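/- All vector spaces are over $\mathbb{C}$. A bornological $*$-algebra is a complete convex bornological vector space $\mathcal{A}$ (every bounded set is contained in a bounded completant disk) with the approximation property (the identity is approximated, uniformly on compact sets, by bounded finite rank operators), equipped with a bounded associative product and a bounded antilinear involution $a\mapsto\overline{a}$. Let $\hat\otimes$ be the completed projective bornological tensor product and $\mathcal{M}(\cdot)$ the algebra of bounded two-sided multipliers. $\mathcal{A}$ is essential if every bounded set of $\mathcal{A}$ is the image under multiplication of a bounded set of $\mathcal{A}\hat\otimes\mathcal{A}$. A bornological quantum group $\mathbb{G}$ is given by an essential bornological $*$-algebra $\mathcal{A}=\mathcal{A}(\mathbb{G})$ together with * an essential bounded $*$-homomorphism $\Delta:\mathcal{A}\to\mathcal{M}(\mathcal{A}\hat\otimes\mathcal{A})$ (essential: every bounded set of $\mathcal{A}\hat\otimes\mathcal{A}$ is the image of a bounded set of $\mathcal{A}\hat\otimes(\mathcal{A}\hat\otimes\mathcal{A})$ under $a\otimes t\mapsto\Delta(a)t$) which is coassociative, $(\Delta\otimes\iota)\Delta=(\iota\otimes\Delta)\Delta$, and whose Galois maps $\gamma_l(a\otimes b)=\Delta(a)(b\otimes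 1)$ and $\rho_r(a\otimes b)=(1\otimes a)\Delta(b)$ are bornological isomorphisms of $\mathcal{A}\hat\otimes\mathcal{A}$ onto itself; * a bounded linear functional $\phi:\mathcal{A}\to\mathbb{C}$ that is positive ($\phi(\overline{a}a)\ge 0$), faithful ($\phi(\overline{a}a)=0$ only for $a=0$), and left invariant ($(\iota\otimes\phi)(\Delta(a))=\phi(a)1$ in $\mathcal{M}(\mathcal{A})$). Let $(L^2(\mathbb{G}),\Lambda)$ be a GNS pair for $\phi$: $L^2(\mathbb{G})$ is a Hilbert space and $\Lambda:\mathcal{A}\to L^2(\mathbb{G})$ is a linear map with dense range such that $\langle\Lambda(f),\Lambda(g)\rangle=\phi(\overline{f}g)$. Theorem. (a) For every $f\in\mathcal{A}$ there is a (unique) bounded operator $m(f)$ on $L^2(\mathbb{G})$ with $m(f)\Lambda(g)=\Lambda(fg)$ for all $g\in\mathcal{A}$, and there is a unique unitary $W$ on $L^2(\mathbb{G})\otimes L^2(\mathbb{G})$ such that $W(\Lambda\hat\otimes\Lambda)(\Delta(g)(f\otimes1))=\Lambda(f)\otimes\Lambda(g)$ for all $f,g\in\mathcal{A}$. (b) The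 norm closure $C=C_0^r(\mathbb{G})$ of $m(\mathcal{A})$ is a $C^*$-subalgebra of $B(L^2(\mathbb{G}))$ that acts non-degenerately: the linear span of $C\,L^2(\mathbb{G})$ is dense in $L^2(\mathbb{G})$. (c) Let $C\otimes C\subset B(L^2(\mathbb{G})\otimes L^2(\mathbb{G}))$ be the spatial (minimal) tensor product, and let $M(C\otimes C)=\{T\in B(L^2(\mathbb{G})\otimes L^2(\mathbb{G})) : T(C\otimes C)\subseteq C\otimes C,\ (C\otimes C)T\subseteq C\otimes C\}$ be its multiplier algebra. Then $\Delta(x)=W^*(1\otimes x)W$ defines an injective $*$-homomorphism $\Delta:C\to M(C\otimes C)$ which is non-degenerate: the closed linear span of $\Delta(C)(C\otimes C)$ is $C\otimes C$. (d) $(\Delta\otimes\iota)\circ\Delta=(\iota\otimes\Delta)\circ\Delta$ as maps $C\to M(C\otimes C\otimes C)$, where $\Delta\otimes\iota$ and $\iota\otimes\Delta$ also denote the extensions to unital $*$-homomorphisms $M(C\otimes C)\to M(C\otimes C\otimes C)$. (e) The linear spans of $\Delta(C)(C\otimes 1)=\{\Delta(x)(y\otimes1) : x,y\in C\}$ and of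 $\Delta(C)(1\otimes C)=\{\Delta(x)(1\otimes y) : x,y\in C\}$ are contained in $C\otimes C$ and dense in it. -/

import Mathlib

open Bornology Filter Topology
open scoped Pointwise TensorProduct ENNReal

universe u v w

set_option linter.unusedSectionVars false
set_option linter.style.haveILetI false

namespace BornQG

/-! ### Complete convex bornological vector spaces -/

/-- A completant disk: a balanced convex set whose span is a Banach space for its gauge. -/
def IsCompletantDisk {V : Type u} [AddCommGroup V] [Module ℂ V] (D : Set V) : Prop :=
  Balanced ℂ D ∧ Convex ℝ D ∧
    ∃ (Y : Type u) (_ : NormedAddCommGroup Y) (_ : NormedSpace ℂ Y) (_ : CompleteSpace Y)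
      (j : Y →ₗ[ℂ] V), Function.Injective j ∧ LinearMap.range j = Submodule.span ℂ D ∧
        ∀ y, ‖y‖ = gauge D (j y)

/-- Complete convex bornological vector spaces (over `ℂ`). -/
class CompleteConvexBornology (V : Type u) [AddCommGroup V] [Module ℂ V] [Bornology V] :
    Prop where
  isBounded_add : ∀ A B : Set V, IsBounded A → IsBounded B → IsBounded (A + B)
  isBounded_smul : ∀ (c : ℂ) (A : Set V), IsBounded A → IsBounded (c • A)
  isBounded_hull : ∀ A : Set V, IsBounded A → IsBounded (convexHull ℝ (balancedHull ℂ A))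
  exists_completant : ∀ A : Set V, IsBounded A → ∃ D, IsBounded D ∧ IsCompletantDisk D ∧ A ⊆ D

/-- Bounded maps: those which send bounded sets to bounded sets. -/
def IsBddMap {V : Type u} {W : Type v} [Bornology V] [Bornology W] (f : V → W) : Prop :=
  ∀ S : Set V, IsBounded S → IsBounded (f '' S)

/-- Bounded maps of two variables. -/
def IsBddMap₂ {V : Type u} {W : Type v} {X : Type w} [Bornology V] [Bornology W] [Bornology X]
    (f : V → W → X) : Prop :=
  ∀ (S : Set V) (T : Set W), IsBounded S → IsBounded T → IsBounded (Set.image2 f S T)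

/-- A Banach space sitting boundedly and injectively in a bornological vector space. -/
structure BanachSub (V : Type u) [AddCommGroup V] [Module ℂ V] [Bornology V] where
  Y : Type u
  [grp : NormedAddCommGroup Y]
  [spc : NormedSpace ℂ Y]
  [cpl : CompleteSpace Y]
  j : Y →ₗ[ℂ] V
  inj : Function.Injective j
  bdd : ∀ C : ℝ, IsBounded (j '' Metric.closedBall 0 C)

attribute [instance] BanachSub.grp BanachSub.spc BanachSub.cpl

section Basic

variable {V : Type u} [AddCommGroup V] [Module ℂ V] [Bornology V]

theorem image_closedBall_eq {Y : Type v} [NormedAddCommGroup Y] [NormedSpace ℂ Y]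
    (j : Y →ₗ[ℂ] V) (C : ℝ) (hC : 0 < C) :
    j '' Metric.closedBall 0 C = (C : ℂ) • (j '' Metric.closedBall 0 1) := by
  have h : Metric.closedBall (0 : Y) C = (C : ℂ) • Metric.closedBall (0 : Y) 1 := by
    rw [smul_unitClosedBall]
    simp [abs_of_pos hC]
  rw [h, image_smul_set]

theorem isCompletantDisk_image {Y : Type u} [NormedAddCommGroup Y] [NormedSpace ℂ Y]
    [CompleteSpace Y] (j : Y →ₗ[ℂ] V) (hj : Function.Injective j) :
    IsCompletantDisk (j '' Metric.closedBall 0 1) := by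
  refine ⟨?_, ?_, Y, inferInstance, inferInstance, inferInstance, j, hj, ?_, ?_⟩
  · intro a ha
    rw [← image_smul_set]
    exact Set.image_mono (balanced_closedBall_zero a ha)
  · exact (convex_closedBall (0 : Y) 1).linear_image (j.restrictScalars ℝ)
  · apply le_antisymm
    · rintro _ ⟨y, rfl⟩
      by_cases hy : y = 0
      · simp [hy]
      have hn : (‖y‖ : ℂ) ≠ 0 := by simpa using hy
      have : j y = (‖y‖ : ℂ) • j ((‖y‖ : ℂ)⁻¹ • y) := by
        rw [map_smul, smul_smul, mul_inv_cancel₀ hn, one_smul]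
      rw [this]
      refine Submodule.smul_mem _ _ (Submodule.subset_span ⟨_, ?_, rfl⟩)
      have : ‖y‖ ≠ 0 := by simpa using hy
      simp [norm_smul, this]
    · rw [Submodule.span_le]
      rintro _ ⟨y, -, rfl⟩
      exact ⟨y, rfl⟩
  · intro y
    have h := gauge_closedBall (zero_le_one) y
    rw [div_one] at h
    rw [← h]
    have hs : ∀ r : ℝ, (j y ∈ r • (j '' Metric.closedBall 0 1)) ↔
        (y ∈ r • Metric.closedBall (0 : Y) 1) := by
      intro r
      have : r • (j '' Metric.closedBall 0 1) = j '' (r • Metric.closedBall (0 : Y) 1) :=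
        (image_smul_set (j.restrictScalars ℝ) r _).symm
      rw [this, hj.mem_set_image]
    simp only [gauge, hs]

theorem exists_banachSub [CompleteConvexBornology V] (S : Set V) (hS : IsBounded S) :
    ∃ E : BanachSub V, S ⊆ E.j '' Metric.closedBall 0 1 := by
  obtain ⟨D, hD, ⟨hbal, hcvx, Y, _, _, _, j, hj, hr, hn⟩, hSD⟩ :=
    CompleteConvexBornology.exists_completant S hS
  have hrc : ∀ r : ℝ, r • D = (r : ℂ) • D := fun r => by
    ext x; simp [Set.mem_smul_set]
  have h2 : j '' Metric.closedBall 0 1 ⊆ (2 : ℂ) • D ∪ {0} := by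
    rintro _ ⟨y, hy, rfl⟩
    by_cases h0 : j y = 0
    · exact Or.inr h0
    have hmem : j y ∈ Submodule.span ℂ D := hr ▸ LinearMap.mem_range_self j y
    have hne : D.Nonempty := by
      by_contra hD0
      rw [Set.not_nonempty_iff_eq_empty] at hD0
      simp [hD0, h0] at hmem
    have hz : (0 : V) ∈ D := hbal.zero_mem hne
    have habs : ∃ r : ℝ, 0 < r ∧ j y ∈ r • D := by
      refine Submodule.span_induction (p := fun x _ => ∃ r : ℝ, 0 < r ∧ x ∈ r • D)
        ?_ ?_ ?_ ?_ hmem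
      · intro x hx
        exact ⟨1, one_pos, by simpa using hx⟩
      · exact ⟨1, one_pos, by simpa using hz⟩
      · rintro x z - - ⟨r, hr, hx⟩ ⟨s, hs, hz⟩
        refine ⟨r + s, by positivity, ?_⟩
        rw [hcvx.add_smul hr.le hs.le]
        exact Set.add_mem_add hx hz
      · rintro a x - ⟨r, hr, hx⟩
        refine ⟨(‖a‖ + 1) * r, by positivity, ?_⟩
        rw [hrc] at hx ⊢
        have h3 : a • x ∈ (a * r : ℂ) • D := by
          rw [mul_smul]; exact Set.smul_mem_smul_set hx
        refine hbal.smul_mono ?_ h3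
        rw [norm_mul, Complex.norm_real, Complex.norm_real, Real.norm_eq_abs, Real.norm_eq_abs,
          abs_of_pos hr, abs_of_pos (by positivity)]
        nlinarith
    have hy' : gauge D (j y) < 2 := by
      rw [← hn]
      have : ‖y‖ ≤ 1 := by simpa using hy
      linarith
    obtain ⟨b, ⟨hb, hx⟩, hb2⟩ := exists_lt_of_csInf_lt habs hy'
    refine Or.inl ?_
    rw [hrc] at hx
    refine hbal.smul_mono ?_ hx
    have hb : 0 < b := hb
    simpa [abs_of_pos hb] using hb2.le
  refine ⟨⟨Y, j, hj, ?_⟩, ?_⟩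
  · intro C
    have hpos : 0 < max C 1 := by positivity
    refine IsBounded.subset ?_ (Set.image_mono (Metric.closedBall_subset_closedBall (le_max_left C 1)))
    rw [image_closedBall_eq j _ hpos]
    exact CompleteConvexBornology.isBounded_smul _ _
      (((CompleteConvexBornology.isBounded_smul _ _ hD).union isBounded_singleton).subset h2)
  · intro x hx
    have hxD := hSD hx
    have hmem : x ∈ LinearMap.range j := hr ▸ Submodule.subset_span hxD
    obtain ⟨y, rfl⟩ := hmem
    refine ⟨y, ?_, rfl⟩
    simpa [hn] using gauge_le_one_of_mem hxD

end Basic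

section Sums

variable {V : Type u} [AddCommGroup V] [Module ℂ V] [Bornology V]

theorem CompleteConvexBornology.of_banachSub
    (hadd : ∀ A B : Set V, IsBounded A → IsBounded B → IsBounded (A + B))
    (hsmul : ∀ (c : ℂ) (A : Set V), IsBounded A → IsBounded (c • A))
    (hE : ∀ A : Set V, IsBounded A → ∃ E : BanachSub V, A ⊆ E.j '' Metric.closedBall 0 1) :
    CompleteConvexBornology V where
  isBounded_add := hadd
  isBounded_smul := hsmul
  isBounded_hull A hA := by
    obtain ⟨E, hE⟩ := hE A hA
    have hD := isCompletantDisk_image E.j E.inj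
    exact (E.bdd 1).subset (convexHull_min (hD.1.balancedHull_subset_of_subset hE) hD.2.1)
  exists_completant A hA := by
    obtain ⟨E, hE⟩ := hE A hA
    exact ⟨_, E.bdd 1, isCompletantDisk_image E.j E.inj, hE⟩

/-- Banach spaces, with the von Neumann bornology of norm-bounded sets. -/
instance instCompleteConvexBanach {X : Type u} [NormedAddCommGroup X] [NormedSpace ℂ X]
    [CompleteSpace X] : CompleteConvexBornology X := by
  refine .of_banachSub (fun A B hA hB => hA.add hB) (fun c A hA => hA.smul₀ c) ?_
  intro A hA
  obtain ⟨C, hC⟩ := hA.subset_closedBall 0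
  set K : ℝ := max C 1 with hK
  have hKpos : 0 < K := by positivity
  have hK0 : (K : ℂ) ≠ 0 := by exact_mod_cast hKpos.ne'
  refine ⟨⟨X, (K : ℂ) • LinearMap.id, ?_, ?_⟩, ?_⟩
  · intro x y h
    exact smul_right_injective X hK0 h
  · intro R
    have : ((K : ℂ) • LinearMap.id : X →ₗ[ℂ] X) '' Metric.closedBall 0 R
      = (K : ℂ) • Metric.closedBall (0 : X) R := by
      ext x; simp [Set.mem_smul_set]
    rw [this]
    exact Metric.isBounded_closedBall.smul₀ _
  · intro x hx
    refine ⟨(K : ℂ)⁻¹ • x, ?_, smul_inv_smul₀ hK0 x⟩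
    have h1 : ‖x‖ ≤ K := by
      have := hC hx
      simp only [Metric.mem_closedBall, dist_zero_right] at this
      exact this.trans (le_max_left _ _)
    simp only [Metric.mem_closedBall, dist_zero_right, norm_smul, norm_inv, Complex.norm_real,
      Real.norm_eq_abs, abs_of_pos hKpos]
    rw [inv_mul_le_iff₀ hKpos]
    simpa using h1

theorem exists_factor [CompleteConvexBornology V] {σ : ℂ →+* ℂ} [RingHomIsometric σ]
    {Y : Type v} [NormedAddCommGroup Y] [NormedSpace ℂ Y] (h : Y →ₛₗ[σ] V)
    (hb : IsBounded (h '' Metric.closedBall 0 1)) :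
    ∃ (E : BanachSub V) (i : Y →SL[σ] E.Y), ∀ y, E.j (i y) = h y := by
  obtain ⟨E, hE⟩ := exists_banachSub _ hb
  have key : ∀ y, ∃ z : E.Y, E.j z = h y ∧ ‖z‖ ≤ ‖y‖ := by
    intro y
    by_cases hy : y = 0
    · exact ⟨0, by simp [hy], by simp⟩
    have hn : ‖y‖ ≠ 0 := by simpa using hy
    have hn' : (‖y‖ : ℂ) ≠ 0 := by exact_mod_cast hn
    obtain ⟨z, hz, hzy⟩ := hE ⟨(‖y‖ : ℂ)⁻¹ • y, by simp [norm_smul, hn], rfl⟩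
    refine ⟨σ (‖y‖ : ℂ) • z, ?_, ?_⟩
    · rw [map_smul, hzy, ← LinearMap.map_smulₛₗ, smul_smul, mul_inv_cancel₀ hn', one_smul]
    · have : ‖z‖ ≤ 1 := by simpa using hz
      rw [norm_smul, RingHomIsometric.norm_map, Complex.norm_real, norm_norm]
      nlinarith [norm_nonneg y]
  choose i hi hin using key
  refine ⟨E, LinearMap.mkContinuous ⟨⟨i, ?_⟩, ?_⟩ 1 ?_, ?_⟩
  · intro x y
    apply E.inj
    simp [hi]
  · intro c x
    apply E.inj
    simp [hi]
  · intro y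
    simpa using hin y
  · intro y
    exact hi y

/-- Unconditional convergence of a series in one of the Banach spaces making up a complete
bornological vector space. -/
def HasBSum {ι : Type w} (f : ι → V) (x : V) : Prop :=
  ∃ (E : BanachSub V) (g : ι → E.Y) (z : E.Y), (∀ p, E.j (g p) = f p) ∧ HasSum g z ∧ E.j z = x

theorem HasBSum.map {X : Type v} [AddCommGroup X] [Module ℂ X] [Bornology X]
    [CompleteConvexBornology X] {σ : ℂ →+* ℂ} [RingHomIsometric σ] {ι : Type w} {f : ι → V}
    {x : V} (hf : HasBSum f x) (h : V →ₛₗ[σ] X) (hh : IsBddMap h) :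
    HasBSum (fun p => h (f p)) (h x) := by
  obtain ⟨E, g, z, hg, hz, rfl⟩ := hf
  obtain ⟨E', i, hi⟩ := exists_factor (h.comp E.j) (by
    have := hh _ (E.bdd 1)
    rwa [Set.image_image] at this)
  refine ⟨E', fun p => i (g p), i z, ?_, hz.mapL i, ?_⟩
  · intro p
    rw [hi]
    exact congrArg h (hg p)
  · rw [hi]; rfl

theorem BanachSub.directed [CompleteConvexBornology V] (E₁ E₂ : BanachSub V) :
    ∃ (E : BanachSub V) (i₁ : E₁.Y →L[ℂ] E.Y) (i₂ : E₂.Y →L[ℂ] E.Y),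
      (∀ y, E.j (i₁ y) = E₁.j y) ∧ ∀ y, E.j (i₂ y) = E₂.j y := by
  obtain ⟨E, i, hi⟩ := exists_factor (LinearMap.coprod E₁.j E₂.j) (by
    refine (CompleteConvexBornology.isBounded_add _ _ (E₁.bdd 1) (E₂.bdd 1)).subset ?_
    rintro _ ⟨⟨y, z⟩, hyz, rfl⟩
    simp only [Metric.mem_closedBall, dist_zero_right, Prod.norm_mk, sup_le_iff] at hyz
    refine Set.add_mem_add ⟨y, ?_, rfl⟩ ⟨z, ?_, rfl⟩
    · simpa using hyz.1
    · simpa using hyz.2)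
  refine ⟨E, i.comp (ContinuousLinearMap.inl ℂ _ _), i.comp (ContinuousLinearMap.inr ℂ _ _), ?_, ?_⟩
  · intro y; simp [hi]
  · intro y; simp [hi]

theorem HasBSum.unique [CompleteConvexBornology V] {ι : Type w} {f : ι → V} {x y : V}
    (hx : HasBSum f x) (hy : HasBSum f y) : x = y := by
  obtain ⟨E₁, g₁, z₁, hg₁, hz₁, rfl⟩ := hx
  obtain ⟨E₂, g₂, z₂, hg₂, hz₂, rfl⟩ := hy
  obtain ⟨E, i₁, i₂, h₁, h₂⟩ := E₁.directed E₂
  rw [← h₁, ← h₂]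
  congr 1
  refine (hz₁.mapL i₁).unique ?_
  convert hz₂.mapL i₂ using 2 with p
  apply E.inj
  rw [h₁, h₂, hg₁, hg₂]

theorem HasBSum.add [CompleteConvexBornology V] {ι : Type w} {f f' : ι → V} {x y : V}
    (hx : HasBSum f x) (hy : HasBSum f' y) : HasBSum (fun p => f p + f' p) (x + y) := by
  obtain ⟨E₁, g₁, z₁, hg₁, hz₁, rfl⟩ := hx
  obtain ⟨E₂, g₂, z₂, hg₂, hz₂, rfl⟩ := hy
  obtain ⟨E, i₁, i₂, h₁, h₂⟩ := E₁.directed E₂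
  refine ⟨E, fun p => i₁ (g₁ p) + i₂ (g₂ p), i₁ z₁ + i₂ z₂, ?_,
    (hz₁.mapL i₁).add (hz₂.mapL i₂), ?_⟩
  · intro p; simp [h₁, h₂, hg₁, hg₂]
  · simp [h₁, h₂]

theorem HasBSum.const_smul {ι : Type w} {f : ι → V} {x : V}
    (hx : HasBSum f x) (c : ℂ) : HasBSum (fun p => c • f p) (c • x) := by
  obtain ⟨E, g, z, hg, hz, rfl⟩ := hx
  exact ⟨E, fun p => c • g p, c • z, fun p => by simp [hg], hz.const_smul c, by simp⟩

end Sums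

/-! ### The completed tensor product -/

section CTensor

variable (V : Type u) (W : Type v) [AddCommGroup V] [Module ℂ V] [Bornology V]
  [AddCommGroup W] [Module ℂ W] [Bornology W]

/-- Absolutely summable families of complex numbers indexed by `V × W`. -/
abbrev L1 : Type (max u v) := lp (fun _ : V × W => ℂ) 1

variable {V W}

/-- The closed subspace of families supported in `B × D`. -/
noncomputable def suppSub (B : Set V) (D : Set W) : Submodule ℂ (L1 V W) where
  carrier := {c | ∀ p : V × W, ¬ (p.1 ∈ B ∧ p.2 ∈ D) → c p = 0}
  add_mem' := by
    intro a b ha hb p hp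
    simp [ha p hp, hb p hp]
  zero_mem' := by
    intro p _
    simp
  smul_mem' := by
    intro k a ha p hp
    simp [ha p hp]

/-- The family `δ_{(v, w)}`. -/
noncomputable def delta (v : V) (w : W) : L1 V W :=
  letI := Classical.decEq (V × W)
  lp.single 1 (v, w) (1 : ℂ)

variable (V W)

/-- Absolutely summable families with bounded support: the free complete bornological vector
space on `V × W`. -/
noncomputable def bddSub : Submodule ℂ (L1 V W) where
  carrier := {c | ∃ (B : Set V) (D : Set W), IsBounded B ∧ IsBounded D ∧ c ∈ suppSub B D}
  add_mem' := by
    rintro a b ⟨B, D, hB, hD, ha⟩ ⟨B', D', hB', hD', hb⟩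
    refine ⟨B ∪ B', D ∪ D', hB.union hB', hD.union hD', ?_⟩
    refine Submodule.add_mem _ (fun p hp => ha p fun h => hp ⟨Or.inl h.1, Or.inl h.2⟩)
      (fun p hp => hb p fun h => hp ⟨Or.inr h.1, Or.inr h.2⟩)
  zero_mem' := ⟨∅, ∅, isBounded_empty, isBounded_empty, Submodule.zero_mem _⟩
  smul_mem' := by
    rintro k a ⟨B, D, hB, hD, ha⟩
    exact ⟨B, D, hB, hD, Submodule.smul_mem _ _ ha⟩

/-- The relations expressing bilinearity of `(v, w) ↦ δ_{(v, w)}`. -/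
noncomputable def bilinRel : Set (L1 V W) :=
  {c | ∃ v v' w, c = delta (v + v') w - delta v w - delta v' w} ∪
  {c | ∃ v w w', c = delta v (w + w') - delta v w - delta v w'} ∪
  {c | ∃ (k : ℂ) (v : V) (w : W), c = delta (k • v) w - k • delta v w} ∪
  {c | ∃ (k : ℂ) (v : V) (w : W), c = delta v (k • w) - k • delta v w}

variable {V W}

/-- Bornologically closed subspaces: those with closed intersection with each of the Banach
spaces `ℓ¹(B × D)`, where `B` and `D` are bounded. -/
def IsBClosed (M : Submodule ℂ (L1 V W)) : Prop :=
  ∀ (B : Set V) (D : Set W), IsBounded B → IsBounded D →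
    IsClosed ((M ⊓ suppSub B D : Submodule ℂ (L1 V W)) : Set (L1 V W))

variable (V W)

/-- The bornological closure of the span of the bilinearity relations. -/
noncomputable def relSub : Submodule ℂ (L1 V W) := sInf {M | bilinRel V W ⊆ M ∧ IsBClosed M}

/-- The completed (projective) bornological tensor product `V ⊗̂ W`. -/
noncomputable def CTensor : Type (max u v) := bddSub V W ⧸ (relSub V W).comap (bddSub V W).subtype

noncomputable instance : AddCommGroup (CTensor V W) :=
  inferInstanceAs (AddCommGroup (bddSub V W ⧸ (relSub V W).comap (bddSub V W).subtype))

noncomputable instance : Module ℂ (CTensor V W) :=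
  inferInstanceAs (Module ℂ (bddSub V W ⧸ (relSub V W).comap (bddSub V W).subtype))

namespace CTensor

/-- The class of a family. -/
noncomputable def mk : bddSub V W →ₗ[ℂ] CTensor V W := ((relSub V W).comap (bddSub V W).subtype).mkQ

variable {V W}

theorem mk_surjective : Function.Surjective (mk V W) := Submodule.mkQ_surjective _

theorem mk_eq_zero {c : bddSub V W} : mk V W c = 0 ↔ (c : L1 V W) ∈ relSub V W := by
  simp only [mk]
  exact Submodule.Quotient.mk_eq_zero _

/-- The image of the ball of radius `C` of the Banach space `ℓ¹(B × D)`. -/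
noncomputable def ball (B : Set V) (D : Set W) (C : ℝ) : Set (CTensor V W) :=
  mk V W '' {c | (c : L1 V W) ∈ suppSub B D ∧ ‖(c : L1 V W)‖ ≤ C}

theorem ball_mono {B B' : Set V} {D D' : Set W} {C C' : ℝ} (hB : B ⊆ B') (hD : D ⊆ D')
    (hC : C ≤ C') : ball B D C ⊆ ball B' D' C' := by
  apply Set.image_mono
  rintro c ⟨hc, hn⟩
  exact ⟨fun p hp => hc p fun h => hp ⟨hB h.1, hD h.2⟩, hn.trans hC⟩

/-- A subset of `V ⊗̂ W` is bounded when it lies in the image of a ball of `ℓ¹(B × D)` for some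
bounded sets `B` and `D`. -/
instance : Bornology (CTensor V W) :=
  Bornology.ofBounded
    {S | ∃ (B : Set V) (D : Set W) (C : ℝ), IsBounded B ∧ IsBounded D ∧ S ⊆ ball B D C}
    ⟨∅, ∅, 0, isBounded_empty, isBounded_empty, Set.empty_subset _⟩
    (by
      rintro S ⟨B, D, C, hB, hD, hS⟩ S' hS'
      exact ⟨B, D, C, hB, hD, hS'.trans hS⟩)
    (by
      rintro S ⟨B, D, C, hB, hD, hS⟩ S' ⟨B', D', C', hB', hD', hS'⟩
      refine ⟨B ∪ B', D ∪ D', max C C', hB.union hB', hD.union hD', Set.union_subset ?_ ?_⟩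
      · exact hS.trans (ball_mono Set.subset_union_left Set.subset_union_left (le_max_left _ _))
      · exact hS'.trans
          (ball_mono Set.subset_union_right Set.subset_union_right (le_max_right _ _)))
    (by
      intro x
      obtain ⟨c, rfl⟩ := mk_surjective x
      obtain ⟨B, D, hB, hD, hc⟩ := c.2
      refine ⟨B, D, ‖(c : L1 V W)‖, hB, hD, ?_⟩
      rintro _ rfl
      exact ⟨c, ⟨hc, le_rfl⟩, rfl⟩)

theorem isBounded_iff {S : Set (CTensor V W)} : IsBounded S ↔
    ∃ (B : Set V) (D : Set W) (C : ℝ), IsBounded B ∧ IsBounded D ∧ S ⊆ ball B D C := by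
  rw [isBounded_def]
  exact Filter.mem_comk.trans (by simp)

end CTensor
end CTensor

section CTensor2

variable {V : Type u} {W : Type v} [AddCommGroup V] [Module ℂ V] [Bornology V]
  [AddCommGroup W] [Module ℂ W] [Bornology W]

theorem isClosed_suppSub (B : Set V) (D : Set W) :
    IsClosed (suppSub B D : Set (L1 V W)) := by
  have : (suppSub B D : Set (L1 V W)) =
      ⋂ p ∈ {p : V × W | ¬ (p.1 ∈ B ∧ p.2 ∈ D)}, {c : L1 V W | c p = 0} := by
    ext c; simp [suppSub]
  rw [this]
  refine isClosed_biInter fun p _ => ?_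
  exact isClosed_eq (lp.evalCLM ℂ (fun _ : V × W => ℂ) 1 p).continuous continuous_const

theorem suppSub_le_bddSub {B : Set V} {D : Set W} (hB : IsBounded B) (hD : IsBounded D) :
    suppSub B D ≤ bddSub V W := fun _ hc => ⟨B, D, hB, hD, hc⟩

theorem delta_mem_suppSub {B : Set V} {D : Set W} {v : V} {w : W} (hv : v ∈ B) (hw : w ∈ D) :
    delta v w ∈ suppSub B D := by
  classical
  intro p hp
  have : p ≠ (v, w) := by
    rintro rfl
    exact hp ⟨hv, hw⟩
  simp [delta, this]

theorem delta_mem_bddSub (v : V) (w : W) : delta v w ∈ bddSub V W :=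
  suppSub_le_bddSub (isBounded_singleton (x := v)) (isBounded_singleton (x := w))
    (delta_mem_suppSub rfl rfl)

theorem norm_delta (v : V) (w : W) : ‖(delta v w : L1 V W)‖ = 1 := by
  letI := Classical.decEq (V × W)
  have h := @lp.norm_single (V × W) (fun _ => ℂ) 1 _ (Classical.decEq (V × W)) (by norm_num)
    (v, w) (1 : ℂ)
  exact h.trans norm_one

theorem hasSum_delta (c : L1 V W) : HasSum (fun p : V × W => c p • delta p.1 p.2) c := by
  classical
  convert lp.hasSum_single (E := fun _ : V × W => ℂ) (p := 1) (by norm_num) c using 2 with p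
  ext q
  by_cases h : q = p
  · subst h; simp [delta]
  · simp [delta, h]

/-- A bornologically closed subspace containing all the `δ_{(v, w)}` contains everything. -/
theorem IsBClosed.bddSub_le {M : Submodule ℂ (L1 V W)} (hM : IsBClosed M)
    (h : ∀ v w, delta v w ∈ M) : bddSub V W ≤ M := by
  rintro c ⟨B, D, hB, hD, hc⟩
  have hmem : c ∈ ((M ⊓ suppSub B D : Submodule ℂ (L1 V W)) : Set (L1 V W)) := by
    refine (hM B D hB hD).mem_of_tendsto (hasSum_delta c) (Eventually.of_forall fun s => ?_)
    refine Submodule.sum_mem _ fun p _ => ?_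
    by_cases hp : p.1 ∈ B ∧ p.2 ∈ D
    · exact Submodule.smul_mem _ _ ⟨h _ _, delta_mem_suppSub hp.1 hp.2⟩
    · rw [hc p hp, zero_smul]
      exact Submodule.zero_mem _
  exact hmem.1

theorem isBClosed_bddSub : IsBClosed (bddSub V W) := by
  intro B D hB hD
  rw [inf_eq_right.2 (suppSub_le_bddSub hB hD)]
  exact isClosed_suppSub B D

theorem isBClosed_sInf {S : Set (Submodule ℂ (L1 V W))} (hS : ∀ M ∈ S, IsBClosed M) :
    IsBClosed (sInf S) := by
  intro B D hB hD
  have : ((sInf S ⊓ suppSub B D : Submodule ℂ (L1 V W)) : Set (L1 V W)) =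
      (⋂ M ∈ S, ((M ⊓ suppSub B D : Submodule ℂ (L1 V W)) : Set (L1 V W))) ∩ suppSub B D := by
    ext c
    simp only [Submodule.coe_inf, Set.mem_inter_iff, SetLike.mem_coe, Submodule.mem_sInf,
      Set.mem_iInter]
    exact ⟨fun h => ⟨fun M hM => ⟨h.1 M hM, h.2⟩, h.2⟩, fun h => ⟨fun M hM => (h.1 M hM).1, h.2⟩⟩
  rw [this]
  exact (isClosed_biInter fun M hM => hS M hM B D hB hD).inter (isClosed_suppSub B D)

theorem isBClosed_relSub : IsBClosed (relSub V W) := isBClosed_sInf fun _ h => h.2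

theorem bilinRel_subset : bilinRel V W ⊆ relSub V W := by
  intro c hc
  simp only [relSub, SetLike.mem_coe, Submodule.mem_sInf]
  exact fun M hM => hM.1 hc

theorem relSub_le_of {M : Submodule ℂ (L1 V W)} (h : bilinRel V W ⊆ M) (hM : IsBClosed M) :
    relSub V W ≤ M := sInf_le ⟨h, hM⟩

variable {X : Type w} [AddCommGroup X] [Module ℂ X] [Bornology X] [CompleteConvexBornology X]
  {σ : ℂ →+* ℂ} [RingHomIsometric σ]

/-- Kernels of bounded maps are bornologically closed. -/
theorem isBClosed_ker (h : bddSub V W →ₛₗ[σ] X)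
    (hb : ∀ (B : Set V) (D : Set W), IsBounded B → IsBounded D →
      IsBounded (h '' {c | (c : L1 V W) ∈ suppSub B D ∧ ‖(c : L1 V W)‖ ≤ 1})) :
    IsBClosed ((LinearMap.ker h).map (bddSub V W).subtype) := by
  intro B D hB hD
  have hle := suppSub_le_bddSub hB hD
  obtain ⟨E, i, hi⟩ := exists_factor (h.comp (Submodule.inclusion hle)) (by
    refine (hb B D hB hD).subset ?_
    rintro _ ⟨c, hc, rfl⟩
    exact ⟨Submodule.inclusion hle c, ⟨c.2, by simpa using hc⟩, rfl⟩)
  have hk : IsClosed ((LinearMap.ker i.toLinearMap : Submodule ℂ (suppSub B D)) :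
      Set (suppSub B D)) := i.isClosed_ker
  have := (isClosed_suppSub B D).isClosedEmbedding_subtypeVal.isClosedMap _ hk
  convert this using 1
  ext c
  constructor
  · rintro ⟨⟨c, hc, rfl⟩, hc'⟩
    refine ⟨⟨c, hc'⟩, ?_, rfl⟩
    change i ⟨c, hc'⟩ = 0
    apply E.inj
    rw [hi, map_zero]
    exact hc
  · rintro ⟨c, hc, rfl⟩
    refine ⟨⟨Submodule.inclusion hle c, ?_, rfl⟩, c.2⟩
    have hc : i c = 0 := hc
    have := hi c
    rw [hc, map_zero] at this
    exact this.symm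

namespace CTensor

theorem _root_.BornQG.banachSub_of_map {F : Type w} [NormedAddCommGroup F] [NormedSpace ℂ F]
    [CompleteSpace F] {X : Type w} [AddCommGroup X] [Module ℂ X] [Bornology X] (q : F →ₗ[ℂ] X)
    (hq : IsClosed (LinearMap.ker q : Set F))
    (hb : ∀ C : ℝ, IsBounded (q '' Metric.closedBall 0 C)) :
    ∃ E : BanachSub X, q '' Metric.closedBall 0 1 ⊆ E.j '' Metric.closedBall 0 1 := by
  haveI := hq
  refine ⟨⟨F ⧸ LinearMap.ker q, (LinearMap.ker q).liftQ q le_rfl, ?_, ?_⟩, ?_⟩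
  · rw [← LinearMap.ker_eq_bot]
    exact Submodule.ker_liftQ_eq_bot _ _ _ le_rfl
  · intro C
    refine (hb (C + 1)).subset ?_
    rintro _ ⟨y, hy, rfl⟩
    have hy : ‖y‖ ≤ C := by simpa using hy
    obtain ⟨c, rfl, hc⟩ := Submodule.Quotient.norm_mk_lt y (ε := 1) one_pos
    exact ⟨c, by rw [mem_closedBall_zero_iff]; linarith, rfl⟩
  · rintro _ ⟨c, hc, rfl⟩
    refine ⟨(LinearMap.ker q).mkQ c, ?_, rfl⟩
    rw [mem_closedBall_zero_iff] at hc ⊢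
    exact (Submodule.Quotient.norm_mk_le _ _).trans hc

theorem ball_isBounded {B : Set V} {D : Set W} (hB : IsBounded B) (hD : IsBounded D) (C : ℝ) :
    IsBounded (ball B D C) := isBounded_iff.2 ⟨B, D, C, hB, hD, subset_rfl⟩

variable (V W) in
/-- The canonical bilinear map `V × W → V ⊗̂ W`. -/
noncomputable def tmulBilin : V →ₗ[ℂ] W →ₗ[ℂ] CTensor V W :=
  LinearMap.mk₂ ℂ (fun v w => mk V W ⟨delta v w, delta_mem_bddSub v w⟩)
    (by
      intro v v' w
      rw [← sub_eq_zero, ← sub_sub, ← map_sub, ← map_sub, mk_eq_zero]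
      exact bilinRel_subset (Or.inl (Or.inl (Or.inl ⟨v, v', w, rfl⟩))))
    (by
      intro k v w
      rw [← sub_eq_zero, ← map_smul, ← map_sub, mk_eq_zero]
      exact bilinRel_subset (Or.inl (Or.inr ⟨k, v, w, rfl⟩)))
    (by
      intro v w w'
      rw [← sub_eq_zero, ← sub_sub, ← map_sub, ← map_sub, mk_eq_zero]
      exact bilinRel_subset (Or.inl (Or.inl (Or.inr ⟨v, w, w', rfl⟩))))
    (by
      intro k v w
      rw [← sub_eq_zero, ← map_smul, ← map_sub, mk_eq_zero]
      exact bilinRel_subset (Or.inr ⟨k, v, w, rfl⟩))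

/-- The elementary tensor `v ⊗ w`. -/
noncomputable def tmul (v : V) (w : W) : CTensor V W := tmulBilin V W v w

theorem tmulBilin_isBdd : IsBddMap₂ (fun v w => tmulBilin V W v w) := by
  intro B D hB hD
  refine (ball_isBounded hB hD 1).subset ?_
  rintro _ ⟨v, hv, w, hw, rfl⟩
  exact ⟨⟨delta v w, _⟩, ⟨delta_mem_suppSub hv hw, (norm_delta v w).le⟩, rfl⟩

/-- Bounded maps out of `V ⊗̂ W` are determined by their values on elementary tensors. -/
theorem hom_ext {f g : CTensor V W →ₛₗ[σ] X} (hf : IsBddMap f) (hg : IsBddMap g)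
    (h : ∀ v w, f (tmul v w) = g (tmul v w)) : f = g := by
  have hfg : ∀ S : Set (CTensor V W), IsBounded S → IsBounded ((f - g) '' S) := by
    intro S hS
    refine (CompleteConvexBornology.isBounded_add _ _ (hf S hS)
      (CompleteConvexBornology.isBounded_smul (-1) _ (hg S hS))).subset ?_
    rintro _ ⟨x, hx, rfl⟩
    exact ⟨f x, ⟨x, hx, rfl⟩, (-1 : ℂ) • g x, ⟨g x, ⟨x, hx, rfl⟩, rfl⟩, by
      simp [sub_eq_add_neg]⟩
  have hcl := isBClosed_ker ((f - g).comp (mk V W)) (by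
    intro B D hB hD
    refine (hfg _ (ball_isBounded hB hD 1)).subset ?_
    rintro _ ⟨c, hc, rfl⟩
    exact ⟨mk V W c, ⟨c, hc, rfl⟩, rfl⟩)
  have hle := hcl.bddSub_le (by
    intro v w
    refine ⟨⟨delta v w, delta_mem_bddSub v w⟩, ?_, rfl⟩
    exact sub_eq_zero.2 (h v w))
  ext x
  obtain ⟨c, rfl⟩ := mk_surjective x
  obtain ⟨c', hc', hcc⟩ := hle c.2
  obtain rfl : c' = c := Subtype.ext hcc
  exact sub_eq_zero.1 hc'

/-- Existence of the sum defining the lift, with control of its position. -/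
theorem exists_sum (β : V →ₛₗ[σ] W →ₛₗ[σ] X) {B : Set V} {D : Set W} (E : BanachSub X)
    (hE : ∀ v ∈ B, ∀ w ∈ D, β v w ∈ E.j '' Metric.closedBall 0 1) {c : L1 V W}
    (hc : c ∈ suppSub B D) :
    ∃ x ∈ E.j '' Metric.closedBall 0 ‖c‖,
      HasBSum (fun p : V × W => σ (c p) • β p.1 p.2) x := by
  have key : ∀ p : V × W, ∃ y : E.Y, E.j y = σ (c p) • β p.1 p.2 ∧ ‖y‖ ≤ ‖c p‖ := by
    intro p
    by_cases hp : p.1 ∈ B ∧ p.2 ∈ D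
    · obtain ⟨y, hy, hyp⟩ := hE _ hp.1 _ hp.2
      refine ⟨σ (c p) • y, by rw [map_smul, hyp], ?_⟩
      rw [norm_smul, RingHomIsometric.norm_map]
      have : ‖y‖ ≤ 1 := by simpa using hy
      nlinarith [norm_nonneg (c p)]
    · exact ⟨0, by simp [hc p hp], by simp⟩
  choose y hy hyn using key
  have hs : HasSum (fun p => ‖c p‖) ‖c‖ := by
    simpa using lp.hasSum_norm (p := 1) (by norm_num) c
  have hsum : Summable y := Summable.of_norm_bounded hs.summable hyn
  refine ⟨E.j (∑' p, y p), ⟨_, ?_, rfl⟩, E, y, _, hy, hsum.hasSum, rfl⟩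
  rw [mem_closedBall_zero_iff]
  exact tsum_of_norm_bounded hs hyn

theorem exists_sum' (β : V →ₛₗ[σ] W →ₛₗ[σ] X) (hβ : IsBddMap₂ (fun v w => β v w))
    (c : bddSub V W) : ∃ x, HasBSum (fun p : V × W => σ ((c : L1 V W) p) • β p.1 p.2) x := by
  obtain ⟨B, D, hB, hD, hc⟩ := c.2
  obtain ⟨E, hE⟩ := exists_banachSub _ (hβ B D hB hD)
  obtain ⟨x, -, hx⟩ := exists_sum β E (fun v hv w hw => hE ⟨v, hv, w, hw, rfl⟩) hc
  exact ⟨x, hx⟩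

/-- `c ↦ ∑ σ (c (v, w)) β (v, w)`. -/
noncomputable def liftAux (β : V →ₛₗ[σ] W →ₛₗ[σ] X) (hβ : IsBddMap₂ (fun v w => β v w)) :
    bddSub V W →ₛₗ[σ] X where
  toFun c := (exists_sum' β hβ c).choose
  map_add' c d := by
    refine (exists_sum' β hβ (c + d)).choose_spec.unique ?_
    convert (exists_sum' β hβ c).choose_spec.add (exists_sum' β hβ d).choose_spec using 2 with p
    simp [add_smul]
  map_smul' k c := by
    refine (exists_sum' β hβ (k • c)).choose_spec.unique ?_
    convert (exists_sum' β hβ c).choose_spec.const_smul (σ k) using 2 with p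
    simp [mul_smul]

theorem liftAux_hasBSum (β : V →ₛₗ[σ] W →ₛₗ[σ] X) (hβ : IsBddMap₂ (fun v w => β v w))
    (c : bddSub V W) :
    HasBSum (fun p : V × W => σ ((c : L1 V W) p) • β p.1 p.2) (liftAux β hβ c) :=
  (exists_sum' β hβ c).choose_spec

theorem liftAux_bdd {ι : Type*} (β : ι → V →ₛₗ[σ] W →ₛₗ[σ] X)
    (hβ : ∀ i, IsBddMap₂ (fun v w => β i v w)) (B : Set V) (D : Set W)
    (hu : IsBounded {x | ∃ i, ∃ v ∈ B, ∃ w ∈ D, x = β i v w}) (C : ℝ) :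
    IsBounded {x | ∃ i, ∃ c : bddSub V W, (c : L1 V W) ∈ suppSub B D ∧ ‖(c : L1 V W)‖ ≤ C ∧
      x = liftAux (β i) (hβ i) c} := by
  obtain ⟨E, hE⟩ := exists_banachSub _ hu
  refine (E.bdd C).subset ?_
  rintro _ ⟨i, c, hc, hn, rfl⟩
  obtain ⟨x, hx, hs⟩ := exists_sum (β i) E (fun v hv w hw => hE ⟨i, v, hv, w, hw, rfl⟩) hc
  rw [(liftAux_hasBSum (β i) (hβ i) c).unique hs]
  exact Set.image_mono (Metric.closedBall_subset_closedBall hn) hx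

theorem liftAux_delta (β : V →ₛₗ[σ] W →ₛₗ[σ] X) (hβ : IsBddMap₂ (fun v w => β v w))
    (v : V) (w : W) : liftAux β hβ ⟨delta v w, delta_mem_bddSub v w⟩ = β v w := by
  classical
  refine (liftAux_hasBSum β hβ _).unique ?_
  obtain ⟨E, hE⟩ := exists_banachSub {β v w} isBounded_singleton
  obtain ⟨y, -, hy⟩ := hE rfl
  refine ⟨E, fun p => if p = (v, w) then y else 0, y, ?_, hasSum_ite_eq _ _, hy⟩
  intro p
  by_cases hp : p = (v, w)
  · subst hp; simp [delta, hy]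
  · simp [delta, hp]

/-- The universal property of `V ⊗̂ W`: a bounded bilinear map `β : V × W → X` (or bi-semilinear
map) induces a bounded linear map `V ⊗̂ W → X`. -/
noncomputable def lift (β : V →ₛₗ[σ] W →ₛₗ[σ] X) (hβ : IsBddMap₂ (fun v w => β v w)) :
    CTensor V W →ₛₗ[σ] X :=
  Submodule.liftQ _ (liftAux β hβ) (by
    have hcl := isBClosed_ker (liftAux β hβ) (by
      intro B D hB hD
      refine (liftAux_bdd (fun _ : Unit => β) (fun _ => hβ) B D ?_ 1).subset ?_
      · refine (hβ B D hB hD).subset ?_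
        rintro _ ⟨-, v, hv, w, hw, rfl⟩
        exact ⟨v, hv, w, hw, rfl⟩
      · rintro _ ⟨c, hc, rfl⟩
        exact ⟨(), c, hc.1, hc.2, rfl⟩)
    have hle : relSub V W ≤ (LinearMap.ker (liftAux β hβ)).map (bddSub V W).subtype := by
      refine relSub_le_of ?_ hcl
      have hd := liftAux_delta β hβ
      rintro c (((⟨v, v', w, rfl⟩ | ⟨v, w, w', rfl⟩) | ⟨k, v, w, rfl⟩) | ⟨k, v, w, rfl⟩)
      · refine ⟨⟨delta (v + v') w, delta_mem_bddSub _ _⟩ - ⟨delta v w, delta_mem_bddSub _ _⟩ -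
          ⟨delta v' w, delta_mem_bddSub _ _⟩, ?_, rfl⟩
        simp [hd]
      · refine ⟨⟨delta v (w + w'), delta_mem_bddSub _ _⟩ - ⟨delta v w, delta_mem_bddSub _ _⟩ -
          ⟨delta v w', delta_mem_bddSub _ _⟩, ?_, rfl⟩
        simp [hd]
      · refine ⟨⟨delta (k • v) w, delta_mem_bddSub _ _⟩ - k • ⟨delta v w, delta_mem_bddSub _ _⟩,
          ?_, rfl⟩
        rw [SetLike.mem_coe, LinearMap.mem_ker, map_sub, LinearMap.map_smulₛₗ, hd, hd]
        simp
      · refine ⟨⟨delta v (k • w), delta_mem_bddSub _ _⟩ - k • ⟨delta v w, delta_mem_bddSub _ _⟩,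
          ?_, rfl⟩
        rw [SetLike.mem_coe, LinearMap.mem_ker, map_sub, LinearMap.map_smulₛₗ, hd, hd]
        simp
    intro c hc
    obtain ⟨c', hc', hcc⟩ := hle hc
    obtain rfl : c' = c := Subtype.ext hcc
    exact hc')

theorem lift_mk (β : V →ₛₗ[σ] W →ₛₗ[σ] X) (hβ : IsBddMap₂ (fun v w => β v w)) (c : bddSub V W) :
    lift β hβ (mk V W c) = liftAux β hβ c := rfl

@[simp]
theorem lift_tmul (β : V →ₛₗ[σ] W →ₛₗ[σ] X) (hβ : IsBddMap₂ (fun v w => β v w)) (v : V) (w : W) :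
    lift β hβ (tmul v w) = β v w := liftAux_delta β hβ v w

theorem lift_bdd_family {ι : Type*} (β : ι → V →ₛₗ[σ] W →ₛₗ[σ] X)
    (hβ : ∀ i, IsBddMap₂ (fun v w => β i v w))
    (hu : ∀ (B : Set V) (D : Set W), IsBounded B → IsBounded D →
      IsBounded {x | ∃ i, ∃ v ∈ B, ∃ w ∈ D, x = β i v w})
    (S : Set (CTensor V W)) (hS : IsBounded S) :
    IsBounded {x | ∃ i, ∃ t ∈ S, x = lift (β i) (hβ i) t} := by
  obtain ⟨B, D, C, hB, hD, hS⟩ := isBounded_iff.1 hS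
  refine (liftAux_bdd β hβ B D (hu B D hB hD) C).subset ?_
  rintro _ ⟨i, t, ht, rfl⟩
  obtain ⟨c, ⟨hc, hn⟩, rfl⟩ := hS ht
  exact ⟨i, c, hc, hn, rfl⟩

theorem lift_isBdd (β : V →ₛₗ[σ] W →ₛₗ[σ] X) (hβ : IsBddMap₂ (fun v w => β v w)) :
    IsBddMap (lift β hβ) := by
  intro S hS
  refine (lift_bdd_family (fun _ : Unit => β) (fun _ => hβ) (fun B D hB hD => ?_) S hS).subset ?_
  · refine (hβ B D hB hD).subset ?_
    rintro _ ⟨-, v, hv, w, hw, rfl⟩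
    exact ⟨v, hv, w, hw, rfl⟩
  · rintro _ ⟨t, ht, rfl⟩
    exact ⟨(), t, ht, rfl⟩

instance : CompleteConvexBornology (CTensor V W) := by
  refine .of_banachSub ?_ ?_ ?_
  · intro S S' hS hS'
    obtain ⟨B, D, C, hB, hD, hS⟩ := isBounded_iff.1 hS
    obtain ⟨B', D', C', hB', hD', hS'⟩ := isBounded_iff.1 hS'
    refine isBounded_iff.2 ⟨B ∪ B', D ∪ D', C + C', hB.union hB', hD.union hD', ?_⟩
    rintro _ ⟨x, hx, y, hy, rfl⟩
    obtain ⟨c, ⟨hc, hn⟩, rfl⟩ := ball_mono Set.subset_union_left Set.subset_union_left le_rfl (hS hx)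
    obtain ⟨d, ⟨hd, hm⟩, rfl⟩ :=
      ball_mono Set.subset_union_right Set.subset_union_right le_rfl (hS' hy)
    exact ⟨c + d, ⟨Submodule.add_mem _ hc hd, (norm_add_le _ _).trans (add_le_add hn hm)⟩,
      map_add _ _ _⟩
  · intro k S hS
    obtain ⟨B, D, C, hB, hD, hS⟩ := isBounded_iff.1 hS
    refine isBounded_iff.2 ⟨B, D, ‖k‖ * C, hB, hD, ?_⟩
    rintro _ ⟨x, hx, rfl⟩
    obtain ⟨c, ⟨hc, hn⟩, rfl⟩ := hS hx
    refine ⟨k • c, ⟨Submodule.smul_mem _ _ hc, ?_⟩, map_smul _ _ _⟩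
    change ‖k • (c : L1 V W)‖ ≤ _
    rw [norm_smul]
    gcongr
  · intro S hS
    obtain ⟨B, D, C, hB, hD, hS⟩ := isBounded_iff.1 hS
    have hle := suppSub_le_bddSub hB hD
    have : CompleteSpace (suppSub B D) := (isClosed_suppSub B D).completeSpace_coe
    set K : ℝ := max C 1 with hK
    have hKpos : 0 < K := by positivity
    have hK0 : (K : ℂ) ≠ 0 := by exact_mod_cast hKpos.ne'
    let q : suppSub B D →ₗ[ℂ] CTensor V W :=
      (K : ℂ) • (mk V W).comp (Submodule.inclusion hle)
    have hq : (LinearMap.ker q : Set (suppSub B D)) = (fun c : suppSub B D => (c : L1 V W)) ⁻¹'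
        ((relSub V W ⊓ suppSub B D : Submodule ℂ (L1 V W)) : Set (L1 V W)) := by
      ext c
      have h1 : q c = 0 ↔ mk V W (Submodule.inclusion hle c) = 0 := by
        change (K : ℂ) • mk V W (Submodule.inclusion hle c) = 0 ↔ _
        exact smul_eq_zero_iff_right hK0
      change q c = 0 ↔ (c : L1 V W) ∈ relSub V W ∧ (c : L1 V W) ∈ suppSub B D
      rw [h1, mk_eq_zero]
      exact ⟨fun h => ⟨h, c.2⟩, fun h => h.1⟩
    obtain ⟨E, hE⟩ := banachSub_of_map q (by
        rw [hq]
        exact (isBClosed_relSub B D hB hD).preimage continuous_subtype_val) (by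
      intro R
      refine isBounded_iff.2 ⟨B, D, K * R, hB, hD, ?_⟩
      rintro _ ⟨c, hc, rfl⟩
      rw [mem_closedBall_zero_iff] at hc
      refine ⟨(K : ℂ) • Submodule.inclusion hle c, ⟨Submodule.smul_mem _ _ c.2, ?_⟩, ?_⟩
      · change ‖(K : ℂ) • (c : L1 V W)‖ ≤ _
        rw [norm_smul, Complex.norm_real, Real.norm_eq_abs, abs_of_pos hKpos]
        have hc : ‖(c : L1 V W)‖ ≤ R := hc
        gcongr
      · rw [map_smul]; rfl)
    refine ⟨E, fun x hx => hE ?_⟩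
    obtain ⟨c, ⟨hc, hn⟩, rfl⟩ := hS hx
    refine ⟨(K : ℂ)⁻¹ • ⟨c, hc⟩, ?_, ?_⟩
    · rw [mem_closedBall_zero_iff]
      change ‖(K : ℂ)⁻¹ • (c : L1 V W)‖ ≤ 1
      rw [norm_smul, norm_inv, Complex.norm_real, Real.norm_eq_abs, abs_of_pos hKpos,
        inv_mul_le_iff₀ hKpos, mul_one]
      exact hn.trans (le_max_left _ _)
    · rw [map_smul]
      exact inv_smul_smul₀ hK0 (mk V W c)

end CTensor
end CTensor2

section Tools

variable {V : Type u} {W : Type v} {X : Type w} [Bornology V] [Bornology W] [Bornology X]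

theorem IsBddMap.comp {f : V → W} {g : W → X} (hg : IsBddMap g) (hf : IsBddMap f) :
    IsBddMap (fun x => g (f x)) := by
  intro S hS
  have := hg _ (hf S hS)
  rwa [Set.image_image] at this

theorem IsBddMap.id : IsBddMap (fun x : V => x) := by
  intro S hS
  simpa using hS

theorem IsBddMap₂.left {f : V → W → X} (hf : IsBddMap₂ f) (w : W) : IsBddMap (fun v => f v w) := by
  intro S hS
  refine (hf S {w} hS isBounded_singleton).subset ?_
  rintro _ ⟨v, hv, rfl⟩
  exact ⟨v, hv, w, rfl, rfl⟩

theorem IsBddMap₂.right {f : V → W → X} (hf : IsBddMap₂ f) (v : V) : IsBddMap (f v) := by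
  intro S hS
  refine (hf {v} S isBounded_singleton hS).subset ?_
  rintro _ ⟨w, hw, rfl⟩
  exact ⟨v, rfl, w, hw, rfl⟩

theorem IsBddMap₂.flip {f : V → W → X} (hf : IsBddMap₂ f) : IsBddMap₂ (fun w v => f v w) := by
  intro S T hS hT
  refine (hf T S hT hS).subset ?_
  rintro _ ⟨w, hw, v, hv, rfl⟩
  exact ⟨v, hv, w, hw, rfl⟩

variable [AddCommGroup X] [Module ℂ X] [CompleteConvexBornology X]

theorem IsBddMap.add {f g : V → X} (hf : IsBddMap f) (hg : IsBddMap g) :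
    IsBddMap (fun x => f x + g x) := by
  intro S hS
  refine (CompleteConvexBornology.isBounded_add _ _ (hf S hS) (hg S hS)).subset ?_
  rintro _ ⟨x, hx, rfl⟩
  exact Set.add_mem_add ⟨x, hx, rfl⟩ ⟨x, hx, rfl⟩

theorem IsBddMap.const_smul (c : ℂ) {f : V → X} (hf : IsBddMap f) :
    IsBddMap (fun x => c • f x) := by
  intro S hS
  refine (CompleteConvexBornology.isBounded_smul c _ (hf S hS)).subset ?_
  rintro _ ⟨x, hx, rfl⟩
  exact Set.smul_mem_smul_set ⟨x, hx, rfl⟩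

end Tools

namespace CTensor

section Maps

variable {V W V' W' U U' : Type*}
  [AddCommGroup V] [Module ℂ V] [Bornology V]
  [AddCommGroup W] [Module ℂ W] [Bornology W]
  [AddCommGroup V'] [Module ℂ V'] [Bornology V']
  [AddCommGroup W'] [Module ℂ W'] [Bornology W']
  [AddCommGroup U] [Module ℂ U] [Bornology U]
  [AddCommGroup U'] [Module ℂ U'] [Bornology U']

theorem map_aux {f : V →ₗ[ℂ] V'} {g : W →ₗ[ℂ] W'} (hf : IsBddMap f) (hg : IsBddMap g) :
    IsBddMap₂ (fun v w => ((tmulBilin V' W').compl₁₂ f g) v w) := by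
  intro B D hB hD
  refine (tmulBilin_isBdd _ _ (hf B hB) (hg D hD)).subset ?_
  rintro _ ⟨v, hv, w, hw, rfl⟩
  exact ⟨f v, ⟨v, hv, rfl⟩, g w, ⟨w, hw, rfl⟩, rfl⟩

/-- The tensor product `f ⊗ g` of bounded linear maps. -/
noncomputable def map (f : V →ₗ[ℂ] V') (g : W →ₗ[ℂ] W') (hf : IsBddMap f) (hg : IsBddMap g) :
    CTensor V W →ₗ[ℂ] CTensor V' W' :=
  lift ((tmulBilin V' W').compl₁₂ f g) (map_aux hf hg)

@[simp]
theorem map_tmul (f : V →ₗ[ℂ] V') (g : W →ₗ[ℂ] W') (hf : IsBddMap f) (hg : IsBddMap g)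
    (v : V) (w : W) : map f g hf hg (tmul v w) = tmul (f v) (g w) :=
  (lift_tmul _ _ v w).trans (by simp [tmul])

theorem map_isBdd (f : V →ₗ[ℂ] V') (g : W →ₗ[ℂ] W') (hf : IsBddMap f) (hg : IsBddMap g) :
    IsBddMap (map f g hf hg) := lift_isBdd _ _

/-- Uniform boundedness of `f ⊗ g`. -/
theorem map_bdd_family {ι : Type*} (f : ι → V →ₗ[ℂ] V') (g : ι → W →ₗ[ℂ] W')
    (hf : ∀ i, IsBddMap (f i)) (hg : ∀ i, IsBddMap (g i))
    (hfu : ∀ B : Set V, IsBounded B → IsBounded {x | ∃ i, ∃ v ∈ B, x = f i v})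
    (hgu : ∀ B : Set W, IsBounded B → IsBounded {x | ∃ i, ∃ v ∈ B, x = g i v})
    (S : Set (CTensor V W)) (hS : IsBounded S) :
    IsBounded {x | ∃ i, ∃ t ∈ S, x = map (f i) (g i) (hf i) (hg i) t} := by
  refine lift_bdd_family _ (fun i => map_aux (hf i) (hg i)) (fun B D hB hD => ?_) S hS
  refine (tmulBilin_isBdd _ _ (hfu B hB) (hgu D hD)).subset ?_
  rintro _ ⟨i, v, hv, w, hw, rfl⟩
  exact ⟨f i v, ⟨i, v, hv, rfl⟩, g i w, ⟨i, w, hw, rfl⟩, rfl⟩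

theorem add_tmul (v v' : V) (w : W) : tmul (v + v') w = tmul v w + tmul v' w := by
  simp [tmul]
theorem tmul_add (v : V) (w w' : W) : tmul v (w + w') = tmul v w + tmul v w' := by
  simp [tmul]
theorem smul_tmul (c : ℂ) (v : V) (w : W) : tmul (c • v) w = c • tmul v w := by
  simp [tmul]
theorem tmul_smul (c : ℂ) (v : V) (w : W) : tmul v (c • w) = c • tmul v w := by
  simp [tmul]

theorem map₂_bdd (π : V →ₗ[ℂ] U →ₗ[ℂ] V') (ρ : W →ₗ[ℂ] U' →ₗ[ℂ] W')
    (hπ : IsBddMap₂ (fun a u => π a u)) (hρ : IsBddMap₂ (fun b u => ρ b u))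
    (B : Set V) (D : Set W) (hB : IsBounded B) (hD : IsBounded D)
    (S : Set (CTensor U U')) (hS : IsBounded S) :
    IsBounded {x | ∃ a ∈ B, ∃ b ∈ D, ∃ t ∈ S, x = map (π a) (ρ b) (hπ.right a) (hρ.right b) t} := by
  refine (map_bdd_family (ι := B × D) (fun i => π i.1) (fun i => ρ i.2) (fun i => hπ.right _)
    (fun i => hρ.right _) (fun T hT => ?_) (fun T hT => ?_) S hS).subset ?_
  · refine (hπ B T hB hT).subset ?_
    rintro _ ⟨i, v, hv, rfl⟩
    exact ⟨i.1, i.1.2, v, hv, rfl⟩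
  · refine (hρ D T hD hT).subset ?_
    rintro _ ⟨i, v, hv, rfl⟩
    exact ⟨i.2, i.2.2, v, hv, rfl⟩
  · rintro _ ⟨a, ha, b, hb, t, ht, rfl⟩
    exact ⟨(⟨a, ha⟩, ⟨b, hb⟩), t, ht, rfl⟩

/-- For fixed `t`, the bilinear map `(a, b) ↦ (π a ⊗ ρ b) t`. -/
noncomputable def map₂Aux (π : V →ₗ[ℂ] U →ₗ[ℂ] V') (ρ : W →ₗ[ℂ] U' →ₗ[ℂ] W')
    (hπ : IsBddMap₂ (fun a u => π a u)) (hρ : IsBddMap₂ (fun b u => ρ b u))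
    (t : CTensor U U') : V →ₗ[ℂ] W →ₗ[ℂ] CTensor V' W' :=
  LinearMap.mk₂ ℂ (fun a b => map (π a) (ρ b) (hπ.right a) (hρ.right b) t)
    (by
      intro a a' b
      have : map (π (a + a')) (ρ b) (hπ.right _) (hρ.right b) =
          map (π a) (ρ b) (hπ.right a) (hρ.right b) +
          map (π a') (ρ b) (hπ.right a') (hρ.right b) :=
        hom_ext (map_isBdd _ _ _ _) ((map_isBdd _ _ _ _).add (map_isBdd _ _ _ _))
          (fun u u' => by simp [add_tmul])
      rw [this]; rfl)
    (by
      intro c a b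
      have : map (π (c • a)) (ρ b) (hπ.right _) (hρ.right b) =
          c • map (π a) (ρ b) (hπ.right a) (hρ.right b) :=
        hom_ext (map_isBdd _ _ _ _) ((map_isBdd _ _ _ _).const_smul c)
          (fun u u' => by simp [smul_tmul])
      rw [this]; rfl)
    (by
      intro a b b'
      have : map (π a) (ρ (b + b')) (hπ.right _) (hρ.right _) =
          map (π a) (ρ b) (hπ.right a) (hρ.right b) +
          map (π a) (ρ b') (hπ.right a) (hρ.right b') :=
        hom_ext (map_isBdd _ _ _ _) ((map_isBdd _ _ _ _).add (map_isBdd _ _ _ _))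
          (fun u u' => by simp [tmul_add])
      rw [this]; rfl)
    (by
      intro c a b
      have : map (π a) (ρ (c • b)) (hπ.right _) (hρ.right _) =
          c • map (π a) (ρ b) (hπ.right a) (hρ.right b) :=
        hom_ext (map_isBdd _ _ _ _) ((map_isBdd _ _ _ _).const_smul c)
          (fun u u' => by simp [tmul_smul])
      rw [this]; rfl)

theorem map₂Aux_bdd (π : V →ₗ[ℂ] U →ₗ[ℂ] V') (ρ : W →ₗ[ℂ] U' →ₗ[ℂ] W')
    (hπ : IsBddMap₂ (fun a u => π a u)) (hρ : IsBddMap₂ (fun b u => ρ b u))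
    (t : CTensor U U') : IsBddMap₂ (fun a b => map₂Aux π ρ hπ hρ t a b) := by
  intro B D hB hD
  refine (map₂_bdd π ρ hπ hρ B D hB hD {t} isBounded_singleton).subset ?_
  rintro _ ⟨a, ha, b, hb, rfl⟩
  exact ⟨a, ha, b, hb, t, rfl, rfl⟩

/-- The tensor product of two bounded bilinear maps:
`map₂ π ρ (a ⊗ b) (u ⊗ u') = π a u ⊗ ρ b u'`. -/
noncomputable def map₂ (π : V →ₗ[ℂ] U →ₗ[ℂ] V') (ρ : W →ₗ[ℂ] U' →ₗ[ℂ] W')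
    (hπ : IsBddMap₂ (fun a u => π a u)) (hρ : IsBddMap₂ (fun b u => ρ b u)) :
    CTensor V W →ₗ[ℂ] CTensor U U' →ₗ[ℂ] CTensor V' W' :=
  LinearMap.mk₂ ℂ (fun x t => lift (map₂Aux π ρ hπ hρ t) (map₂Aux_bdd π ρ hπ hρ t) x)
    (fun x x' t => map_add _ _ _)
    (fun c x t => map_smul _ _ _)
    (by
      intro x t t'
      have : lift (map₂Aux π ρ hπ hρ (t + t')) (map₂Aux_bdd π ρ hπ hρ _) =
          lift (map₂Aux π ρ hπ hρ t) (map₂Aux_bdd π ρ hπ hρ t) +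
          lift (map₂Aux π ρ hπ hρ t') (map₂Aux_bdd π ρ hπ hρ t') :=
        hom_ext (lift_isBdd _ _) ((lift_isBdd _ _).add (lift_isBdd _ _))
          (fun u u' => by simp [map₂Aux])
      rw [this]; rfl)
    (by
      intro c x t
      have : lift (map₂Aux π ρ hπ hρ (c • t)) (map₂Aux_bdd π ρ hπ hρ _) =
          c • lift (map₂Aux π ρ hπ hρ t) (map₂Aux_bdd π ρ hπ hρ t) :=
        hom_ext (lift_isBdd _ _) ((lift_isBdd _ _).const_smul c)
          (fun u u' => by simp [map₂Aux])
      rw [this]; rfl)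

@[simp]
theorem map₂_tmul (π : V →ₗ[ℂ] U →ₗ[ℂ] V') (ρ : W →ₗ[ℂ] U' →ₗ[ℂ] W')
    (hπ : IsBddMap₂ (fun a u => π a u)) (hρ : IsBddMap₂ (fun b u => ρ b u))
    (a : V) (b : W) (t : CTensor U U') :
    map₂ π ρ hπ hρ (tmul a b) t = map (π a) (ρ b) (hπ.right a) (hρ.right b) t := by
  simp [map₂, map₂Aux]

theorem map₂_isBdd (π : V →ₗ[ℂ] U →ₗ[ℂ] V') (ρ : W →ₗ[ℂ] U' →ₗ[ℂ] W')
    (hπ : IsBddMap₂ (fun a u => π a u)) (hρ : IsBddMap₂ (fun b u => ρ b u)) :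
    IsBddMap₂ (fun x t => map₂ π ρ hπ hρ x t) := by
  intro S T hS hT
  refine (lift_bdd_family (ι := T) (fun t => map₂Aux π ρ hπ hρ t)
    (fun t => map₂Aux_bdd π ρ hπ hρ t) (fun B D hB hD => ?_) S hS).subset ?_
  · refine (map₂_bdd π ρ hπ hρ B D hB hD T hT).subset ?_
    rintro _ ⟨t, a, ha, b, hb, rfl⟩
    exact ⟨a, ha, b, hb, t, t.2, rfl⟩
  · rintro _ ⟨x, hx, t, ht, rfl⟩
    exact ⟨⟨t, ht⟩, x, hx, rfl⟩

/-- Two bounded bilinear maps on tensor products agreeing on elementary tensors are equal. -/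
theorem hom_ext₂ {X : Type*} [AddCommGroup X] [Module ℂ X] [Bornology X]
    [CompleteConvexBornology X] {f g : CTensor V W →ₗ[ℂ] CTensor U U' →ₗ[ℂ] X}
    (hf : IsBddMap₂ (fun x t => f x t)) (hg : IsBddMap₂ (fun x t => g x t))
    (h : ∀ a b u u', f (tmul a b) (tmul u u') = g (tmul a b) (tmul u u')) : f = g := by
  ext x t
  have h1 : ∀ a b, f (tmul a b) = g (tmul a b) := fun a b =>
    hom_ext (hf.right _) (hg.right _) (h a b)
  have h2 : f.flip t = g.flip t :=
    hom_ext (hf.left t) (hg.left t) (fun a b => congrArg (fun φ => φ t) (h1 a b))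
  exact congrArg (fun φ => φ x) h2

theorem assoc_aux (u : U) :
    IsBddMap ((tmulBilin W U).flip u) := tmulBilin_isBdd.left u

variable (V W U) in
/-- The bilinear map `(t, u) ↦ t ⊗ u`, with `(v ⊗ w) ⊗ u` sent to `v ⊗ (w ⊗ u)`. -/
noncomputable def assocBilin : CTensor V W →ₗ[ℂ] U →ₗ[ℂ] CTensor V (CTensor W U) :=
  LinearMap.mk₂ ℂ (fun t u => map LinearMap.id ((tmulBilin W U).flip u) IsBddMap.id (assoc_aux u) t)
    (fun _ _ _ => map_add _ _ _) (fun _ _ _ => map_smul _ _ _)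
    (by
      intro t u u'
      have : map (LinearMap.id : V →ₗ[ℂ] V) ((tmulBilin W U).flip (u + u')) IsBddMap.id
          (assoc_aux _) = map LinearMap.id ((tmulBilin W U).flip u) IsBddMap.id (assoc_aux u) +
          map LinearMap.id ((tmulBilin W U).flip u') IsBddMap.id (assoc_aux u') :=
        hom_ext (map_isBdd _ _ _ _) ((map_isBdd _ _ _ _).add (map_isBdd _ _ _ _))
          (fun v w => by simp [tmul_add])
      rw [this]; rfl)
    (by
      intro c t u
      have : map (LinearMap.id : V →ₗ[ℂ] V) ((tmulBilin W U).flip (c • u)) IsBddMap.id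
          (assoc_aux _) = c • map LinearMap.id ((tmulBilin W U).flip u) IsBddMap.id (assoc_aux u) :=
        hom_ext (map_isBdd _ _ _ _) ((map_isBdd _ _ _ _).const_smul c)
          (fun v w => by simp [tmul_smul])
      rw [this]; rfl)

theorem assocBilin_bdd : IsBddMap₂ (fun t u => assocBilin V W U t u) := by
  intro S T hS hT
  refine (map_bdd_family (ι := T) (fun _ => (LinearMap.id : V →ₗ[ℂ] V))
    (fun u => (tmulBilin W U).flip (u : U)) (fun _ => IsBddMap.id) (fun u => assoc_aux (u : U))
    (fun B hB => ?_) (fun B hB => ?_) S hS).subset ?_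
  · refine hB.subset ?_
    rintro _ ⟨_, v, hv, rfl⟩
    exact hv
  · refine (tmulBilin_isBdd B T hB hT).subset ?_
    rintro _ ⟨u, v, hv, rfl⟩
    exact ⟨v, hv, u, u.2, rfl⟩
  · rintro _ ⟨t, ht, u, hu, rfl⟩
    exact ⟨⟨u, hu⟩, t, ht, rfl⟩

variable (V W U) in
/-- The associator `(V ⊗̂ W) ⊗̂ U → V ⊗̂ (W ⊗̂ U)`. -/
noncomputable def assoc : CTensor (CTensor V W) U →ₗ[ℂ] CTensor V (CTensor W U) :=
  lift (assocBilin V W U) assocBilin_bdd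

@[simp]
theorem assoc_tmul (v : V) (w : W) (u : U) :
    assoc V W U (tmul (tmul v w) u) = tmul v (tmul w u) := by
  rw [assoc, lift_tmul]
  exact map_tmul _ _ IsBddMap.id (assoc_aux u) v w

end Maps
end CTensor

/-! ### Bornological algebras and their multipliers -/

/-- (Complete convex) bornological algebras. -/
class BornologicalAlgebra (A : Type u) [NonUnitalRing A] [Module ℂ A] [IsScalarTower ℂ A A]
    [SMulCommClass ℂ A A] [Bornology A] : Prop extends CompleteConvexBornology A where
  bdd_mul : IsBddMap₂ (fun a b : A => a * b)

/-- Bornological `*`-algebras. -/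
class BornologicalStarAlgebra (A : Type u) [NonUnitalRing A] [Module ℂ A] [IsScalarTower ℂ A A]
    [SMulCommClass ℂ A A] [StarRing A] [StarModule ℂ A] [Bornology A] : Prop
    extends BornologicalAlgebra A where
  bdd_star : IsBddMap (fun a : A => star a)

theorem IsBddMap.lcomp {V : Type u} {W : Type v} {X : Type w}
    [AddCommGroup V] [Module ℂ V] [Bornology V] [AddCommGroup W] [Module ℂ W] [Bornology W]
    [AddCommGroup X] [Module ℂ X] [Bornology X] {σ₁ σ₂ σ₃ : ℂ →+* ℂ} [RingHomCompTriple σ₁ σ₂ σ₃]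
    {g : W →ₛₗ[σ₂] X} {f : V →ₛₗ[σ₁] W} (hg : IsBddMap g) (hf : IsBddMap f) :
    IsBddMap (g.comp f) := by
  intro S hS
  have := hg _ (hf S hS)
  rw [Set.image_image] at this
  exact this

theorem IsBddMap₂.flip_left {V : Type u} {W : Type v} {X : Type w}
    [AddCommGroup V] [Module ℂ V] [Bornology V] [AddCommGroup W] [Module ℂ W] [Bornology W]
    [AddCommGroup X] [Module ℂ X] [Bornology X] {f : V →ₗ[ℂ] W →ₗ[ℂ] X}
    (hf : IsBddMap₂ (fun v w => f v w)) (w : W) : IsBddMap (f.flip w) := hf.left w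

theorem bdd_mulL {A : Type u} [NonUnitalRing A] [Module ℂ A] [IsScalarTower ℂ A A]
    [SMulCommClass ℂ A A] [Bornology A] [BornologicalAlgebra A] :
    IsBddMap₂ (fun a b : A => LinearMap.mul ℂ A a b) := BornologicalAlgebra.bdd_mul

namespace CTensor

section Algebra

variable {A : Type u} {B : Type v}
  [NonUnitalRing A] [Module ℂ A] [IsScalarTower ℂ A A] [SMulCommClass ℂ A A] [Bornology A]
  [BornologicalAlgebra A]
  [NonUnitalRing B] [Module ℂ B] [IsScalarTower ℂ B B] [SMulCommClass ℂ B B] [Bornology B]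
  [BornologicalAlgebra B]

variable (A B) in
/-- The product of `A ⊗̂ B` as a bilinear map. -/
noncomputable def mulBilin : CTensor A B →ₗ[ℂ] CTensor A B →ₗ[ℂ] CTensor A B :=
  map₂ (LinearMap.mul ℂ A) (LinearMap.mul ℂ B) bdd_mulL bdd_mulL

theorem mulBilin_bdd : IsBddMap₂ (fun x y => mulBilin A B x y) := map₂_isBdd _ _ _ _

theorem mulBilin_tmul (a a' : A) (b b' : B) :
    mulBilin A B (tmul a b) (tmul a' b') = tmul (a * a') (b * b') := by
  rw [mulBilin, map₂_tmul, map_tmul]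
  rfl

theorem mulBilin_right (x : CTensor A B) : IsBddMap (mulBilin A B x) := mulBilin_bdd.right x

theorem mulBilin_left (y : CTensor A B) : IsBddMap ((mulBilin A B).flip y) :=
  mulBilin_bdd.flip_left y

theorem mulBilin_assoc (x y z : CTensor A B) :
    mulBilin A B (mulBilin A B x y) z = mulBilin A B x (mulBilin A B y z) := by
  have h2 : ∀ (a a' : A) (b b' : B) (z : CTensor A B),
      mulBilin A B (mulBilin A B (tmul a b) (tmul a' b')) z =
        mulBilin A B (tmul a b) (mulBilin A B (tmul a' b') z) := by
    intro a a' b b' z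
    have : mulBilin A B (mulBilin A B (tmul a b) (tmul a' b')) =
        (mulBilin A B (tmul a b)) ∘ₗ (mulBilin A B (tmul a' b')) := by
      refine hom_ext (mulBilin_right _) ((mulBilin_right _).lcomp (mulBilin_right _)) ?_
      intro c d
      rw [LinearMap.comp_apply, mulBilin_tmul, mulBilin_tmul, mulBilin_tmul, mulBilin_tmul,
        mul_assoc, mul_assoc]
    exact LinearMap.congr_fun this z
  have h3 : ∀ (a : A) (b : B) (y z : CTensor A B),
      mulBilin A B (mulBilin A B (tmul a b) y) z =
        mulBilin A B (tmul a b) (mulBilin A B y z) := by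
    intro a b y z
    have : ((mulBilin A B).flip z) ∘ₗ (mulBilin A B (tmul a b)) =
        (mulBilin A B (tmul a b)) ∘ₗ ((mulBilin A B).flip z) := by
      refine hom_ext ((mulBilin_left _).lcomp (mulBilin_right _))
        ((mulBilin_right _).lcomp (mulBilin_left _)) ?_
      intro c d
      exact h2 a c b d z
    exact LinearMap.congr_fun this y
  have : ((mulBilin A B).flip z) ∘ₗ ((mulBilin A B).flip y) =
      (mulBilin A B).flip (mulBilin A B y z) := by
    refine hom_ext ((mulBilin_left _).lcomp (mulBilin_left _)) (mulBilin_left _) ?_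
    intro c d
    exact h3 c d y z
  exact LinearMap.congr_fun this x

noncomputable instance : NonUnitalRing (CTensor A B) where
  mul x y := mulBilin A B x y
  left_distrib x y z := map_add _ _ _
  right_distrib x y z := by
    change mulBilin A B (x + y) z = _
    rw [map_add]; rfl
  zero_mul x := by
    change mulBilin A B 0 x = _
    rw [map_zero]; rfl
  mul_zero x := map_zero _
  mul_assoc x y z := mulBilin_assoc x y z

theorem mul_def (x y : CTensor A B) : x * y = mulBilin A B x y := rfl

@[simp]
theorem tmul_mul_tmul (a a' : A) (b b' : B) :
    tmul a b * tmul a' b' = tmul (a * a') (b * b') := mulBilin_tmul a a' b b'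

instance : IsScalarTower ℂ (CTensor A B) (CTensor A B) where
  smul_assoc c x y := by
    change mulBilin A B (c • x) y = c • mulBilin A B x y
    rw [map_smul]; rfl

instance : SMulCommClass ℂ (CTensor A B) (CTensor A B) where
  smul_comm c x y := (map_smul (mulBilin A B x) c y).symm

instance : BornologicalAlgebra (CTensor A B) where
  bdd_mul := mulBilin_bdd

end Algebra

section StarAlgebra

variable {A : Type u} {B : Type v}
  [NonUnitalRing A] [Module ℂ A] [IsScalarTower ℂ A A] [SMulCommClass ℂ A A] [StarRing A]
  [StarModule ℂ A] [Bornology A] [BornologicalStarAlgebra A]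
  [NonUnitalRing B] [Module ℂ B] [IsScalarTower ℂ B B] [SMulCommClass ℂ B B] [StarRing B]
  [StarModule ℂ B] [Bornology B] [BornologicalStarAlgebra B]

variable (A B) in
/-- `(a, b) ↦ a^* ⊗ b^*`. -/
noncomputable def starBilin :
    A →ₛₗ[starRingEnd ℂ] B →ₛₗ[starRingEnd ℂ] CTensor A B :=
  LinearMap.mk₂'ₛₗ (starRingEnd ℂ) (starRingEnd ℂ) (fun a b => tmul (star a) (star b))
    (fun a a' b => by simp [add_tmul]) (fun c a b => by simp [smul_tmul])
    (fun a b b' => by simp [tmul_add]) (fun c a b => by simp [tmul_smul])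

theorem starBilin_bdd : IsBddMap₂ (fun a b => starBilin A B a b) := by
  intro S T hS hT
  refine (tmulBilin_isBdd _ _ (BornologicalStarAlgebra.bdd_star S hS)
    (BornologicalStarAlgebra.bdd_star T hT)).subset ?_
  rintro _ ⟨a, ha, b, hb, rfl⟩
  exact ⟨star a, ⟨a, ha, rfl⟩, star b, ⟨b, hb, rfl⟩, rfl⟩

variable (A B) in
/-- The involution of `A ⊗̂ B` as a conjugate linear map. -/
noncomputable def starMap : CTensor A B →ₛₗ[starRingEnd ℂ] CTensor A B :=
  lift (starBilin A B) starBilin_bdd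

theorem starMap_tmul (a : A) (b : B) : starMap A B (tmul a b) = tmul (star a) (star b) :=
  lift_tmul _ _ a b

theorem starMap_bdd : IsBddMap (starMap A B) := lift_isBdd _ _

noncomputable instance : StarRing (CTensor A B) where
  star x := starMap A B x
  star_involutive x := by
    have : (starMap A B).comp (starMap A B) = LinearMap.id := by
      refine hom_ext (starMap_bdd.lcomp starMap_bdd) IsBddMap.id ?_
      intro a b
      rw [LinearMap.comp_apply, starMap_tmul, starMap_tmul, star_star, star_star]
      rfl
    exact LinearMap.congr_fun this x
  star_mul x y := by
    change starMap A B (mulBilin A B x y) = mulBilin A B (starMap A B y) (starMap A B x)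
    have h1 : ∀ (a : A) (b : B) (y : CTensor A B), starMap A B (mulBilin A B (tmul a b) y) =
        mulBilin A B (starMap A B y) (starMap A B (tmul a b)) := by
      intro a b y
      have : (starMap A B).comp (mulBilin A B (tmul a b)) =
          ((mulBilin A B).flip (starMap A B (tmul a b))).comp (starMap A B) := by
        refine hom_ext (starMap_bdd.lcomp (mulBilin_right _))
          ((mulBilin_left _).lcomp starMap_bdd) ?_
        intro c d
        rw [LinearMap.comp_apply, LinearMap.comp_apply, LinearMap.flip_apply, mulBilin_tmul,
          starMap_tmul, starMap_tmul, starMap_tmul, mulBilin_tmul, star_mul, star_mul]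
      exact LinearMap.congr_fun this y
    have : (starMap A B).comp ((mulBilin A B).flip y) =
        (mulBilin A B (starMap A B y)).comp (starMap A B) := by
      refine hom_ext (starMap_bdd.lcomp (mulBilin_left _))
        ((mulBilin_right _).lcomp starMap_bdd) ?_
      intro a b
      exact h1 a b y
    exact LinearMap.congr_fun this x
  star_add x y := map_add _ _ _

@[simp]
theorem star_tmul (a : A) (b : B) : star (tmul a b) = tmul (star a) (star b) := starMap_tmul a b

instance : StarModule ℂ (CTensor A B) where
  star_smul c x := LinearMap.map_smulₛₗ (starMap A B) c x

instance : BornologicalStarAlgebra (CTensor A B) where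
  bdd_star := starMap_bdd

end StarAlgebra

end CTensor

section Multiplier

variable (A : Type u) [NonUnitalRing A] [Module ℂ A] [IsScalarTower ℂ A A] [SMulCommClass ℂ A A]
  [Bornology A] [BornologicalAlgebra A]

/-- The algebra of multipliers of `A`, i.e. pairs `(c_l, c_r)` of bounded linear maps satisfying
`c_l (a b) = (c_l a) b`, `c_r (a b) = a (c_r b)` and `(c_r a) b = a (c_l b)`. The product is
`(c d)_l = c_l d_l` and `(c d)_r = d_r c_r`. -/
def multiplierSubalgebra : Subalgebra ℂ (Module.End ℂ A × (Module.End ℂ A)ᵐᵒᵖ) where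
  carrier := {c | IsBddMap c.1 ∧ IsBddMap c.2.unop ∧ (∀ a b, c.1 (a * b) = c.1 a * b) ∧
    (∀ a b, c.2.unop (a * b) = a * c.2.unop b) ∧ ∀ a b, c.2.unop a * b = a * c.1 b}
  mul_mem' := by
    rintro c d ⟨h1, h2, h3, h4, h5⟩ ⟨k1, k2, k3, k4, k5⟩
    refine ⟨h1.comp k1, k2.comp h2, ?_, ?_, ?_⟩ <;> intro a b <;>
      simp [h3, h4, h5, k3, k4, k5]
  add_mem' := by
    rintro c d ⟨h1, h2, h3, h4, h5⟩ ⟨k1, k2, k3, k4, k5⟩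
    refine ⟨h1.add k1, h2.add k2, ?_, ?_, ?_⟩ <;> intro a b <;>
      simp [h3, h4, h5, k3, k4, k5, add_mul, mul_add]
  algebraMap_mem' := by
    intro c
    refine ⟨IsBddMap.id.const_smul c, IsBddMap.id.const_smul c, ?_, ?_, ?_⟩ <;> intro a b <;>
      simp [Module.algebraMap_end_apply, smul_mul_assoc, mul_smul_comm]

/-- The multiplier algebra `M(A)`. -/
abbrev Multiplier : Type u := multiplierSubalgebra A

variable {A}

namespace Multiplier

/-- The action `a ↦ c a`. -/
def left (c : Multiplier A) : A →ₗ[ℂ] A := c.1.1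

/-- The action `a ↦ a c`. -/
def right (c : Multiplier A) : A →ₗ[ℂ] A := c.1.2.unop

theorem left_bdd (c : Multiplier A) : IsBddMap c.left := c.2.1
theorem right_bdd (c : Multiplier A) : IsBddMap c.right := c.2.2.1
theorem left_mul (c : Multiplier A) (a b : A) : c.left (a * b) = c.left a * b := c.2.2.2.1 a b
theorem right_mul (c : Multiplier A) (a b : A) : c.right (a * b) = a * c.right b :=
  c.2.2.2.2.1 a b
theorem mul_left (c : Multiplier A) (a b : A) : c.right a * b = a * c.left b := c.2.2.2.2.2 a b

/-- An element of `A` as a multiplier. -/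
def ofElem (a : A) : Multiplier A :=
  ⟨(LinearMap.mulLeft ℂ a, .op (LinearMap.mulRight ℂ a)),
    BornologicalAlgebra.bdd_mul.right a, BornologicalAlgebra.bdd_mul.left a,
    fun b c => (mul_assoc a b c).symm, fun b c => mul_assoc b c a, fun b c => mul_assoc b a c⟩

section Tensor

variable {B : Type v} [NonUnitalRing B] [Module ℂ B] [IsScalarTower ℂ B B] [SMulCommClass ℂ B B]
  [Bornology B] [BornologicalAlgebra B]

open CTensor in
/-- The multiplier `c ⊗ d` of `A ⊗̂ B`. -/
noncomputable def tmul (c : Multiplier A) (d : Multiplier B) : Multiplier (CTensor A B) :=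
  ⟨(map c.left d.left c.left_bdd d.left_bdd, .op (map c.right d.right c.right_bdd d.right_bdd)), by
    have hb := mulBilin_bdd (A := A) (B := B)
    set L := map c.left d.left c.left_bdd d.left_bdd with hL
    set R := map c.right d.right c.right_bdd d.right_bdd with hR
    have bL : IsBddMap L := map_isBdd _ _ _ _
    have bR : IsBddMap R := map_isBdd _ _ _ _
    refine ⟨bL, bR, ?_, ?_, ?_⟩
    · intro x y
      have := hom_ext₂ (f := (mulBilin A B).compr₂ L) (g := (mulBilin A B) ∘ₗ L)
        (fun S T hS hT => by
          refine (bL _ (hb S T hS hT)).subset ?_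
          rintro _ ⟨s, hs, t, ht, rfl⟩
          exact ⟨_, ⟨s, hs, t, ht, rfl⟩, rfl⟩)
        (fun S T hS hT => by
          refine (hb _ T (bL S hS) hT).subset ?_
          rintro _ ⟨s, hs, t, ht, rfl⟩
          exact ⟨_, ⟨s, hs, rfl⟩, t, ht, rfl⟩)
        (fun a b u u' => by
          rw [LinearMap.compr₂_apply, LinearMap.comp_apply, mulBilin_tmul, hL, map_tmul, map_tmul,
            mulBilin_tmul, left_mul, left_mul])
      exact LinearMap.congr_fun₂ this x y
    · intro x y
      have := hom_ext₂ (f := (mulBilin A B).compr₂ R) (g := (mulBilin A B).compl₂ R)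
        (fun S T hS hT => by
          refine (bR _ (hb S T hS hT)).subset ?_
          rintro _ ⟨s, hs, t, ht, rfl⟩
          exact ⟨_, ⟨s, hs, t, ht, rfl⟩, rfl⟩)
        (fun S T hS hT => by
          refine (hb S _ hS (bR T hT)).subset ?_
          rintro _ ⟨s, hs, t, ht, rfl⟩
          exact ⟨s, hs, _, ⟨t, ht, rfl⟩, rfl⟩)
        (fun a b u u' => by
          rw [LinearMap.compr₂_apply, LinearMap.compl₂_apply, mulBilin_tmul, hR, map_tmul,
            map_tmul, mulBilin_tmul, right_mul, right_mul])
      exact LinearMap.congr_fun₂ this x y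
    · intro x y
      have := hom_ext₂ (f := (mulBilin A B) ∘ₗ R) (g := (mulBilin A B).compl₂ L)
        (fun S T hS hT => by
          refine (hb _ T (bR S hS) hT).subset ?_
          rintro _ ⟨s, hs, t, ht, rfl⟩
          exact ⟨_, ⟨s, hs, rfl⟩, t, ht, rfl⟩)
        (fun S T hS hT => by
          refine (hb S _ hS (bL T hT)).subset ?_
          rintro _ ⟨s, hs, t, ht, rfl⟩
          exact ⟨s, hs, _, ⟨t, ht, rfl⟩, rfl⟩)
        (fun a b u u' => by
          rw [LinearMap.comp_apply, LinearMap.compl₂_apply, hL, hR, map_tmul, map_tmul,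
            mulBilin_tmul, mulBilin_tmul, mul_left, mul_left])
      exact LinearMap.congr_fun₂ this x y⟩

end Tensor

end Multiplier
end Multiplier

section MultiplierStar

variable {A : Type u} [NonUnitalRing A] [Module ℂ A] [IsScalarTower ℂ A A] [SMulCommClass ℂ A A]
  [StarRing A] [StarModule ℂ A] [Bornology A] [BornologicalStarAlgebra A]

/-- `a ↦ (f (a^*))^*`. -/
def starConj (f : A →ₗ[ℂ] A) : A →ₗ[ℂ] A where
  toFun a := star (f (star a))
  map_add' a b := by simp
  map_smul' c a := by simp

theorem starConj_bdd {f : A →ₗ[ℂ] A} (hf : IsBddMap f) : IsBddMap (starConj f) :=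
  BornologicalStarAlgebra.bdd_star.comp (hf.comp BornologicalStarAlgebra.bdd_star)

/-- The involution of `M(A)`: `c^* a = (a^* c)^*` and `a c^* = (c a^*)^*`. -/
instance : Star (Multiplier A) where
  star c := ⟨(starConj c.right, .op (starConj c.left)),
    starConj_bdd c.right_bdd, starConj_bdd c.left_bdd,
    fun a b => by simp [starConj, Multiplier.right_mul],
    fun a b => by simp [starConj, Multiplier.left_mul],
    fun a b => by
      apply star_injective
      simp [starConj, Multiplier.mul_left]⟩

end MultiplierStar

/-! ### Bornological quantum groups -/

/-- The approximation property: the identity can be approximated, uniformly on compact sets, by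
bounded maps of finite rank. -/
def ApproximationProperty (V : Type u) [AddCommGroup V] [Module ℂ V] [Bornology V] : Prop :=
  ∀ (E : BanachSub V) (K : Set E.Y), IsCompact K →
    ∃ S : Set V, IsBounded S ∧ ∀ ε : ℝ, 0 < ε →
      ∃ T : V →ₗ[ℂ] V, IsBddMap T ∧ FiniteDimensional ℂ (LinearMap.range T) ∧
        ∀ x ∈ E.j '' K, T x - x ∈ ε • S

section BQG

variable {A : Type u} [NonUnitalRing A] [Module ℂ A] [IsScalarTower ℂ A A] [SMulCommClass ℂ A A]
  [StarRing A] [StarModule ℂ A] [Bornology A] [BornologicalStarAlgebra A]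

variable (A) in
/-- Essential bornological algebras: every bounded set is the image under the multiplication
`A ⊗̂ A → A` of a bounded set. -/
def IsEssentialAlgebra : Prop :=
  ∀ S : Set A, IsBounded S → ∃ S' : Set (CTensor A A), IsBounded S' ∧
    S = CTensor.lift (LinearMap.mul ℂ A) bdd_mulL '' S'

section Hom

variable {B : Type v} [NonUnitalRing B] [Module ℂ B] [IsScalarTower ℂ B B] [SMulCommClass ℂ B B]
  [StarRing B] [StarModule ℂ B] [Bornology B] [BornologicalStarAlgebra B]

/-- The left action `(a, b) ↦ f(a) b` of `A` on `B` defined by `f : A → M(B)`. -/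
def actL (f : A →⋆ₙₐ[ℂ] Multiplier B) : A →ₗ[ℂ] B →ₗ[ℂ] B where
  toFun a := (f a).left
  map_add' a a' := by rw [map_add]; rfl
  map_smul' c a := by rw [map_smul]; rfl

/-- The right action `(a, b) ↦ b f(a)` of `A` on `B` defined by `f : A → M(B)`. -/
def actR (f : A →⋆ₙₐ[ℂ] Multiplier B) : A →ₗ[ℂ] B →ₗ[ℂ] B where
  toFun a := (f a).right
  map_add' a a' := by rw [map_add]; rfl
  map_smul' c a := by rw [map_smul]; rfl

end Hom

/-- For a homomorphism `π : B → M(C)`, given by its left action `πl b x = π(b) x` and right action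
`πr b x = x π(b)`, and multipliers `c ∈ M(B)`, `d ∈ M(C)`, the relation `d = π(c)`, where `π` also
denotes the extension of `π` to `M(B)`: it is characterized by `d π(b) x = π(c b) x` and
`x π(b) d = x π(b c)`. -/
def IsExtensionValue {B : Type v} {C : Type w}
    [NonUnitalRing B] [Module ℂ B] [IsScalarTower ℂ B B] [SMulCommClass ℂ B B]
    [Bornology B] [BornologicalAlgebra B]
    [NonUnitalRing C] [Module ℂ C] [IsScalarTower ℂ C C] [SMulCommClass ℂ C C]
    [Bornology C] [BornologicalAlgebra C]
    (πl πr : B → C → C) (c : Multiplier B) (d : Multiplier C) : Prop :=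
  (∀ b x, d.left (πl b x) = πl (c.left b) x) ∧ ∀ b x, d.right (πr b x) = πr (c.right b) x

theorem bdd_mulL_flip : IsBddMap₂ (fun a b : A => (LinearMap.mul ℂ A).flip a b) :=
  IsBddMap₂.flip bdd_mulL

open CTensor in
/-- Coassociativity `(Δ ⊗ ι)(Δ(a)) = (ι ⊗ Δ)(Δ(a))`. The left hand side is `d`, the right hand
side is `d'`, and these are identified through the associator. -/
def IsCoassociative (Δ : A →⋆ₙₐ[ℂ] Multiplier (CTensor A A))
    (hl : IsBddMap₂ (fun a t => actL Δ a t)) (hr : IsBddMap₂ (fun a t => actR Δ a t)) : Prop :=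
  ∀ a : A, ∃ (d : Multiplier (CTensor (CTensor A A) A)) (d' : Multiplier (CTensor A (CTensor A A))),
    IsExtensionValue (fun x y => map₂ (actL Δ) (LinearMap.mul ℂ A) hl bdd_mulL x y)
      (fun x y => map₂ (actR Δ) (LinearMap.mul ℂ A).flip hr bdd_mulL_flip x y) (Δ a) d ∧
    IsExtensionValue (fun x y => map₂ (LinearMap.mul ℂ A) (actL Δ) bdd_mulL hl x y)
      (fun x y => map₂ (LinearMap.mul ℂ A).flip (actR Δ) bdd_mulL_flip hr x y) (Δ a) d' ∧
    (∀ y, assoc A A A (d.left y) = d'.left (assoc A A A y)) ∧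
    ∀ y, assoc A A A (d.right y) = d'.right (assoc A A A y)

/-- `γ` is the Galois map `γ_l : a ⊗ b ↦ Δ(a) (b ⊗ 1)`, as a map from `A ⊗̂ A` to itself. -/
def IsGaloisL (Δ : A →⋆ₙₐ[ℂ] Multiplier (CTensor A A)) (γ : CTensor A A →ₗ[ℂ] CTensor A A) :
    Prop :=
  IsBddMap γ ∧ ∀ a b, Multiplier.ofElem (γ (CTensor.tmul a b)) =
    Δ a * Multiplier.tmul (Multiplier.ofElem b) 1

/-- `ρ` is the Galois map `ρ_r : a ⊗ b ↦ (1 ⊗ a) Δ(b)`, as a map from `A ⊗̂ A` to itself. -/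
def IsGaloisR (Δ : A →⋆ₙₐ[ℂ] Multiplier (CTensor A A)) (ρ : CTensor A A →ₗ[ℂ] CTensor A A) :
    Prop :=
  IsBddMap ρ ∧ ∀ a b, Multiplier.ofElem (ρ (CTensor.tmul a b)) =
    Multiplier.tmul 1 (Multiplier.ofElem a) * Δ b

/-- Coproducts on a bornological `*`-algebra: essential bounded coassociative `*`-homomorphisms
`Δ : A → M(A ⊗̂ A)` such that the Galois maps are bounded linear maps of `A ⊗̂ A` to itself. -/
structure IsCoproduct (Δ : A →⋆ₙₐ[ℂ] Multiplier (CTensor A A)) : Prop where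
  bdd_left : IsBddMap₂ (fun a t => actL Δ a t)
  bdd_right : IsBddMap₂ (fun a t => actR Δ a t)
  essential : ∀ S : Set (CTensor A A), IsBounded S →
    ∃ S' : Set (CTensor A (CTensor A A)), IsBounded S' ∧
      S = CTensor.lift (actL Δ) bdd_left '' S'
  coassoc : IsCoassociative Δ bdd_left bdd_right
  galois_l : ∃ γ, IsGaloisL Δ γ
  galois_r : ∃ ρ, IsGaloisR Δ ρ

/-- The cancellation property: the Galois maps are bornological isomorphisms. -/
def HasCancellation (Δ : A →⋆ₙₐ[ℂ] Multiplier (CTensor A A)) : Prop :=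
  (∃ γ : CTensor A A ≃ₗ[ℂ] CTensor A A, IsGaloisL Δ γ ∧ IsBddMap γ.symm) ∧
  ∃ ρ : CTensor A A ≃ₗ[ℂ] CTensor A A, IsGaloisR Δ ρ ∧ IsBddMap ρ.symm

theorem slice_aux {ω : A →ₗ[ℂ] ℂ} (hω : IsBddMap ω) :
    IsBddMap₂ (fun a b : A => (LinearMap.lsmul ℂ A ∘ₗ ω).flip a b) := by
  intro S T hS hT
  obtain ⟨C, hC⟩ := (hω T hT).subset_closedBall 0
  refine (CompleteConvexBornology.isBounded_smul (max C 1 : ℝ) _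
    (CompleteConvexBornology.isBounded_hull S hS)).subset ?_
  rintro _ ⟨a, ha, b, hb, rfl⟩
  have hpos : 0 < max C 1 := by positivity
  have h0 : ((max C 1 : ℝ) : ℂ) ≠ 0 := by exact_mod_cast hpos.ne'
  refine ⟨((max C 1 : ℝ) : ℂ)⁻¹ • ω b • a, subset_convexHull ℝ _ ?_, ?_⟩
  · rw [smul_smul, mem_balancedHull_iff]
    refine ⟨_, ?_, Set.smul_mem_smul_set ha⟩
    have : ‖ω b‖ ≤ C := by simpa using hC ⟨b, hb, rfl⟩
    rw [norm_mul, norm_inv, Complex.norm_real, Real.norm_eq_abs, abs_of_pos hpos,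
      inv_mul_le_iff₀ hpos, mul_one]
    exact this.trans (le_max_left _ _)
  · exact smul_inv_smul₀ h0 _

/-- The slice map `ι ⊗ ω : A ⊗̂ A → A`, `a ⊗ b ↦ ω(b) a`. -/
noncomputable def slice (ω : A →ₗ[ℂ] ℂ) (hω : IsBddMap ω) : CTensor A A →ₗ[ℂ] A :=
  CTensor.lift (LinearMap.lsmul ℂ A ∘ₗ ω).flip (slice_aux hω)

/-- Left invariance: `(ι ⊗ φ)(Δ(a)) = φ(a) 1`, where `(ι ⊗ φ)(Δ(a)) ∈ M(A)` is given by
`(ι ⊗ φ)(Δ(a)) b = (ι ⊗ φ)(Δ(a) (b ⊗ 1))` and `b (ι ⊗ φ)(Δ(a)) = (ι ⊗ φ)((b ⊗ 1) Δ(a))`. -/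
def IsLeftInvariant (Δ : A →⋆ₙₐ[ℂ] Multiplier (CTensor A A)) (φ : A →ₗ[ℂ] ℂ)
    (hφ : IsBddMap φ) : Prop :=
  ∀ (a b : A) (t : CTensor A A),
    (Multiplier.ofElem t = Δ a * Multiplier.tmul (Multiplier.ofElem b) 1 →
      slice φ hφ t = φ a • b) ∧
    (Multiplier.ofElem t = Multiplier.tmul (Multiplier.ofElem b) 1 * Δ a →
      slice φ hφ t = φ a • b)

variable (A) in
/-- The structure of a bornological quantum group (with involution) on `A`: a coproduct with the
cancellation property on the essential bornological `*`-algebra `A`, together with a positive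
faithful left invariant integral. -/
structure BornologicalQuantumGroup where
  comul : A →⋆ₙₐ[ℂ] Multiplier (CTensor A A)
  integral : A →ₗ[ℂ] ℂ
  essential : IsEssentialAlgebra A
  isCoproduct : IsCoproduct comul
  cancellation : HasCancellation comul
  bdd_integral : IsBddMap integral
  positive : ∀ a, 0 ≤ (integral (star a * a)).re ∧ (integral (star a * a)).im = 0
  faithful : ∀ a, integral (star a * a) = 0 → a = 0
  leftInvariant : IsLeftInvariant comul integral bdd_integral

end BQG

/-! ### Hilbert space tensor products and concrete `C^*`-algebras -/

section Hilbert

variable {H : Type u} {K : Type v} {L : Type w}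
  [NormedAddCommGroup H] [InnerProductSpace ℂ H]
  [NormedAddCommGroup K] [InnerProductSpace ℂ K]
  [NormedAddCommGroup L] [InnerProductSpace ℂ L]

variable (H K) in
/-- The Hilbert space tensor product `H ⊗ K`. -/
abbrev HTensor : Type (max u v) := UniformSpace.Completion (H ⊗[ℂ] K)

variable (H K) in
/-- The bilinear map `(ξ, η) ↦ ξ ⊗ η`. -/
noncomputable def htmulBilin : H →ₗ[ℂ] K →ₗ[ℂ] HTensor H K :=
  (TensorProduct.mk ℂ H K).compr₂ (UniformSpace.Completion.toComplₗᵢ (𝕜 := ℂ)).toLinearMap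

/-- The elementary tensor `ξ ⊗ η`. -/
noncomputable def htmul (ξ : H) (η : K) : HTensor H K := htmulBilin H K ξ η

/-- The operator `x ⊗ y` on `H ⊗ K`. -/
noncomputable def opTensor (x : H →L[ℂ] H) (y : K →L[ℂ] K) : HTensor H K →L[ℂ] HTensor H K :=
  (TensorProduct.mapL x y).completion

theorem opTensor_htmul (x : H →L[ℂ] H) (y : K →L[ℂ] K) (ξ : H) (η : K) :
    opTensor x y (htmul ξ η) = htmul (x ξ) (y η) := by
  change (TensorProduct.mapL x y).completion ((ξ ⊗ₜ[ℂ] η : H ⊗[ℂ] K) : HTensor H K) = _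
  rw [ContinuousLinearMap.completion_apply_coe]
  rfl

theorem denseRange_mapIsometry {H' : Type*} {K' : Type*}
    [NormedAddCommGroup H'] [InnerProductSpace ℂ H']
    [NormedAddCommGroup K'] [InnerProductSpace ℂ K'] (f : H →ₗᵢ[ℂ] H') (g : K →ₗᵢ[ℂ] K')
    (hf : DenseRange f) (hg : DenseRange g) : DenseRange (TensorProduct.mapIsometry f g) := by
  set M := (LinearMap.range (TensorProduct.mapIsometry f g).toLinearMap).topologicalClosure with hM
  have h1 : ∀ ξ η, ξ ⊗ₜ[ℂ] η ∈ M := by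
    intro ξ η
    have hcl : IsClosed {p : H' × K' | p.1 ⊗ₜ[ℂ] p.2 ∈ M} :=
      (Submodule.isClosed_topologicalClosure _).preimage TensorProduct.continuous_tmul
    have hd : DenseRange (Prod.map f g) := hf.prodMap hg
    refine hd.induction_on (p := fun p : H' × K' => p.1 ⊗ₜ[ℂ] p.2 ∈ M) (ξ, η) hcl ?_
    rintro ⟨a, b⟩
    exact Submodule.le_topologicalClosure _ ⟨a ⊗ₜ b, by simp⟩
  intro x
  have : x ∈ M := by
    induction x with
    | zero => exact Submodule.zero_mem _
    | tmul ξ η => exact h1 ξ η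
    | add x y hx hy => exact Submodule.add_mem _ hx hy
  exact this

variable (H K L) in
/-- The canonical isometry `(H ⊗ K) ⊗ L → (H ⊗̂ K) ⊗̂ L` from the algebraic tensor product. -/
noncomputable def assocLeft : (H ⊗[ℂ] K) ⊗[ℂ] L →ₗᵢ[ℂ] HTensor (HTensor H K) L :=
  (UniformSpace.Completion.toComplₗᵢ (𝕜 := ℂ)).comp
    (TensorProduct.mapIsometry (UniformSpace.Completion.toComplₗᵢ (𝕜 := ℂ)) LinearIsometry.id)

variable (H K L) in
/-- The canonical isometry `H ⊗ (K ⊗ L) → H ⊗̂ (K ⊗̂ L)` from the algebraic tensor product. -/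
noncomputable def assocRight : H ⊗[ℂ] (K ⊗[ℂ] L) →ₗᵢ[ℂ] HTensor H (HTensor K L) :=
  (UniformSpace.Completion.toComplₗᵢ (𝕜 := ℂ)).comp
    (TensorProduct.mapIsometry LinearIsometry.id (UniformSpace.Completion.toComplₗᵢ (𝕜 := ℂ)))

theorem denseRange_assocLeft : DenseRange (assocLeft H K L) :=
  UniformSpace.Completion.denseRange_coe.comp
    (denseRange_mapIsometry _ _ UniformSpace.Completion.denseRange_coe denseRange_id)
    (UniformSpace.Completion.continuous_coe _)

theorem denseRange_assocRight : DenseRange (assocRight H K L) :=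
  UniformSpace.Completion.denseRange_coe.comp
    (denseRange_mapIsometry _ _ denseRange_id UniformSpace.Completion.denseRange_coe)
    (UniformSpace.Completion.continuous_coe _)

variable (H K L) in
/-- The associativity unitary `(H ⊗ K) ⊗ L ≃ H ⊗ (K ⊗ L)`. -/
noncomputable def hassoc : HTensor (HTensor H K) L ≃ₗᵢ[ℂ] HTensor H (HTensor K L) :=
  (TensorProduct.assocIsometry ℂ H K L).toLinearEquiv.extendOfIsometry
    (assocLeft H K L).toLinearMap (assocRight H K L).toLinearMap
    denseRange_assocLeft denseRange_assocRight
    (fun x => by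
      change ‖assocRight H K L _‖ = ‖assocLeft H K L x‖
      rw [LinearIsometry.norm_map, LinearIsometry.norm_map]
      exact (TensorProduct.assocIsometry ℂ H K L).norm_map x)

theorem hassoc_htmul (ξ : H) (η : K) (ζ : L) :
    hassoc H K L (htmul (htmul ξ η) ζ) = htmul ξ (htmul η ζ) :=
  LinearEquiv.extendOfIsometry_eq _ _ _ _ _ _ ((ξ ⊗ₜ[ℂ] η) ⊗ₜ[ℂ] ζ)

variable [CompleteSpace H] [CompleteSpace K]

instance : ContinuousStar (H →L[ℂ] H) := NormedStarGroup.to_continuousStar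

instance : IsSemitopologicalSemiring (H →L[ℂ] H) :=
  IsTopologicalSemiring.toIsSemitopologicalSemiring (H →L[ℂ] H)

/-- The spatial (minimal) tensor product `C ⊗ D`: the `C^*`-subalgebra of `B(H ⊗ K)` generated by
the operators `x ⊗ y` with `x ∈ C` and `y ∈ D`. -/
noncomputable def spatialTensor (C : NonUnitalStarSubalgebra ℂ (H →L[ℂ] H))
    (D : NonUnitalStarSubalgebra ℂ (K →L[ℂ] K)) :
    NonUnitalStarSubalgebra ℂ (HTensor H K →L[ℂ] HTensor H K) :=
  (NonUnitalStarAlgebra.adjoin ℂ {T | ∃ x ∈ C, ∃ y ∈ D, T = opTensor x y}).topologicalClosure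

/-- The multiplier algebra `M(C) = {T ∈ B(H) : T C ⊆ C, C T ⊆ C}` of a non-degenerate
`C^*`-subalgebra `C` of `B(H)`. -/
def cstarMultiplier (C : NonUnitalStarSubalgebra ℂ (H →L[ℂ] H)) :
    StarSubalgebra ℂ (H →L[ℂ] H) where
  carrier := {T | ∀ x ∈ C, T * x ∈ C ∧ x * T ∈ C}
  mul_mem' := by
    intro S T hS hT x hx
    exact ⟨by rw [mul_assoc]; exact (hS _ (hT x hx).1).1,
      by rw [← mul_assoc]; exact (hT _ (hS x hx).2).2⟩
  add_mem' := by
    intro S T hS hT x hx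
    exact ⟨by rw [add_mul]; exact add_mem (hS x hx).1 (hT x hx).1,
      by rw [mul_add]; exact add_mem (hS x hx).2 (hT x hx).2⟩
  algebraMap_mem' := by
    intro c x hx
    rw [← Algebra.commutes, ← Algebra.smul_def]
    exact ⟨SMulMemClass.smul_mem c hx, SMulMemClass.smul_mem c hx⟩
  star_mem' := by
    intro T hT x hx
    have h := hT (star x) (star_mem hx)
    exact ⟨by simpa using star_mem h.2, by simpa using star_mem h.1⟩

/-- A `C^*`-algebra acting non-degenerately. -/
def IsNondegenerate (C : NonUnitalStarSubalgebra ℂ (H →L[ℂ] H)) : Prop :=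
  Dense (Submodule.span ℂ {η : H | ∃ x ∈ C, ∃ ξ : H, η = x ξ} : Set H)

/-- Coassociativity of `Δ : C → M(C ⊗ C)`. The homomorphisms `Δ ⊗ ι` and `ι ⊗ Δ`, extended to
unital `*`-homomorphisms `M(C ⊗ C) → M(C ⊗ C ⊗ C)`, exist and any such extensions agree on the
range of `Δ`. -/
def IsCStarCoassociative (C : NonUnitalStarSubalgebra ℂ (H →L[ℂ] H))
    (Δ : C →⋆ₙₐ[ℂ] cstarMultiplier (spatialTensor C C)) : Prop :=
  let IsLeftExt := fun F : cstarMultiplier (spatialTensor C C) →⋆ₐ[ℂ]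
      cstarMultiplier (spatialTensor (spatialTensor C C) C) =>
    ∀ (a b : C) (T : cstarMultiplier (spatialTensor C C)), T.1 = opTensor a.1 b.1 →
      (F T).1 = opTensor (Δ a).1 b.1
  let IsRightExt := fun F : cstarMultiplier (spatialTensor C C) →⋆ₐ[ℂ]
      cstarMultiplier (spatialTensor C (spatialTensor C C)) =>
    ∀ (a b : C) (T : cstarMultiplier (spatialTensor C C)), T.1 = opTensor a.1 b.1 →
      (F T).1 = opTensor a.1 (Δ b).1
  (∃ F, IsLeftExt F) ∧ (∃ G, IsRightExt G) ∧
    ∀ F G, IsLeftExt F → IsRightExt G → ∀ (x : C) (ζ : HTensor (HTensor H H) H),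
      hassoc H H H ((F (Δ x)).1 ζ) = (G (Δ x)).1 (hassoc H H H ζ)

end Hilbert

/-! ### The reduced `C^*`-algebra of functions on a bornological quantum group -/

namespace BornologicalQuantumGroup

variable {A : Type u} [NonUnitalRing A] [Module ℂ A] [IsScalarTower ℂ A A] [SMulCommClass ℂ A A]
  [StarRing A] [StarModule ℂ A] [Bornology A] [BornologicalStarAlgebra A]
  {H : Type v} [NormedAddCommGroup H] [InnerProductSpace ℂ H] [CompleteSpace H]

/-- `(H, Λ)` is a GNS pair for the left invariant integral. -/
structure IsGNS (G : BornologicalQuantumGroup A) (Λ : A →ₗ[ℂ] H) : Prop where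
  dense : DenseRange Λ
  inner_eq : ∀ f g, inner ℂ (Λ f) (Λ g) = G.integral (star f * g)

theorem IsGNS.bdd {G : BornologicalQuantumGroup A} {Λ : A →ₗ[ℂ] H} (h : G.IsGNS Λ) :
    IsBddMap Λ := by
  intro S hS
  have h1 : IsBounded (Set.image2 (fun a b : A => a * b) ((fun a : A => star a) '' S) S) :=
    BornologicalAlgebra.bdd_mul _ _ (BornologicalStarAlgebra.bdd_star S hS) hS
  obtain ⟨C, hC⟩ := (G.bdd_integral _ h1).subset_closedBall 0
  refine (Metric.isBounded_closedBall (x := (0 : H)) (r := Real.sqrt C)).subset ?_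
  rintro _ ⟨a, ha, rfl⟩
  rw [mem_closedBall_zero_iff]
  apply Real.le_sqrt_of_sq_le
  have h2 : ‖G.integral (star a * a)‖ ≤ C := by
    simpa using hC ⟨_, ⟨star a, ⟨a, ha, rfl⟩, a, ha, rfl⟩, rfl⟩
  rw [← h.inner_eq, inner_self_eq_norm_sq_to_K] at h2
  simpa using h2

theorem hilbertMap_aux {Λ : A →ₗ[ℂ] H} (hΛ : IsBddMap Λ) :
    IsBddMap₂ (fun a b => ((htmulBilin H H).compl₁₂ Λ Λ) a b) := by
  intro S T hS hT
  obtain ⟨C, hC⟩ := (hΛ S hS).subset_closedBall 0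
  obtain ⟨D, hD⟩ := (hΛ T hT).subset_closedBall 0
  refine (Metric.isBounded_closedBall (x := (0 : HTensor H H)) (r := C * D)).subset ?_
  rintro _ ⟨a, ha, b, hb, rfl⟩
  have h1 : ‖Λ a‖ ≤ C := by simpa using hC ⟨a, ha, rfl⟩
  have h2 : ‖Λ b‖ ≤ D := by simpa using hD ⟨b, hb, rfl⟩
  rw [mem_closedBall_zero_iff]
  change ‖((Λ a ⊗ₜ[ℂ] Λ b : H ⊗[ℂ] H) : HTensor H H)‖ ≤ _
  rw [UniformSpace.Completion.norm_coe, TensorProduct.norm_tmul]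
  have := norm_nonneg (Λ a)
  gcongr
  linarith

/-- The bounded map `Λ ⊗̂ Λ : A ⊗̂ A → H ⊗ H`. -/
noncomputable def hilbertMap (Λ : A →ₗ[ℂ] H) (hΛ : IsBddMap Λ) : CTensor A A →ₗ[ℂ] HTensor H H :=
  CTensor.lift ((htmulBilin H H).compl₁₂ Λ Λ) (hilbertMap_aux hΛ)

/-- `W` is the multiplicative unitary: the unitary operator with
`W (Λ ⊗ Λ)(Δ(g)(f ⊗ 1)) = Λ(f) ⊗ Λ(g)`. -/
def IsMultiplicativeUnitary (G : BornologicalQuantumGroup A) {Λ : A →ₗ[ℂ] H} (hΛ : G.IsGNS Λ)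
    (W : HTensor H H →L[ℂ] HTensor H H) : Prop :=
  W ∈ unitary (HTensor H H →L[ℂ] HTensor H H) ∧
  ∀ (f g : A) (t : CTensor A A),
    Multiplier.ofElem t = G.comul g * Multiplier.tmul (Multiplier.ofElem f) 1 →
      W (hilbertMap Λ hΛ.bdd t) = htmul (Λ f) (Λ g)

/-- `C_0^r(𝔾)`: the norm closure of the set of the bounded operators `m(f)` extending
`Λ(g) ↦ Λ(f g)`. -/
def reducedFunctions (Λ : A →ₗ[ℂ] H) : Set (H →L[ℂ] H) :=
  closure {T | ∃ f : A, ∀ g : A, T (Λ g) = Λ (f * g)}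

end BornologicalQuantumGroup

end BornQG

open BornQG

namespace BornQG

/-! ### Hilbert space tensor products -/

section HTensor

variable {H : Type u} {K : Type v} {L : Type w}
  [NormedAddCommGroup H] [InnerProductSpace ℂ H]
  [NormedAddCommGroup K] [InnerProductSpace ℂ K]
  [NormedAddCommGroup L] [InnerProductSpace ℂ L]

/-! Write `φ` for the integral and `γ`, `ρ` for the Galois maps `γ(a ⊗ b) = Δ(a)(b ⊗ 1)` and `ρ(a ⊗
b) = (1 ⊗ a)Δ(b)`. The proof rests on the bijectivity of these two maps on `A ⊗̂ A`.

The unitary. As multipliers, `γ(a ⊗ b)^* γ(c ⊗ d) = (b^* ⊗ 1)Δ(a^* c)(d ⊗ 1)`, so left invariance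
gives `(φ ⊗ φ)(γ(a ⊗ b)^* γ(c ⊗ d)) = φ(a^* c) φ(b^* d)` (`slice_star_galoisL_mul_galoisL`). Hence
`Λ(b) ⊗ Λ(a) ↦ (Λ ⊗ Λ)γ(a ⊗ b)` is isometric, and it has dense range because `γ` is onto. Its
extension is `W^*`.

Bounded multiplication. Slicing the second leg of `W^*` by `⟨Λ(x^*), · Λ(y)⟩` gives a bounded
operator, which turns out to be left multiplication by `(ι ⊗ φ)ρ(x ⊗ y)` (`lift_sliceBilin_apply`).
Since `ρ` is bijective, `(ι ⊗ φ)ρ(u)` becomes `φ(b) a` for `u = ρ⁻¹(a ⊗ b)`. So every `m(a)` is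
bounded, and `m` is a bounded map from `A` to `B(H)`.

The coproduct. On the vectors `(Λ ⊗ Λ)(t)` the operator `W^*(1 ⊗ m(a))W` acts as `Δ(a)`
(`comulHom_leftRegular_map₂`). Therefore `m ⊗ m` sends `Δ(a)t`, `γ(a ⊗ b)` and `ρ(a ⊗ b)` to
`Δ(m(a))(m ⊗ m)(t)`, `Δ(m(a))(m(b) ⊗ 1)` and `(1 ⊗ m(a))Δ(m(b))`. The multiplier property comes from
the first of these, non-degeneracy from essentiality of `Δ`, and the two density statements from
surjectivity of `γ` and, after taking adjoints, of `ρ`.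

Coassociativity. In leg notation `Δ ⊗ ι` and `ι ⊗ Δ` are `T ↦ W₁₂^* T₂₃ W₁₂` and `T ↦ W₂₃^* T₁₃
W₂₃`, defined on all bounded operators. Non-degeneracy shows that they preserve multipliers and that
they are the only extensions. On the vectors `(Λ ⊗ Λ ⊗ Λ)(y)` they implement the algebraic actions,
so coassociativity passes from `A` to `m(A)` and by continuity to `C`.

Two devices recur. Elements of `A ⊗̂ A` are infinite sums, so claims are reduced to elementary
tensors through closed subspaces of Banach spaces (`CTensor.map_mem`). The hypotheses are identities
in `M(A ⊗̂ A)`, and faithfulness of `φ` shows that slices and Hilbert space vectors depend only on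
the multiplier (`slice_congr`, `map₂_congr`). -/

theorem inner_htmul (a c : H) (b d : K) :
    inner ℂ (htmul a b) (htmul c d) = inner ℂ a c * inner ℂ b d := by
  change inner ℂ ((a ⊗ₜ[ℂ] b : H ⊗[ℂ] K) : HTensor H K) ((c ⊗ₜ[ℂ] d : H ⊗[ℂ] K) : HTensor H K) = _
  rw [UniformSpace.Completion.inner_coe, TensorProduct.inner_tmul]

theorem norm_htmul (a : H) (b : K) : ‖htmul a b‖ = ‖a‖ * ‖b‖ := by
  change ‖((a ⊗ₜ[ℂ] b : H ⊗[ℂ] K) : HTensor H K)‖ = _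
  rw [UniformSpace.Completion.norm_coe, TensorProduct.norm_tmul]

variable (H K) in
/-- The continuous bilinear map `(ξ, η) ↦ ξ ⊗ η`. -/
noncomputable def htmulL : H →L[ℂ] K →L[ℂ] HTensor H K :=
  (htmulBilin H K).mkContinuous₂ 1 fun x y => by
    rw [one_mul]
    exact (norm_htmul x y).le

theorem htmulL_apply (a : H) (b : K) : htmulL H K a b = htmul a b := rfl

theorem add_htmul (a a' : H) (b : K) : htmul (a + a') b = htmul a b + htmul a' b := by
  simp [htmul]

theorem smul_htmul (c : ℂ) (a : H) (b : K) : htmul (c • a) b = c • htmul a b := by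
  simp [htmul]

theorem htmul_add (a : H) (b b' : K) : htmul a (b + b') = htmul a b + htmul a b' := by
  simp [htmul]

theorem htmul_smul (c : ℂ) (a : H) (b : K) : htmul a (c • b) = c • htmul a b := by
  simp [htmul]

/-- As `N` is closed and `htmul` is separately continuous, the two variables can be enlarged one
after the other from the spanning sets to the whole spaces. Algebraic tensors are then dense in the
completion. This is the density test for all the Hilbert space tensor products below. -/
theorem htmul_mem_of_dense {s : Set H} {t : Set K}
    (hs : Dense (Submodule.span ℂ s : Set H)) (ht : Dense (Submodule.span ℂ t : Set K))
    {N : Submodule ℂ (HTensor H K)} (hN : IsClosed (N : Set (HTensor H K)))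
    (h : ∀ x ∈ s, ∀ y ∈ t, htmul x y ∈ N) : N = ⊤ := by
  have h1 : ∀ x ∈ s, ∀ η, htmul x η ∈ N := by
    intro x hx
    have hcl : IsClosed ((N.comap (htmulL H K x).toLinearMap : Submodule ℂ K) : Set K) :=
      hN.preimage (htmulL H K x).continuous
    have hle : Submodule.span ℂ t ≤ N.comap (htmulL H K x).toLinearMap :=
      Submodule.span_le.2 fun y hy => h x hx y hy
    intro η
    exact closure_minimal hle hcl (ht η)
  have h2 : ∀ ξ η, htmul ξ η ∈ N := by
    intro ξ η
    have hcl : IsClosed ((N.comap ((htmulL H K).flip η).toLinearMap : Submodule ℂ H) : Set H) :=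
      hN.preimage ((htmulL H K).flip η).continuous
    have hle : Submodule.span ℂ s ≤ N.comap ((htmulL H K).flip η).toLinearMap :=
      Submodule.span_le.2 fun x hx => h1 x hx η
    exact closure_minimal hle hcl (hs ξ)
  rw [eq_top_iff]
  rintro x -
  refine UniformSpace.Completion.induction_on x hN fun y => ?_
  induction y with
  | zero => exact N.zero_mem
  | tmul a b => exact h2 a b
  | add a b ha hb =>
    rw [UniformSpace.Completion.coe_add]
    exact N.add_mem ha hb

theorem dense_span_univ (V : Type*) [NormedAddCommGroup V] [NormedSpace ℂ V] :
    Dense (Submodule.span ℂ (Set.univ : Set V) : Set V) := by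
  rw [Submodule.span_univ]
  exact dense_univ

theorem dense_span_range_htmul :
    Dense (Submodule.span ℂ {x : HTensor H K | ∃ ξ η, x = htmul ξ η} : Set (HTensor H K)) := by
  rw [Submodule.dense_iff_topologicalClosure_eq_top]
  exact htmul_mem_of_dense (dense_span_univ H) (dense_span_univ K)
    (Submodule.isClosed_topologicalClosure _)
    fun x _ y _ => Submodule.le_topologicalClosure _ (Submodule.subset_span ⟨x, y, rfl⟩)

theorem clm_ext_of_dense_span {X Y : Type*} [NormedAddCommGroup X] [NormedSpace ℂ X]
    [NormedAddCommGroup Y] [NormedSpace ℂ Y] {s : Set X}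
    (hs : Dense (Submodule.span ℂ s : Set X)) {T S : X →L[ℂ] Y} (h : ∀ x ∈ s, T x = S x) :
    T = S :=
  ContinuousLinearMap.ext_on hs h

theorem HTensor.clm_ext {X : Type*} [NormedAddCommGroup X] [NormedSpace ℂ X]
    {T S : HTensor H K →L[ℂ] X} (h : ∀ ξ η, T (htmul ξ η) = S (htmul ξ η)) : T = S := by
  refine clm_ext_of_dense_span dense_span_range_htmul ?_
  rintro _ ⟨ξ, η, rfl⟩
  exact h ξ η

theorem norm_opTensor_le (x : H →L[ℂ] H) (y : K →L[ℂ] K) : ‖opTensor x y‖ ≤ ‖x‖ * ‖y‖ := by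
  refine ContinuousLinearMap.opNorm_le_bound _ (by positivity) fun ξ => ?_
  refine UniformSpace.Completion.induction_on ξ
    (isClosed_le (by fun_prop) (by fun_prop)) fun z => ?_
  rw [opTensor, ContinuousLinearMap.completion_apply_coe, UniformSpace.Completion.norm_coe,
    UniformSpace.Completion.norm_coe]
  exact (ContinuousLinearMap.le_opNorm _ _).trans
    (mul_le_mul_of_nonneg_right (TensorProduct.norm_mapL_le x y) (norm_nonneg _))

variable (H K) in
/-- The bilinear map `(x, y) ↦ x ⊗ y` on operators. -/
noncomputable def opTensorBilin :
    (H →L[ℂ] H) →ₗ[ℂ] (K →L[ℂ] K) →ₗ[ℂ] (HTensor H K →L[ℂ] HTensor H K) :=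
  LinearMap.mk₂ ℂ (fun (x : H →L[ℂ] H) (y : K →L[ℂ] K) => opTensor x y)
    (fun x x' y => HTensor.clm_ext fun ξ η => by
      simp only [opTensor_htmul, add_apply, add_htmul])
    (fun c x y => HTensor.clm_ext fun ξ η => by
      simp only [opTensor_htmul, smul_apply, smul_htmul])
    (fun x y y' => HTensor.clm_ext fun ξ η => by
      simp only [opTensor_htmul, add_apply, htmul_add])
    (fun c x y => HTensor.clm_ext fun ξ η => by
      simp only [opTensor_htmul, smul_apply, htmul_smul])

theorem opTensorBilin_apply (x : H →L[ℂ] H) (y : K →L[ℂ] K) :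
    opTensorBilin H K x y = opTensor x y := rfl

theorem continuous_opTensor_right (x : H →L[ℂ] H) :
    Continuous fun y : K →L[ℂ] K => opTensor x y :=
  AddMonoidHomClass.continuous_of_bound (opTensorBilin H K x) ‖x‖ (norm_opTensor_le x)

theorem continuous_opTensor_left (y : K →L[ℂ] K) :
    Continuous fun x : H →L[ℂ] H => opTensor x y :=
  AddMonoidHomClass.continuous_of_bound ((opTensorBilin H K).flip y) ‖y‖ fun x => by
    rw [mul_comm]
    exact norm_opTensor_le x y

theorem opTensor_mul (x x' : H →L[ℂ] H) (y y' : K →L[ℂ] K) :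
    opTensor x y * opTensor x' y' = opTensor (x * x') (y * y') :=
  HTensor.clm_ext fun ξ η => by
    simp only [mul_apply_eq_comp, opTensor_htmul]

theorem opTensor_one : opTensor (1 : H →L[ℂ] H) (1 : K →L[ℂ] K) = 1 :=
  HTensor.clm_ext fun ξ η => by
    simp only [one_apply_eq_self, opTensor_htmul]

/-- The difference is orthogonal to a dense subspace. With `s` the range of `Λ` or `Λ ⊗ Λ`, equality
of vectors becomes an identity for the integral. -/
theorem ext_inner_of_dense_span {X : Type*} [NormedAddCommGroup X] [InnerProductSpace ℂ X]
    {s : Set X} (hs : Dense (Submodule.span ℂ s : Set X)) {x y : X}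
    (h : ∀ z ∈ s, inner ℂ z x = inner ℂ z y) : x = y := by
  have : x - y ∈ (Submodule.span ℂ s)ᗮ := by
    rw [Submodule.mem_orthogonal]
    intro u hu
    induction hu using Submodule.span_induction with
    | mem z hz => rw [inner_sub_right, h z hz, sub_self]
    | zero => exact inner_zero_left _
    | add a b _ _ ha hb => rw [inner_add_left, ha, hb, add_zero]
    | smul c a _ ha => rw [inner_smul_left, ha, mul_zero]
  have h2 := (Submodule.span ℂ s).orthogonal_closure
  rw [← h2, Submodule.dense_iff_topologicalClosure_eq_top.1 hs, Submodule.top_orthogonal_eq_bot,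
    Submodule.mem_bot, sub_eq_zero] at this
  exact this

theorem star_opTensor [CompleteSpace H] [CompleteSpace K] (x : H →L[ℂ] H) (y : K →L[ℂ] K) :
    star (opTensor x y) = opTensor (star x) (star y) := by
  refine HTensor.clm_ext fun ξ η => ext_inner_of_dense_span dense_span_range_htmul ?_
  rintro _ ⟨ξ', η', rfl⟩
  rw [ContinuousLinearMap.star_eq_adjoint, ContinuousLinearMap.adjoint_inner_right,
    opTensor_htmul, opTensor_htmul, inner_htmul, inner_htmul,
    ContinuousLinearMap.star_eq_adjoint, ContinuousLinearMap.star_eq_adjoint,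
    ContinuousLinearMap.adjoint_inner_right, ContinuousLinearMap.adjoint_inner_right]

variable (H K) in
/-- The homomorphism `T ↦ 1 ⊗ T`. -/
noncomputable def oneTensorHom [CompleteSpace H] [CompleteSpace K] :
    (K →L[ℂ] K) →⋆ₐ[ℂ] (HTensor H K →L[ℂ] HTensor H K) where
  toFun T := opTensor 1 T
  map_one' := opTensor_one
  map_mul' S T := by rw [opTensor_mul, one_mul]
  map_zero' := map_zero (opTensorBilin H K 1)
  map_add' S T := map_add (opTensorBilin H K 1) S T
  commutes' c := by
    rw [Algebra.algebraMap_eq_smul_one, Algebra.algebraMap_eq_smul_one, ← opTensor_one]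
    exact map_smul (opTensorBilin H K 1) c 1
  map_star' T := by rw [star_opTensor, star_one]

variable (H K L) in
/-- The isometry `ξ ⊗ (η ⊗ ζ) ↦ η ⊗ (ξ ⊗ ζ)` of algebraic tensor products. -/
noncomputable def leftCommIsometry : H ⊗[ℂ] (K ⊗[ℂ] L) ≃ₗᵢ[ℂ] K ⊗[ℂ] (H ⊗[ℂ] L) :=
  ((TensorProduct.assocIsometry ℂ H K L).symm.trans
    (TensorProduct.congrIsometry (TensorProduct.commIsometry ℂ H K)
      (LinearIsometryEquiv.refl ℂ L))).trans (TensorProduct.assocIsometry ℂ K H L)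

variable (H K L) in
/-- The unitary `ξ ⊗ (η ⊗ ζ) ↦ η ⊗ (ξ ⊗ ζ)`. -/
noncomputable def hleftComm : HTensor H (HTensor K L) ≃ₗᵢ[ℂ] HTensor K (HTensor H L) :=
  (leftCommIsometry H K L).toLinearEquiv.extendOfIsometry
    (assocRight H K L).toLinearMap (assocRight K H L).toLinearMap
    denseRange_assocRight denseRange_assocRight
    (fun x => by
      change ‖assocRight K H L _‖ = ‖assocRight H K L x‖
      rw [LinearIsometry.norm_map, LinearIsometry.norm_map]
      exact (leftCommIsometry H K L).norm_map x)

theorem hleftComm_htmul (ξ : H) (η : K) (ζ : L) :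
    hleftComm H K L (htmul ξ (htmul η ζ)) = htmul η (htmul ξ ζ) :=
  LinearEquiv.extendOfIsometry_eq _ _ _ _ _ _ (ξ ⊗ₜ[ℂ] (η ⊗ₜ[ℂ] ζ))

theorem hassoc_opTensor (x : H →L[ℂ] H) (y : K →L[ℂ] K) (z : L →L[ℂ] L)
    (ζ : HTensor (HTensor H K) L) :
    hassoc H K L (opTensor (opTensor x y) z ζ) = opTensor x (opTensor y z) (hassoc H K L ζ) := by
  have h : ((hassoc H K L).toContinuousLinearEquiv : _ →L[ℂ] _).comp
      (opTensor (opTensor x y) z) = (opTensor x (opTensor y z)).comp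
        ((hassoc H K L).toContinuousLinearEquiv : _ →L[ℂ] _) := by
    refine HTensor.clm_ext fun ξ η => ?_
    -- The vector `ξ` of `H ⊗ K` need not be an elementary tensor, so a second continuity argument
    -- is made in that slot, with `η` fixed.
    have h2 : (((hassoc H K L).toContinuousLinearEquiv : _ →L[ℂ] _).comp
        (opTensor (opTensor x y) z)).comp ((htmulL _ L).flip η) =
        ((opTensor x (opTensor y z)).comp
          ((hassoc H K L).toContinuousLinearEquiv : _ →L[ℂ] _)).comp ((htmulL _ L).flip η) := by
      refine HTensor.clm_ext fun a b => ?_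
      simp [htmulL_apply, opTensor_htmul, hassoc_htmul]
    exact congrArg (fun T => T ξ) h2
  exact congrArg (fun T => T ζ) h

theorem hleftComm_opTensor (x : H →L[ℂ] H) (y : K →L[ℂ] K) (z : L →L[ℂ] L)
    (ζ : HTensor H (HTensor K L)) :
    hleftComm H K L (opTensor x (opTensor y z) ζ) =
      opTensor y (opTensor x z) (hleftComm H K L ζ) := by
  have h : ((hleftComm H K L).toContinuousLinearEquiv : _ →L[ℂ] _).comp
      (opTensor x (opTensor y z)) = (opTensor y (opTensor x z)).comp
        ((hleftComm H K L).toContinuousLinearEquiv : _ →L[ℂ] _) := by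
    refine HTensor.clm_ext fun ξ η => ?_
    have h2 : (((hleftComm H K L).toContinuousLinearEquiv : _ →L[ℂ] _).comp
        (opTensor x (opTensor y z))).comp (htmulL H _ ξ) =
        ((opTensor y (opTensor x z)).comp
          ((hleftComm H K L).toContinuousLinearEquiv : _ →L[ℂ] _)).comp (htmulL H _ ξ) := by
      refine HTensor.clm_ext fun a b => ?_
      simp [htmulL_apply, opTensor_htmul, hleftComm_htmul]
    exact congrArg (fun T => T η) h2
  exact congrArg (fun T => T ζ) h

end HTensor

/-! ### Spatial tensor products and multipliers -/

section Spatial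

variable {H : Type u} {K : Type v} {L : Type w}
  [NormedAddCommGroup H] [InnerProductSpace ℂ H] [CompleteSpace H]
  [NormedAddCommGroup K] [InnerProductSpace ℂ K] [CompleteSpace K]
  [NormedAddCommGroup L] [InnerProductSpace ℂ L] [CompleteSpace L]
  {C : NonUnitalStarSubalgebra ℂ (H →L[ℂ] H)} {D : NonUnitalStarSubalgebra ℂ (K →L[ℂ] K)}

theorem opTensor_mem_spatialTensor {x : H →L[ℂ] H} {y : K →L[ℂ] K} (hx : x ∈ C) (hy : y ∈ D) :
    opTensor x y ∈ spatialTensor C D :=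
  NonUnitalStarSubalgebra.le_topologicalClosure _
    (NonUnitalStarAlgebra.subset_adjoin ℂ _ ⟨x, hx, y, hy, rfl⟩)

theorem isClosed_spatialTensor :
    IsClosed (spatialTensor C D : Set (HTensor H K →L[ℂ] HTensor H K)) :=
  NonUnitalStarSubalgebra.isClosed_topologicalClosure _

/-- Closed subspaces containing the elementary tensors contain the spatial tensor product. -/
theorem spatialTensor_subset {N : Submodule ℂ (HTensor H K →L[ℂ] HTensor H K)}
    (hN : IsClosed (N : Set (HTensor H K →L[ℂ] HTensor H K)))
    (h : ∀ x ∈ C, ∀ y ∈ D, opTensor x y ∈ N) :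
    (spatialTensor C D : Set (HTensor H K →L[ℂ] HTensor H K)) ⊆ N := by
  refine closure_minimal ?_ hN
  set s : Set (HTensor H K →L[ℂ] HTensor H K) := {T | ∃ x ∈ C, ∃ y ∈ D, T = opTensor x y}
  have hspan := NonUnitalStarAlgebra.adjoin_eq_span (R := ℂ) s
  intro T hT
  have hT' : T ∈ Submodule.span ℂ
      (Subsemigroup.closure (s ∪ star s) : Set (HTensor H K →L[ℂ] HTensor H K)) := by
    rw [← hspan]
    exact hT
  -- Elementary tensors are stable under adjoints and products, so the `*`-algebra which they
  -- generate is just their linear span.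
  have hs : s ∪ star s ⊆ s := by
    rintro T (hT | ⟨x, hx, y, hy, hT⟩)
    · exact hT
    · refine ⟨star x, star_mem hx, star y, star_mem hy, ?_⟩
      exact (star_star T).symm.trans ((congrArg star hT).trans (star_opTensor x y))
  have hcl : (Subsemigroup.closure (s ∪ star s) : Set (HTensor H K →L[ℂ] HTensor H K)) ⊆ s := by
    intro T hT
    induction hT using Subsemigroup.closure_induction with
    | mem x hx => exact hs hx
    | mul a b _ _ ha hb =>
      obtain ⟨x, hx, y, hy, rfl⟩ := ha
      obtain ⟨x', hx', y', hy', rfl⟩ := hb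
      exact ⟨_, mul_mem hx hx', _, mul_mem hy hy', opTensor_mul _ _ _ _⟩
  refine Submodule.span_le.2 ?_ hT'
  intro T hT
  obtain ⟨x, hx, y, hy, rfl⟩ := hcl hT
  exact h x hx y hy

/-- The subspace of all `T` such that `y T` lies in the closed subspace `N` is closed. -/
theorem isClosed_comap_mulLeft (N : Submodule ℂ (K →L[ℂ] K)) (hN : IsClosed (N : Set (K →L[ℂ] K)))
    (y : K →L[ℂ] K) :
    IsClosed ((N.comap (LinearMap.mulLeft ℂ y) : Submodule ℂ (K →L[ℂ] K)) : Set (K →L[ℂ] K)) :=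
  hN.preimage (continuous_const_mul y)

/-- Since `x T = (T^* x^*)^*`, the condition on right multiplication follows from the one on left
multiplication as soon as the operators come in a self-adjoint family. -/
theorem mem_cstarMultiplier_of_left {S : Set (K →L[ℂ] K)} (hS : ∀ T ∈ S, star T ∈ S)
    (h : ∀ T ∈ S, ∀ x ∈ D, T * x ∈ D) {T : K →L[ℂ] K} (hT : T ∈ S) : T ∈ cstarMultiplier D := by
  intro x hx
  refine ⟨h T hT x hx, ?_⟩
  have := star_mem (h _ (hS T hT) _ (star_mem hx))
  rwa [star_mul, star_star, star_star] at this

/-- Closedness makes the multiplier algebra a `C^*`-algebra, which yields automatic continuity of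
`*`-homomorphisms out of it. -/
theorem isClosed_cstarMultiplier (hD : IsClosed (D : Set (K →L[ℂ] K))) :
    IsClosed (cstarMultiplier D : Set (K →L[ℂ] K)) := by
  have : (cstarMultiplier D : Set (K →L[ℂ] K)) =
      ⋂ x ∈ D, ((fun T => T * x) ⁻¹' D) ∩ ((fun T => x * T) ⁻¹' D) := by
    ext T
    simp only [Set.mem_iInter]
    exact Iff.rfl
  rw [this]
  exact isClosed_biInter fun x _ =>
    (hD.preimage (continuous_mul_const x)).inter (hD.preimage (continuous_const_mul x))

theorem mem_cstarMultiplier_of_mem {T : K →L[ℂ] K} (hT : T ∈ D) : T ∈ cstarMultiplier D :=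
  fun _ hx => ⟨mul_mem hT hx, mul_mem hx hT⟩

theorem continuous_starAlgHom_clm (F : (K →L[ℂ] K) →⋆ₐ[ℂ] (L →L[ℂ] L)) : Continuous F :=
  AddMonoidHomClass.continuous_of_bound F 1 fun x => by
    rw [one_mul]
    exact NonUnitalStarAlgHom.norm_apply_le F x

/-- A `*`-homomorphism which is non-degenerate on `D` maps multipliers of `D` to multipliers. -/
theorem map_mem_cstarMultiplier (F : (K →L[ℂ] K) →⋆ₐ[ℂ] (L →L[ℂ] L))
    {E : NonUnitalStarSubalgebra ℂ (L →L[ℂ] L)} (hE : IsClosed (E : Set (L →L[ℂ] L)))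
    (h1 : ∀ x ∈ D, ∀ y ∈ E, F x * y ∈ E)
    (h2 : ∀ N : Submodule ℂ (L →L[ℂ] L), IsClosed (N : Set (L →L[ℂ] L)) →
      (∀ x ∈ D, ∀ y ∈ E, F x * y ∈ N) → (E : Set (L →L[ℂ] L)) ⊆ N)
    {T : K →L[ℂ] K} (hT : T ∈ cstarMultiplier D) : F T ∈ cstarMultiplier E := by
  refine mem_cstarMultiplier_of_left (S := F '' cstarMultiplier D) ?_ ?_ ⟨T, hT, rfl⟩
  · rintro _ ⟨T, hT, rfl⟩
    exact ⟨star T, star_mem hT, map_star F T⟩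
  · rintro _ ⟨T, hT, rfl⟩ y hy
    -- By non-degeneracy it suffices to test on products `F(x) y` with `x ∈ D`. There `F(T) F(x) =
    -- F(T x)`, and `T x` is again in `D`.
    refine h2 (E.toSubmodule.comap (LinearMap.mulLeft ℂ (F T)))
      (isClosed_comap_mulLeft _ hE _) ?_ hy
    intro x hx y hy
    change F T * (F x * y) ∈ E
    rw [← mul_assoc, ← map_mul]
    exact h1 _ (hT x hx).1 y hy

/-- Two `*`-homomorphisms on the multiplier algebra which agree on a generating set of `D`, and
one of which is non-degenerate on `D`, are equal. -/
theorem starAlgHom_multiplier_ext (hD : IsClosed (D : Set (K →L[ℂ] K)))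
    {E : NonUnitalStarSubalgebra ℂ (L →L[ℂ] L)} (hE : IsClosed (E : Set (L →L[ℂ] L)))
    {s : Set (K →L[ℂ] K)} (hsD : s ⊆ D)
    (hs : (D : Set (K →L[ℂ] K)) ⊆ closure (Submodule.span ℂ s : Set (K →L[ℂ] K)))
    {F F' : cstarMultiplier D →⋆ₐ[ℂ] cstarMultiplier E}
    (h : ∀ T : cstarMultiplier D, T.1 ∈ s → F T = F' T)
    (hF : Dense (Submodule.span ℂ {η : L | ∃ T : cstarMultiplier D, T.1 ∈ s ∧
      ∃ ξ, η = (F T).1 ξ} : Set L)) : F = F' := by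
  -- Norm closed `*`-subalgebras are `C^*`-algebras, so both homomorphisms are contractive.
  -- Agreement on `s` therefore spreads to its span and then to `D`.
  have : IsClosed (cstarMultiplier D : Set (K →L[ℂ] K)) := isClosed_cstarMultiplier hD
  have : IsClosed (cstarMultiplier E : Set (L →L[ℂ] L)) := isClosed_cstarMultiplier hE
  have hFc : Continuous F := AddMonoidHomClass.continuous_of_bound F 1 fun x => by
    rw [one_mul]
    exact NonUnitalStarAlgHom.norm_apply_le F x
  have hFc' : Continuous F' := AddMonoidHomClass.continuous_of_bound F' 1 fun x => by
    rw [one_mul]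
    exact NonUnitalStarAlgHom.norm_apply_le F' x
  have hsM : (Submodule.span ℂ s : Submodule ℂ (K →L[ℂ] K)) ≤
      Subalgebra.toSubmodule (cstarMultiplier D).toSubalgebra :=
    Submodule.span_le.2 fun T hT => mem_cstarMultiplier_of_mem (hsD hT)
  have hspan : ∀ T : cstarMultiplier D, T.1 ∈ Submodule.span ℂ s → F T = F' T := by
    rintro ⟨T, hTM⟩ hT
    change T ∈ Submodule.span ℂ s at hT
    induction hT using Submodule.span_induction with
    | mem x hx => exact h _ hx
    | zero => exact (map_zero F).trans (map_zero F').symm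
    | add a b ha hb h1 h2 =>
      have := congrArg₂ (· + ·) (h1 (hsM ha)) (h2 (hsM hb))
      exact ((map_add F ⟨a, hsM ha⟩ ⟨b, hsM hb⟩).trans this).trans
        (map_add F' ⟨a, hsM ha⟩ ⟨b, hsM hb⟩).symm
    | smul c a ha h1 =>
      have := congrArg (c • ·) (h1 (hsM ha))
      exact ((map_smul F c ⟨a, hsM ha⟩).trans this).trans (map_smul F' c ⟨a, hsM ha⟩).symm
  have hD' : ∀ T : cstarMultiplier D, T.1 ∈ D → F T = F' T := by
    intro T hT
    have hcl : T ∈ closure {T : cstarMultiplier D | T.1 ∈ Submodule.span ℂ s} := by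
      rw [closure_subtype]
      convert hs hT using 2
      ext x
      simp only [Set.mem_image, Set.mem_ofPred_eq, SetLike.mem_coe, Subtype.exists,
        exists_and_left, exists_prop, exists_eq_right_right, and_iff_left_iff_imp]
      exact fun hx => hsM hx
    exact closure_minimal (t := {T | F T = F' T}) hspan (isClosed_eq hFc hFc') hcl
  -- For a general multiplier `T`, compare on the dense set of vectors `F(x)ξ` with `x ∈ s`: there
  -- `F(T)F(x) = F(T x)` with `T x ∈ D`, and likewise for `F'`.
  refine StarAlgHom.ext fun T => Subtype.ext (clm_ext_of_dense_span hF ?_)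
  rintro _ ⟨x, hx, ξ, rfl⟩
  have hTx : (T * x).1 ∈ D := (T.2 _ (hsD hx)).1
  have h1 := hD' _ hTx
  rw [map_mul, map_mul, ← h x hx] at h1
  exact congrArg (fun S : cstarMultiplier E => S.1 ξ) h1

end Spatial

/-! ### Bounded maps into Banach spaces -/

section Bounded

variable {V : Type*} {W : Type*} {U : Type*} {U' : Type*}
  [AddCommGroup V] [Module ℂ V] [Bornology V]
  [AddCommGroup W] [Module ℂ W] [Bornology W]
  [AddCommGroup U] [Module ℂ U] [Bornology U]
  [AddCommGroup U'] [Module ℂ U'] [Bornology U']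
  {X : Type*} [NormedAddCommGroup X] [NormedSpace ℂ X]
  {Y : Type*} [NormedAddCommGroup Y] [NormedSpace ℂ Y]

theorem isBddMap_clm {σ : ℂ →+* ℂ} [RingHomIsometric σ] (T : X →SL[σ] Y) : IsBddMap T :=
  fun _ hS => T.lipschitz.isBounded_image hS

theorem IsBddMap.clm_comp {σ : ℂ →+* ℂ} [RingHomIsometric σ] (T : X →SL[σ] Y) {f : V → X}
    (hf : IsBddMap f) : IsBddMap fun x => T (f x) :=
  (isBddMap_clm T).comp hf

theorem isBddMap_const {V X : Type*} [Bornology V] [Bornology X] (x : X) :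
    IsBddMap fun _ : V => x := by
  intro S _
  refine isBounded_singleton (x := x) |>.subset ?_
  rintro _ ⟨_, -, rfl⟩
  rfl

/-- A bounded map sending elementary tensors to a closed subspace takes values in it. -/
theorem CTensor.map_mem [CompleteSpace X] {f : CTensor V W →ₗ[ℂ] X} (hf : IsBddMap f)
    {N : Submodule ℂ X} (hN : IsClosed (N : Set X)) (h : ∀ v w, f (CTensor.tmul v w) ∈ N)
    (t : CTensor V W) : f t ∈ N := by
  haveI := hN
  have hq : IsBddMap (N.mkQ : X → X ⧸ N) := isBddMap_clm N.mkQL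
  -- In the Banach space `X ⧸ N` membership becomes vanishing, and bounded maps into a Banach space
  -- are determined by elementary tensors.
  have h0 : N.mkQ ∘ₗ f = 0 := by
    refine CTensor.hom_ext (hq.comp hf) (isBddMap_const 0) fun v w => ?_
    exact (Submodule.Quotient.mk_eq_zero N).2 (h v w)
  exact (Submodule.Quotient.mk_eq_zero N).1 (LinearMap.congr_fun h0 t)

/-- The form in which essentiality is used: every element of `U` comes from `V ⊗̂ W`, so closed
conditions on `U` can be tested on the products `β v w`, although an element need not be a finite
sum of them. -/
theorem map_mem_of_lift_surjective [CompleteSpace X] [CompleteConvexBornology U]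
    {β : V →ₗ[ℂ] W →ₗ[ℂ] U}
    {hβ : IsBddMap₂ fun v w => β v w} (hs : Function.Surjective (CTensor.lift β hβ))
    {f : U →ₗ[ℂ] X} (hf : IsBddMap f) {N : Submodule ℂ X} (hN : IsClosed (N : Set X))
    (h : ∀ v w, f (β v w) ∈ N) (x : U) : f x ∈ N := by
  obtain ⟨t, rfl⟩ := hs x
  refine CTensor.map_mem (f := f ∘ₗ CTensor.lift β hβ) (hf.comp (CTensor.lift_isBdd β hβ)) hN ?_ t
  intro v w
  rw [LinearMap.comp_apply, CTensor.lift_tmul]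
  exact h v w

theorem ext_of_lift_surjective [CompleteConvexBornology U] [CompleteConvexBornology U']
    {β : V →ₗ[ℂ] W →ₗ[ℂ] U}
    {hβ : IsBddMap₂ fun v w => β v w} (hs : Function.Surjective (CTensor.lift β hβ))
    {f g : U →ₗ[ℂ] U'} (hf : IsBddMap f) (hg : IsBddMap g)
    (h : ∀ v w, f (β v w) = g (β v w)) : f = g := by
  have : f ∘ₗ CTensor.lift β hβ = g ∘ₗ CTensor.lift β hβ := by
    refine CTensor.hom_ext (hf.comp (CTensor.lift_isBdd β hβ))
      (hg.comp (CTensor.lift_isBdd β hβ)) fun v w => ?_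
    rw [LinearMap.comp_apply, LinearMap.comp_apply, CTensor.lift_tmul]
    exact h v w
  ext x
  obtain ⟨t, rfl⟩ := hs x
  exact LinearMap.congr_fun this t

variable {A : Type u} [NonUnitalRing A] [Module ℂ A] [IsScalarTower ℂ A A] [SMulCommClass ℂ A A]
  [StarRing A] [StarModule ℂ A] [Bornology A] [BornologicalStarAlgebra A]

/-- Essentiality is a lifting property for bounded sets; applied to singletons it gives
surjectivity, which is all that is needed from it. -/
theorem IsEssentialAlgebra.surjective (h : IsEssentialAlgebra A) :
    Function.Surjective (CTensor.lift (LinearMap.mul ℂ A) bdd_mulL) := by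
  intro a
  obtain ⟨S, -, hS⟩ := h {a} isBounded_singleton
  obtain ⟨t, -, ht⟩ : a ∈ CTensor.lift (LinearMap.mul ℂ A) bdd_mulL '' S := hS ▸ rfl
  exact ⟨t, ht⟩

theorem IsCoproduct.surjective {Δ : A →⋆ₙₐ[ℂ] Multiplier (CTensor A A)} (h : IsCoproduct Δ) :
    Function.Surjective (CTensor.lift (actL Δ) h.bdd_left) := by
  intro a
  obtain ⟨S, -, hS⟩ := h.essential {a} isBounded_singleton
  obtain ⟨t, -, ht⟩ : a ∈ CTensor.lift (actL Δ) h.bdd_left '' S := hS ▸ rfl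
  exact ⟨t, ht⟩

end Bounded

/-! ### Tensor products of bounded maps into Hilbert spaces -/

section HilbertMap

variable {V : Type*} {W : Type*} {U : Type*}
  [AddCommGroup V] [Module ℂ V] [Bornology V]
  [AddCommGroup W] [Module ℂ W] [Bornology W]
  [AddCommGroup U] [Module ℂ U] [Bornology U]
  {H : Type*} {K : Type*} {L : Type*}
  [NormedAddCommGroup H] [InnerProductSpace ℂ H]
  [NormedAddCommGroup K] [InnerProductSpace ℂ K]
  [NormedAddCommGroup L] [InnerProductSpace ℂ L]

theorem hmap_aux {Λ : V →ₗ[ℂ] H} {Λ' : W →ₗ[ℂ] K} (hΛ : IsBddMap Λ) (hΛ' : IsBddMap Λ') :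
    IsBddMap₂ (fun a b => ((htmulBilin H K).compl₁₂ Λ Λ') a b) := by
  intro S T hS hT
  obtain ⟨C, hC⟩ := (hΛ S hS).subset_closedBall 0
  obtain ⟨D, hD⟩ := (hΛ' T hT).subset_closedBall 0
  refine (Metric.isBounded_closedBall (x := (0 : HTensor H K)) (r := C * D)).subset ?_
  rintro _ ⟨a, ha, b, hb, rfl⟩
  have h1 : ‖Λ a‖ ≤ C := by simpa using hC ⟨a, ha, rfl⟩
  have h2 : ‖Λ' b‖ ≤ D := by simpa using hD ⟨b, hb, rfl⟩
  rw [mem_closedBall_zero_iff]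
  refine (norm_htmul (Λ a) (Λ' b)).le.trans ?_
  exact mul_le_mul h1 h2 (norm_nonneg _) ((norm_nonneg _).trans h1)

/-- The bounded map `Λ ⊗̂ Λ' : V ⊗̂ W → H ⊗ K`. -/
noncomputable def hmap (Λ : V →ₗ[ℂ] H) (Λ' : W →ₗ[ℂ] K) (hΛ : IsBddMap Λ) (hΛ' : IsBddMap Λ') :
    CTensor V W →ₗ[ℂ] HTensor H K :=
  CTensor.lift ((htmulBilin H K).compl₁₂ Λ Λ') (hmap_aux hΛ hΛ')

theorem hmap_tmul {Λ : V →ₗ[ℂ] H} {Λ' : W →ₗ[ℂ] K} (hΛ : IsBddMap Λ) (hΛ' : IsBddMap Λ')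
    (a : V) (b : W) : hmap Λ Λ' hΛ hΛ' (CTensor.tmul a b) = htmul (Λ a) (Λ' b) :=
  CTensor.lift_tmul _ _ a b

theorem hmap_isBdd {Λ : V →ₗ[ℂ] H} {Λ' : W →ₗ[ℂ] K} (hΛ : IsBddMap Λ) (hΛ' : IsBddMap Λ') :
    IsBddMap (hmap Λ Λ' hΛ hΛ') := CTensor.lift_isBdd _ _

theorem dense_span_range {E : Type*} [NormedAddCommGroup E] [NormedSpace ℂ E] {Λ : V →ₗ[ℂ] E}
    (h : DenseRange Λ) : Dense (Submodule.span ℂ (Set.range Λ) : Set E) :=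
  Dense.mono Submodule.subset_span h

theorem denseRange_hmap {Λ : V →ₗ[ℂ] H} {Λ' : W →ₗ[ℂ] K} (hΛ : IsBddMap Λ) (hΛ' : IsBddMap Λ')
    (h : DenseRange Λ) (h' : DenseRange Λ') : DenseRange (hmap Λ Λ' hΛ hΛ') := by
  have hd : Dense ((LinearMap.range (hmap Λ Λ' hΛ hΛ') : Submodule ℂ (HTensor H K)) :
      Set (HTensor H K)) := by
    rw [Submodule.dense_iff_topologicalClosure_eq_top]
    refine htmul_mem_of_dense (dense_span_range h) (dense_span_range h')
      (Submodule.isClosed_topologicalClosure _) ?_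
    rintro _ ⟨a, rfl⟩ _ ⟨b, rfl⟩
    exact Submodule.le_topologicalClosure _ ⟨_, hmap_tmul hΛ hΛ' a b⟩
  exact hd

theorem clm_ext_of_denseRange {E F : Type*} [NormedAddCommGroup E] [NormedSpace ℂ E]
    [NormedAddCommGroup F] [NormedSpace ℂ F] {Λ : V → E}
    (h : DenseRange Λ) {T S : E →L[ℂ] F} (hTS : ∀ a, T (Λ a) = S (Λ a)) : T = S :=
  DFunLike.coe_injective (h.equalizer T.continuous S.continuous (funext hTS))

/-- For a fixed first argument both sides are bounded and linear in the second, hence determined by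
elementary tensors. Conjugate symmetry then exchanges the roles of the two arguments. -/
theorem inner_eq_of_tmul {P : CTensor V W →ₗ[ℂ] H} {Q : CTensor V W →ₗ[ℂ] K}
    (hP : IsBddMap P) (hQ : IsBddMap Q)
    (h : ∀ a b c d, inner ℂ (P (CTensor.tmul a b)) (P (CTensor.tmul c d)) =
      inner ℂ (Q (CTensor.tmul a b)) (Q (CTensor.tmul c d))) (s t : CTensor V W) :
    inner ℂ (P s) (P t) = inner ℂ (Q s) (Q t) := by
  have key : ∀ s, (∀ c d, inner ℂ (P s) (P (CTensor.tmul c d)) =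
      inner ℂ (Q s) (Q (CTensor.tmul c d))) → ∀ t, inner ℂ (P s) (P t) = inner ℂ (Q s) (Q t) := by
    intro s hs t
    have : (innerSL ℂ (P s)).toLinearMap ∘ₗ P = (innerSL ℂ (Q s)).toLinearMap ∘ₗ Q :=
      CTensor.hom_ext (hP.clm_comp (innerSL ℂ (P s))) (hQ.clm_comp (innerSL ℂ (Q s))) hs
    exact LinearMap.congr_fun this t
  refine key s (fun c d => ?_) t
  rw [← inner_conj_symm, key _ (h c d) s, inner_conj_symm]

/-- Reduces the isometry property of the multiplicative unitary to a computation with elementary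
tensors. -/
theorem norm_eq_of_tmul {P : CTensor V W →ₗ[ℂ] H} {Q : CTensor V W →ₗ[ℂ] K}
    (hP : IsBddMap P) (hQ : IsBddMap Q)
    (h : ∀ a b c d, inner ℂ (P (CTensor.tmul a b)) (P (CTensor.tmul c d)) =
      inner ℂ (Q (CTensor.tmul a b)) (Q (CTensor.tmul c d))) (t : CTensor V W) :
    ‖P t‖ = ‖Q t‖ := by
  rw [norm_eq_sqrt_re_inner (𝕜 := ℂ), norm_eq_sqrt_re_inner (𝕜 := ℂ), inner_eq_of_tmul hP hQ h]

/-- The bridge between the bornological and the Hilbert space associators, through which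
coassociativity is transferred. Both sides agree on `(a ⊗ b) ⊗ c`; the extension is made first in `a
⊗ b` and then in the outer tensor product. -/
theorem hassoc_hmap {Λ : V →ₗ[ℂ] H} {Λ' : W →ₗ[ℂ] K} {Λ'' : U →ₗ[ℂ] L}
    (hΛ : IsBddMap Λ) (hΛ' : IsBddMap Λ') (hΛ'' : IsBddMap Λ'')
    (y : CTensor (CTensor V W) U) :
    hassoc H K L (hmap (hmap Λ Λ' hΛ hΛ') Λ'' (hmap_isBdd hΛ hΛ') hΛ'' y) =
      hmap Λ (hmap Λ' Λ'' hΛ' hΛ'') hΛ (hmap_isBdd hΛ' hΛ'') (CTensor.assoc V W U y) := by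
  have h2 : IsBddMap (hmap Λ (hmap Λ' Λ'' hΛ' hΛ'') hΛ (hmap_isBdd hΛ' hΛ'') ∘ₗ
      CTensor.assoc V W U) := (hmap_isBdd hΛ (hmap_isBdd hΛ' hΛ'')).comp (CTensor.lift_isBdd _ _)
  have h1 : IsBddMap ((hassoc H K L).toLinearEquiv.toLinearMap ∘ₗ
      hmap (hmap Λ Λ' hΛ hΛ') Λ'' (hmap_isBdd hΛ hΛ') hΛ'') :=
    (hmap_isBdd (hmap_isBdd hΛ hΛ') hΛ'').clm_comp
      ((hassoc H K L).toContinuousLinearEquiv :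
        HTensor (HTensor H K) L →L[ℂ] HTensor H (HTensor K L))
  have key : (hassoc H K L).toLinearEquiv.toLinearMap ∘ₗ
      hmap (hmap Λ Λ' hΛ hΛ') Λ'' (hmap_isBdd hΛ hΛ') hΛ'' =
      hmap Λ (hmap Λ' Λ'' hΛ' hΛ'') hΛ (hmap_isBdd hΛ' hΛ'') ∘ₗ CTensor.assoc V W U := by
    refine CTensor.hom_ext h1 h2 fun t c => ?_
    have h3 : IsBddMap ((CTensor.tmulBilin (CTensor V W) U).flip c) :=
      CTensor.tmulBilin_isBdd.left c
    have : ((hassoc H K L).toLinearEquiv.toLinearMap ∘ₗ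
      hmap (hmap Λ Λ' hΛ hΛ') Λ'' (hmap_isBdd hΛ hΛ') hΛ'') ∘ₗ
        (CTensor.tmulBilin (CTensor V W) U).flip c =
      (hmap Λ (hmap Λ' Λ'' hΛ' hΛ'') hΛ (hmap_isBdd hΛ' hΛ'') ∘ₗ CTensor.assoc V W U) ∘ₗ
        (CTensor.tmulBilin (CTensor V W) U).flip c := by
      refine CTensor.hom_ext (h1.comp h3) (h2.comp h3) fun a b => ?_
      change hassoc H K L (hmap (hmap Λ Λ' hΛ hΛ') Λ'' (hmap_isBdd hΛ hΛ') hΛ''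
        (CTensor.tmul (CTensor.tmul a b) c)) =
        hmap Λ (hmap Λ' Λ'' hΛ' hΛ'') hΛ (hmap_isBdd hΛ' hΛ'')
          (CTensor.assoc V W U (CTensor.tmul (CTensor.tmul a b) c))
      rw [CTensor.assoc_tmul]
      simp only [hmap_tmul, hassoc_htmul]
    exact LinearMap.congr_fun this t
  exact LinearMap.congr_fun key y

end HilbertMap

/-! ### Multipliers and slice maps -/

namespace Multiplier

section

variable {A : Type u} [NonUnitalRing A] [Module ℂ A] [IsScalarTower ℂ A A] [SMulCommClass ℂ A A]
  [Bornology A] [BornologicalAlgebra A]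
  {B : Type v} [NonUnitalRing B] [Module ℂ B] [IsScalarTower ℂ B B] [SMulCommClass ℂ B B]
  [Bornology B] [BornologicalAlgebra B]

theorem ext {c d : Multiplier A} (hl : ∀ a, c.left a = d.left a)
    (hr : ∀ a, c.right a = d.right a) : c = d :=
  Subtype.ext (Prod.ext (LinearMap.ext hl) (MulOpposite.unop_injective (LinearMap.ext hr)))

theorem mul_left_apply (c d : Multiplier A) (a : A) : (c * d).left a = c.left (d.left a) := rfl

theorem mul_right_apply (c d : Multiplier A) (a : A) : (c * d).right a = d.right (c.right a) := rfl

theorem ofElem_left_apply (a b : A) : (ofElem a).left b = a * b := rfl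

theorem ofElem_right_apply (a b : A) : (ofElem a).right b = b * a := rfl

/-- With this the action of a multiplier on an element is a product in the multiplier algebra, where
the Galois identities and associativity are available. -/
theorem ofElem_left (c : Multiplier A) (a : A) : ofElem (c.left a) = c * ofElem a :=
  ext (fun b => (c.left_mul a b).symm) fun b => (c.mul_left b a).symm

theorem ofElem_right (c : Multiplier A) (a : A) : ofElem (c.right a) = ofElem a * c :=
  ext (fun b => c.mul_left a b) fun b => (c.right_mul b a).symm

theorem tmul_left_tmul (c : Multiplier A) (d : Multiplier B) (a : A) (b : B) :
    (tmul c d).left (CTensor.tmul a b) = CTensor.tmul (c.left a) (d.left b) :=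
  CTensor.map_tmul _ _ c.left_bdd d.left_bdd a b

theorem tmul_right_tmul (c : Multiplier A) (d : Multiplier B) (a : A) (b : B) :
    (tmul c d).right (CTensor.tmul a b) = CTensor.tmul (c.right a) (d.right b) :=
  CTensor.map_tmul _ _ c.right_bdd d.right_bdd a b

/-- The factorization `a ⊗ b = (a ⊗ 1)(1 ⊗ b)`; it separates the leg that is sliced from the one
that is not. -/
theorem tmul_mul_eq (a : A) (b : B) (t : CTensor A B) :
    CTensor.tmul a b * t = (tmul (ofElem a) 1).left ((tmul 1 (ofElem b)).left t) := by
  have : LinearMap.mulLeft ℂ (CTensor.tmul a b) =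
      (tmul (ofElem a) 1).left ∘ₗ (tmul 1 (ofElem b)).left := by
    have hb : IsBddMap (LinearMap.mulLeft ℂ (CTensor.tmul a b)) :=
      BornologicalAlgebra.bdd_mul.right _
    refine CTensor.hom_ext hb ((left_bdd (tmul (ofElem a) 1)).comp
      (left_bdd (tmul 1 (ofElem b)))) ?_
    intro c d
    rw [LinearMap.comp_apply, tmul_left_tmul, tmul_left_tmul]
    exact CTensor.tmul_mul_tmul a c b d
  exact LinearMap.congr_fun this t

end

section Star

variable {A : Type u} [NonUnitalRing A] [Module ℂ A] [IsScalarTower ℂ A A] [SMulCommClass ℂ A A]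
  [StarRing A] [StarModule ℂ A] [Bornology A] [BornologicalStarAlgebra A]

theorem star_left_apply (c : Multiplier A) (a : A) : (star c).left a = star (c.right (star a)) :=
  rfl

/-- Expresses `(a ⊗ 1)^* = a^* ⊗ 1` through the actions on `A ⊗̂ A`; by boundedness it is enough to
check elementary tensors. -/
theorem star_tmul_ofElem_one_left (a : A) (t : CTensor A A) :
    star ((tmul (ofElem a) 1 : Multiplier (CTensor A A)).right (star t)) =
      (tmul (ofElem (star a)) 1).left t := by
  have : starConj (tmul (ofElem a) 1 : Multiplier (CTensor A A)).right =
      (tmul (ofElem (star a)) 1 : Multiplier (CTensor A A)).left := by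
    refine CTensor.hom_ext (starConj_bdd (right_bdd _)) (left_bdd _) fun c d => ?_
    change star ((tmul (ofElem a) 1 : Multiplier (CTensor A A)).right
      (star (CTensor.tmul c d))) = _
    rw [CTensor.star_tmul, tmul_right_tmul, tmul_left_tmul, CTensor.star_tmul,
      ofElem_right_apply, ofElem_left_apply, star_mul, star_star]
    congr 1
    exact star_star d
  exact LinearMap.congr_fun this t

end Star

end Multiplier

/-! ### Slice maps -/

section Slice

variable {A : Type u} [NonUnitalRing A] [Module ℂ A] [IsScalarTower ℂ A A] [SMulCommClass ℂ A A]
  [StarRing A] [StarModule ℂ A] [Bornology A] [BornologicalStarAlgebra A]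
  {ω : A →ₗ[ℂ] ℂ} (hω : IsBddMap ω)

theorem slice_tmul (a b : A) : slice ω hω (CTensor.tmul a b) = ω b • a :=
  CTensor.lift_tmul _ _ a b

theorem slice_isBdd : IsBddMap (slice ω hω) := CTensor.lift_isBdd _ _

/-- Slicing the second leg is linear over multipliers of the first leg, since on `a ⊗ b` it only
contributes the scalar `ω b`. -/
theorem slice_tmul_one_left (c : Multiplier A) (t : CTensor A A) :
    slice ω hω ((Multiplier.tmul c 1).left t) = c.left (slice ω hω t) := by
  have : slice ω hω ∘ₗ (Multiplier.tmul c 1).left = c.left ∘ₗ slice ω hω := by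
    refine CTensor.hom_ext ((slice_isBdd hω).comp (Multiplier.left_bdd _))
      (c.left_bdd.comp (slice_isBdd hω)) fun a b => ?_
    rw [LinearMap.comp_apply, LinearMap.comp_apply, Multiplier.tmul_left_tmul, slice_tmul,
      slice_tmul, map_smul]
    rfl
  exact LinearMap.congr_fun this t

theorem slice_tmul_one_right (c : Multiplier A) (t : CTensor A A) :
    slice ω hω ((Multiplier.tmul c 1).right t) = c.right (slice ω hω t) := by
  have : slice ω hω ∘ₗ (Multiplier.tmul c 1).right = c.right ∘ₗ slice ω hω := by
    refine CTensor.hom_ext ((slice_isBdd hω).comp (Multiplier.right_bdd _))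
      (c.right_bdd.comp (slice_isBdd hω)) fun a b => ?_
    rw [LinearMap.comp_apply, LinearMap.comp_apply, Multiplier.tmul_right_tmul, slice_tmul,
      slice_tmul, map_smul]
    rfl
  exact LinearMap.congr_fun this t

/-- The slice map `ω ⊗ ι : a ⊗ b ↦ ω(a) b`. -/
noncomputable def sliceLeft (ω : A →ₗ[ℂ] ℂ) (hω : IsBddMap ω) : CTensor A A →ₗ[ℂ] A :=
  CTensor.lift (LinearMap.lsmul ℂ A ∘ₗ ω) (slice_aux hω).flip

theorem sliceLeft_tmul (a b : A) : sliceLeft ω hω (CTensor.tmul a b) = ω a • b :=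
  CTensor.lift_tmul _ _ a b

theorem sliceLeft_isBdd : IsBddMap (sliceLeft ω hω) := CTensor.lift_isBdd _ _

/-- Fubini for `ψ ⊗ ω`: the order in which the legs are sliced does not matter. -/
theorem apply_sliceLeft {ψ : A →ₗ[ℂ] ℂ} (hψ : IsBddMap ψ) (t : CTensor A A) :
    ω (sliceLeft ψ hψ t) = ψ (slice ω hω t) := by
  have : ω ∘ₗ sliceLeft ψ hψ = ψ ∘ₗ slice ω hω := by
    refine CTensor.hom_ext (hω.comp (sliceLeft_isBdd hψ)) (hψ.comp (slice_isBdd hω)) fun a b => ?_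
    rw [LinearMap.comp_apply, LinearMap.comp_apply, slice_tmul, sliceLeft_tmul, map_smul, map_smul,
      smul_eq_mul, smul_eq_mul, mul_comm]
  exact LinearMap.congr_fun this t

theorem isBddMap_comp_mulLeft {ω : A →ₗ[ℂ] ℂ} (hω : IsBddMap ω) (a : A) :
    IsBddMap (ω ∘ₗ LinearMap.mulLeft ℂ a) :=
  hω.comp (BornologicalAlgebra.bdd_mul.right a)

/-- A functional of the form `ω(a ·)` absorbs the first leg of a left factor `a ⊗ b`. Slices of this
form thus see only the products `(a ⊗ b) t`, that is, the multiplier defined by `t`. -/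
theorem mul_sliceLeft (a b : A) (t : CTensor A A) :
    b * sliceLeft (ω ∘ₗ LinearMap.mulLeft ℂ a) (isBddMap_comp_mulLeft hω a) t =
      sliceLeft ω hω (CTensor.tmul a b * t) := by
  have : LinearMap.mulLeft ℂ b ∘ₗ
      sliceLeft (ω ∘ₗ LinearMap.mulLeft ℂ a) (isBddMap_comp_mulLeft hω a) =
      sliceLeft ω hω ∘ₗ LinearMap.mulLeft ℂ (CTensor.tmul a b) := by
    refine CTensor.hom_ext
      ((BornologicalAlgebra.bdd_mul.right b).comp (sliceLeft_isBdd (isBddMap_comp_mulLeft hω a)))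
      ((sliceLeft_isBdd hω).comp (BornologicalAlgebra.bdd_mul.right _)) fun c d => ?_
    simp only [LinearMap.comp_apply, sliceLeft_tmul, LinearMap.mulLeft_apply,
      CTensor.tmul_mul_tmul, mul_smul_comm]
  exact LinearMap.congr_fun this t

end Slice

/-! ### Galois maps, faithfulness and left invariance -/

namespace BornologicalQuantumGroup

section Galois

variable {A : Type u} [NonUnitalRing A] [Module ℂ A] [IsScalarTower ℂ A A] [SMulCommClass ℂ A A]
  [StarRing A] [StarModule ℂ A] [Bornology A] [BornologicalStarAlgebra A]
  (G : BornologicalQuantumGroup A)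

/-- The Galois map `γ_l : a ⊗ b ↦ Δ(a) (b ⊗ 1)`. -/
noncomputable def galoisL : CTensor A A ≃ₗ[ℂ] CTensor A A := G.cancellation.1.choose

/-- The Galois map `ρ_r : a ⊗ b ↦ (1 ⊗ a) Δ(b)`. -/
noncomputable def galoisR : CTensor A A ≃ₗ[ℂ] CTensor A A := G.cancellation.2.choose

theorem galoisL_isBdd : IsBddMap G.galoisL := G.cancellation.1.choose_spec.1.1

theorem galoisR_isBdd : IsBddMap G.galoisR := G.cancellation.2.choose_spec.1.1

theorem galoisR_symm_isBdd : IsBddMap G.galoisR.symm := G.cancellation.2.choose_spec.2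

theorem ofElem_galoisL (a b : A) : Multiplier.ofElem (G.galoisL (CTensor.tmul a b)) =
    G.comul a * Multiplier.tmul (Multiplier.ofElem b) 1 := G.cancellation.1.choose_spec.1.2 a b

theorem ofElem_galoisR (a b : A) : Multiplier.ofElem (G.galoisR (CTensor.tmul a b)) =
    Multiplier.tmul 1 (Multiplier.ofElem a) * G.comul b := G.cancellation.2.choose_spec.1.2 a b

theorem slice_galoisL (a b : A) :
    slice G.integral G.bdd_integral (G.galoisL (CTensor.tmul a b)) = G.integral a • b :=
  (G.leftInvariant a b _).1 (G.ofElem_galoisL a b)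

/-- Faithfulness with `a = c^*`: the functionals `φ(a ·)` separate the points of `A`. -/
theorem eq_zero_of_integral_mul_eq_zero {c : A} (h : ∀ a, G.integral (a * c) = 0) : c = 0 :=
  G.faithful c (h _)

/-- Slices of `t` only depend on the multiplier defined by `t`. -/
theorem slice_congr (G : BornologicalQuantumGroup A) {ω : A →ₗ[ℂ] ℂ} (hω : IsBddMap ω) {s t : CTensor A A}
    (h : Multiplier.ofElem s = Multiplier.ofElem t) : slice ω hω s = slice ω hω t := by
  have hmul : ∀ r, r * (s - t) = 0 := fun r => by
    rw [mul_sub, ← Multiplier.ofElem_right_apply, h, Multiplier.ofElem_right_apply, sub_self]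
  rw [← sub_eq_zero, ← map_sub]
  -- Faithfulness is used twice. The inner use kills the left slice of `s - t` by `φ(a ·)`, because
  -- its products with `b` only involve `(a ⊗ b)(s - t) = 0`. By Fubini `φ(a ·)` then kills the
  -- right slice for every `a`.
  refine G.eq_zero_of_integral_mul_eq_zero fun a => ?_
  have h0 : sliceLeft (G.integral ∘ₗ LinearMap.mulLeft ℂ a)
      (isBddMap_comp_mulLeft G.bdd_integral a) (s - t) = 0 :=
    G.eq_zero_of_integral_mul_eq_zero fun b => by
      rw [mul_sliceLeft G.bdd_integral, hmul, map_zero, map_zero]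
  have := apply_sliceLeft hω (isBddMap_comp_mulLeft G.bdd_integral a) (s - t)
  rw [h0, map_zero] at this
  exact this.symm

/-- `γ(a ⊗ b)^* γ(c ⊗ d)` has the same slices as `(b^* ⊗ 1) γ(a^* c ⊗ d)`. -/
theorem slice_star_galoisL_mul_galoisL (a b c d : A) :
    slice G.integral G.bdd_integral
      (star (G.galoisL (CTensor.tmul a b)) * G.galoisL (CTensor.tmul c d)) =
      G.integral (star a * c) • (star b * d) := by
  -- This is `γ(a ⊗ b)^* = (b^* ⊗ 1)Δ(a^*)`, the adjoint of the defining identity of `γ`.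
  have h1 : ∀ y, star (G.galoisL (CTensor.tmul a b)) * y =
      (Multiplier.tmul (Multiplier.ofElem (star b)) 1).left ((G.comul (star a)).left y) := by
    intro y
    rw [← Multiplier.star_tmul_ofElem_one_left, map_star G.comul, Multiplier.star_left_apply, star_star,
      ← Multiplier.mul_right_apply, ← G.ofElem_galoisL, Multiplier.ofElem_right_apply, star_mul,
      star_star]
  -- `Δ(a^*)γ(c ⊗ d)` and `γ(a^* c ⊗ d)` define the same multiplier `Δ(a^* c)(d ⊗ 1)`, which
  -- suffices for equality of slices. Left invariance evaluates the latter slice.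
  have h2 : slice G.integral G.bdd_integral
      ((G.comul (star a)).left (G.galoisL (CTensor.tmul c d))) =
      slice G.integral G.bdd_integral (G.galoisL (CTensor.tmul (star a * c) d)) := by
    refine G.slice_congr _ ?_
    rw [Multiplier.ofElem_left, G.ofElem_galoisL, G.ofElem_galoisL, map_mul, mul_assoc]
  rw [h1, slice_tmul_one_left, h2, slice_galoisL, map_smul, Multiplier.ofElem_left_apply]

/-- `(ι ⊗ φ)((1 ⊗ x) γ(y ⊗ f)) = (ι ⊗ φ)(ρ(x ⊗ y)) f`. -/
theorem slice_tmul_galoisL {ω : A →ₗ[ℂ] ℂ} (hω : IsBddMap ω) (x y f : A) :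
    slice ω hω ((Multiplier.tmul 1 (Multiplier.ofElem x)).left (G.galoisL (CTensor.tmul y f))) =
      slice ω hω (G.galoisR (CTensor.tmul x y)) * f := by
  rw [← Multiplier.ofElem_right_apply, ← slice_tmul_one_right]
  -- Both sides represent the multiplier `(1 ⊗ x)Δ(y)(f ⊗ 1)`, bracketed in the two possible ways.
  refine G.slice_congr _ ?_
  rw [Multiplier.ofElem_left, Multiplier.ofElem_right, G.ofElem_galoisL, G.ofElem_galoisR,
    mul_assoc]

end Galois

end BornologicalQuantumGroup

namespace BornologicalQuantumGroup

/-! ### The multiplicative unitary and the left regular representation -/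

section GNS

variable {A : Type u} [NonUnitalRing A] [Module ℂ A] [IsScalarTower ℂ A A] [SMulCommClass ℂ A A]
  [StarRing A] [StarModule ℂ A] [Bornology A] [BornologicalStarAlgebra A]
  {H : Type v} [NormedAddCommGroup H] [InnerProductSpace ℂ H] [CompleteSpace H]
  {G : BornologicalQuantumGroup A} {Λ : A →ₗ[ℂ] H} (hΛ : G.IsGNS Λ)

/-- The bounded map `Λ ⊗̂ Λ`. -/
noncomputable def IsGNS.map₂ : CTensor A A →ₗ[ℂ] HTensor H H := hmap Λ Λ hΛ.bdd hΛ.bdd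

theorem IsGNS.hilbertMap_eq : hilbertMap Λ hΛ.bdd = hΛ.map₂ := rfl

theorem IsGNS.map₂_tmul (a b : A) : hΛ.map₂ (CTensor.tmul a b) = htmul (Λ a) (Λ b) :=
  hmap_tmul _ _ a b

theorem IsGNS.map₂_isBdd : IsBddMap hΛ.map₂ := hmap_isBdd _ _

theorem IsGNS.denseRange_map₂ : DenseRange hΛ.map₂ := denseRange_hmap _ _ hΛ.dense hΛ.dense

/-- `⟨(Λ ⊗ Λ) s, (Λ ⊗ Λ) t⟩ = (φ ⊗ φ)(s^* t)`. -/
theorem IsGNS.inner_map₂ (s t : CTensor A A) : inner ℂ (hΛ.map₂ s) (hΛ.map₂ t) =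
    G.integral (slice G.integral G.bdd_integral (star s * t)) := by
  have hb : IsBddMap (G.integral ∘ₗ slice G.integral G.bdd_integral) :=
    G.bdd_integral.comp (slice_isBdd G.bdd_integral)
  have h1 : ∀ a b, inner ℂ (hΛ.map₂ (CTensor.tmul a b)) (hΛ.map₂ t) =
      G.integral (slice G.integral G.bdd_integral (star (CTensor.tmul a b) * t)) := by
    intro a b
    have hm : IsBddMap (LinearMap.mulLeft ℂ (star (CTensor.tmul a b))) :=
      BornologicalAlgebra.bdd_mul.right _
    have : (innerSL ℂ (hΛ.map₂ (CTensor.tmul a b))).toLinearMap ∘ₗ hΛ.map₂ =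
        (G.integral ∘ₗ slice G.integral G.bdd_integral) ∘ₗ
          LinearMap.mulLeft ℂ (star (CTensor.tmul a b)) := by
      refine CTensor.hom_ext (hΛ.map₂_isBdd.clm_comp (innerSL ℂ (hΛ.map₂ (CTensor.tmul a b))))
        (hb.comp hm) fun c d => ?_
      change inner ℂ (hΛ.map₂ (CTensor.tmul a b)) (hΛ.map₂ (CTensor.tmul c d)) =
        G.integral (slice G.integral G.bdd_integral (star (CTensor.tmul a b) * CTensor.tmul c d))
      rw [hΛ.map₂_tmul, hΛ.map₂_tmul, inner_htmul, hΛ.inner_eq, hΛ.inner_eq, CTensor.star_tmul,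
        CTensor.tmul_mul_tmul, slice_tmul, map_smul, smul_eq_mul, mul_comm]
    exact LinearMap.congr_fun this t
  have hm : IsBddMap (LinearMap.mulRight ℂ t) := BornologicalAlgebra.bdd_mul.left t
  -- In the first variable both sides are conjugate linear, the right one through the involution, so
  -- the comparison is made between semilinear maps.
  have : (innerSLFlip ℂ (hΛ.map₂ t)).toLinearMap.comp hΛ.map₂ =
      ((G.integral ∘ₗ slice G.integral G.bdd_integral) ∘ₗ LinearMap.mulRight ℂ t).comp
        (CTensor.starMap A A) :=
    CTensor.hom_ext (hΛ.map₂_isBdd.clm_comp (innerSLFlip ℂ (hΛ.map₂ t)))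
      ((hb.comp hm).comp CTensor.starMap_bdd) h1
  exact LinearMap.congr_fun this s

/-- Inner products with the dense set of vectors `(Λ ⊗ Λ)(r)` involve `s` only through `r^* s`,
hence only through the multiplier of `s`. Identities in `M(A ⊗̂ A)` can therefore be used on
vectors. -/
theorem IsGNS.map₂_congr {s t : CTensor A A} (h : Multiplier.ofElem s = Multiplier.ofElem t) :
    hΛ.map₂ s = hΛ.map₂ t := by
  refine ext_inner_of_dense_span (dense_span_range hΛ.denseRange_map₂) ?_
  rintro _ ⟨r, rfl⟩
  rw [hΛ.inner_map₂, hΛ.inner_map₂, ← Multiplier.ofElem_right_apply, h,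
    Multiplier.ofElem_right_apply]

/-- The bounded map `a ⊗ b ↦ Λ(b) ⊗ Λ(a)`. -/
noncomputable def IsGNS.map₂Flip : CTensor A A →ₗ[ℂ] HTensor H H :=
  CTensor.lift ((htmulBilin H H).compl₁₂ Λ Λ).flip (hilbertMap_aux hΛ.bdd).flip

theorem IsGNS.map₂Flip_tmul (a b : A) :
    hΛ.map₂Flip (CTensor.tmul a b) = htmul (Λ b) (Λ a) :=
  CTensor.lift_tmul _ _ a b

theorem IsGNS.map₂Flip_isBdd : IsBddMap hΛ.map₂Flip := CTensor.lift_isBdd _ _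

theorem IsGNS.denseRange_map₂Flip : DenseRange hΛ.map₂Flip := by
  have hd : Dense ((LinearMap.range hΛ.map₂Flip : Submodule ℂ (HTensor H H)) :
      Set (HTensor H H)) := by
    rw [Submodule.dense_iff_topologicalClosure_eq_top]
    refine htmul_mem_of_dense (dense_span_range hΛ.dense) (dense_span_range hΛ.dense)
      (Submodule.isClosed_topologicalClosure _) ?_
    rintro _ ⟨a, rfl⟩ _ ⟨b, rfl⟩
    exact Submodule.le_topologicalClosure _ ⟨_, hΛ.map₂Flip_tmul b a⟩
  exact hd

theorem IsGNS.denseRange_map₂_galoisL :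
    DenseRange (hΛ.map₂ ∘ₗ G.galoisL.toLinearMap) := by
  have := G.galoisL.surjective.range_eq
  rw [DenseRange, LinearMap.coe_comp, Set.range_comp]
  change Dense (hΛ.map₂ '' Set.range G.galoisL)
  rw [this, Set.image_univ]
  exact hΛ.denseRange_map₂

/-- Left invariance as an isometry: `(φ ⊗ φ)(γ(a ⊗ b)^* γ(c ⊗ d)) = φ(b^* d) φ(a^* c)` is the inner
product of `Λ(b) ⊗ Λ(a)` and `Λ(d) ⊗ Λ(c)`. The flip occurs because `b` stays in the first leg of
`Δ(a)(b ⊗ 1)`. -/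
theorem IsGNS.norm_map₂_galoisL (t : CTensor A A) :
    ‖hΛ.map₂Flip t‖ = ‖(hΛ.map₂ ∘ₗ G.galoisL.toLinearMap) t‖ := by
  have hb : IsBddMap (hΛ.map₂ ∘ₗ G.galoisL.toLinearMap) := hΛ.map₂_isBdd.comp G.galoisL_isBdd
  refine norm_eq_of_tmul hΛ.map₂Flip_isBdd hb ?_ t
  intro a b c d
  change _ = inner ℂ (hΛ.map₂ (G.galoisL (CTensor.tmul a b)))
    (hΛ.map₂ (G.galoisL (CTensor.tmul c d)))
  rw [hΛ.inner_map₂, G.slice_star_galoisL_mul_galoisL, map_smul, hΛ.map₂Flip_tmul,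
    hΛ.map₂Flip_tmul, inner_htmul, hΛ.inner_eq, hΛ.inner_eq, smul_eq_mul, mul_comm]

/-- The multiplicative unitary as an isometric isomorphism. -/
noncomputable def IsGNS.multUnitaryEquiv : HTensor H H ≃ₗᵢ[ℂ] HTensor H H :=
  -- Source and target are both presented as completions of images of `A ⊗̂ A`, so the operator is
  -- the extension of the identity of `A ⊗̂ A`. Density of the first image uses that `γ` is onto.
  (LinearEquiv.refl ℂ (CTensor A A)).extendOfIsometry (hΛ.map₂ ∘ₗ G.galoisL.toLinearMap)
    hΛ.map₂Flip hΛ.denseRange_map₂_galoisL hΛ.denseRange_map₂Flip hΛ.norm_map₂_galoisL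

theorem IsGNS.multUnitaryEquiv_map₂ (t : CTensor A A) :
    hΛ.multUnitaryEquiv (hΛ.map₂ (G.galoisL t)) = hΛ.map₂Flip t :=
  LinearEquiv.extendOfIsometry_eq _ _ _ _ _ _ t

/-- The multiplicative unitary. -/
noncomputable def IsGNS.multUnitary : unitary (HTensor H H →L[ℂ] HTensor H H) :=
  Unitary.linearIsometryEquiv.symm hΛ.multUnitaryEquiv

theorem IsGNS.multUnitary_map₂ (t : CTensor A A) :
    (hΛ.multUnitary : HTensor H H →L[ℂ] HTensor H H) (hΛ.map₂ (G.galoisL t)) = hΛ.map₂Flip t :=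
  hΛ.multUnitaryEquiv_map₂ t

theorem IsGNS.star_multUnitary_map₂Flip (t : CTensor A A) :
    (star hΛ.multUnitary : HTensor H H →L[ℂ] HTensor H H) (hΛ.map₂Flip t) =
      hΛ.map₂ (G.galoisL t) := by
  rw [← hΛ.multUnitary_map₂, ← mul_apply_eq_comp, Unitary.coe_star_mul_self]
  rfl

theorem IsGNS.isMultiplicativeUnitary :
    G.IsMultiplicativeUnitary hΛ (hΛ.multUnitary : HTensor H H →L[ℂ] HTensor H H) := by
  refine ⟨hΛ.multUnitary.2, fun f g t ht => ?_⟩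
  -- The element `t` is known only up to its multiplier, and may be replaced by `γ(g ⊗ f)`.
  rw [hΛ.hilbertMap_eq, hΛ.map₂_congr (ht.trans (G.ofElem_galoisL g f).symm),
    hΛ.multUnitary_map₂, hΛ.map₂Flip_tmul]

/-- The defining relation fixes the operator on `(Λ ⊗ Λ)γ(a ⊗ b)`, hence by boundedness on all `(Λ ⊗
Λ)γ(t)`, and these vectors are dense. -/
theorem IsGNS.eq_multUnitary {W : HTensor H H →L[ℂ] HTensor H H}
    (hW : G.IsMultiplicativeUnitary hΛ W) : W = hΛ.multUnitary := by
  refine clm_ext_of_denseRange hΛ.denseRange_map₂_galoisL fun t => ?_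
  have hb : IsBddMap (hΛ.map₂ ∘ₗ G.galoisL.toLinearMap) := hΛ.map₂_isBdd.comp G.galoisL_isBdd
  have : W.toLinearMap ∘ₗ (hΛ.map₂ ∘ₗ G.galoisL.toLinearMap) = hΛ.map₂Flip := by
    refine CTensor.hom_ext (hb.clm_comp W) hΛ.map₂Flip_isBdd fun a b => ?_
    rw [hΛ.map₂Flip_tmul]
    exact hW.2 b a _ (G.ofElem_galoisL a b)
  exact (LinearMap.congr_fun this t).trans (hΛ.multUnitary_map₂ t).symm

/-- The operator `ζ ↦ ζ ⊗ ξ`. -/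
noncomputable def rightTensor : H →L[ℂ] H →L[ℂ] HTensor H H := (htmulL H H).flip

theorem rightTensor_apply (ξ ζ : H) : rightTensor ξ ζ = htmul ζ ξ := rfl

theorem norm_rightTensor_le (ξ : H) : ‖rightTensor ξ‖ ≤ ‖ξ‖ :=
  ContinuousLinearMap.opNorm_le_bound _ (norm_nonneg _) fun ζ => by
    rw [rightTensor_apply, norm_htmul, mul_comm]

/-- The slice `(ι ⊗ ω)(W^*)`, where `ω = ⟨Λ(x^*), · Λ(y)⟩`. -/
noncomputable def IsGNS.sliceBilin : A →ₗ[ℂ] A →ₗ[ℂ] (H →L[ℂ] H) :=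
  LinearMap.mk₂ ℂ (fun x y => (ContinuousLinearMap.adjoint (rightTensor (Λ (star x)))).comp
      ((star hΛ.multUnitary : HTensor H H →L[ℂ] HTensor H H).comp (rightTensor (Λ y))))
    (fun x x' y => by
      simp only [star_add, map_add, ContinuousLinearMap.add_comp])
    -- The involution in `Λ(x^*)` compensates the conjugate linearity of the adjoint, so the slice
    -- is linear in `x`.
    (fun c x y => by
      simp only [star_smul, map_smul, map_smulₛₗ, ContinuousLinearMap.smul_comp, starRingEnd_apply,
        star_star])
    (fun x y y' => by
      simp only [map_add, ContinuousLinearMap.comp_add])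
    (fun c x y => by
      simp only [map_smul, ContinuousLinearMap.comp_smul])

theorem IsGNS.sliceBilin_apply (x y : A) :
    hΛ.sliceBilin x y = (ContinuousLinearMap.adjoint (rightTensor (Λ (star x)))).comp
      ((star hΛ.multUnitary : HTensor H H →L[ℂ] HTensor H H).comp (rightTensor (Λ y))) := rfl

theorem IsGNS.inner_sliceBilin (x y : A) (ζ ξ : H) :
    inner ℂ ζ (hΛ.sliceBilin x y ξ) = inner ℂ (htmul ζ (Λ (star x)))
      ((star hΛ.multUnitary : HTensor H H →L[ℂ] HTensor H H) (htmul ξ (Λ y))) := by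
  rw [hΛ.sliceBilin_apply, ContinuousLinearMap.comp_apply, ContinuousLinearMap.adjoint_inner_right]
  rfl

theorem IsGNS.norm_sliceBilin_le (x y : A) :
    ‖hΛ.sliceBilin x y‖ ≤ ‖Λ (star x)‖ *
      (‖(star hΛ.multUnitary : HTensor H H →L[ℂ] HTensor H H)‖ * ‖Λ y‖) := by
  rw [hΛ.sliceBilin_apply]
  refine (ContinuousLinearMap.opNorm_comp_le _ _).trans ?_
  rw [LinearIsometryEquiv.norm_map]
  refine mul_le_mul (norm_rightTensor_le _) ?_ (norm_nonneg _) (norm_nonneg _)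
  refine (ContinuousLinearMap.opNorm_comp_le _ _).trans ?_
  exact mul_le_mul_of_nonneg_left (norm_rightTensor_le _) (norm_nonneg _)

theorem IsGNS.sliceBilin_isBdd : IsBddMap₂ fun x y => hΛ.sliceBilin x y := by
  intro S T hS hT
  obtain ⟨C, hC⟩ := (hΛ.bdd _ (BornologicalStarAlgebra.bdd_star S hS)).subset_closedBall 0
  obtain ⟨D, hD⟩ := (hΛ.bdd T hT).subset_closedBall 0
  refine (Metric.isBounded_closedBall (x := (0 : H →L[ℂ] H))
    (r := C * (‖(star hΛ.multUnitary : HTensor H H →L[ℂ] HTensor H H)‖ * D))).subset ?_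
  rintro _ ⟨a, ha, b, hb, rfl⟩
  have h1 : ‖Λ (star a)‖ ≤ C := by simpa using hC ⟨star a, ⟨a, ha, rfl⟩, rfl⟩
  have h2 : ‖Λ b‖ ≤ D := by simpa using hD ⟨b, hb, rfl⟩
  rw [mem_closedBall_zero_iff]
  refine (hΛ.norm_sliceBilin_le a b).trans ?_
  have hC : 0 ≤ C := (norm_nonneg _).trans h1
  gcongr

/-- Slices of `W^*` are multiplication operators. For `u = x ⊗ y`, pairing with `Λ(k)` gives `(φ ⊗
φ)((k^* ⊗ x)Δ(y)(f ⊗ 1))`, and slicing the second leg leaves `φ(k^* (ι ⊗ φ)(ρ(x ⊗ y)) f)`.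
Boundedness in `u` extends this to all of `A ⊗̂ A`. -/
theorem IsGNS.lift_sliceBilin_apply (u : CTensor A A) (f : A) :
    CTensor.lift hΛ.sliceBilin hΛ.sliceBilin_isBdd u (Λ f) =
      Λ (slice G.integral G.bdd_integral (G.galoisR u) * f) := by
  have h2 : IsBddMap (Λ ∘ₗ LinearMap.mulRight ℂ f ∘ₗ
      slice G.integral G.bdd_integral ∘ₗ G.galoisR.toLinearMap) :=
    hΛ.bdd.comp ((BornologicalAlgebra.bdd_mul.left f).comp
      ((slice_isBdd G.bdd_integral).comp G.galoisR_isBdd))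
  have : (ContinuousLinearMap.apply ℂ H (Λ f)).toLinearMap ∘ₗ
      CTensor.lift hΛ.sliceBilin hΛ.sliceBilin_isBdd = Λ ∘ₗ LinearMap.mulRight ℂ f ∘ₗ
      slice G.integral G.bdd_integral ∘ₗ G.galoisR.toLinearMap := by
    refine CTensor.hom_ext ((CTensor.lift_isBdd hΛ.sliceBilin hΛ.sliceBilin_isBdd).clm_comp
      (ContinuousLinearMap.apply ℂ H (Λ f))) h2 fun x y => ?_
    refine ext_inner_of_dense_span (dense_span_range hΛ.dense) ?_
    rintro _ ⟨k, rfl⟩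
    change inner ℂ (Λ k) (CTensor.lift hΛ.sliceBilin hΛ.sliceBilin_isBdd (CTensor.tmul x y) (Λ f)) =
      inner ℂ (Λ k) (Λ (slice G.integral G.bdd_integral (G.galoisR (CTensor.tmul x y)) * f))
    rw [CTensor.lift_tmul, hΛ.inner_sliceBilin, ← hΛ.map₂Flip_tmul y f,
      hΛ.star_multUnitary_map₂Flip, ← hΛ.map₂_tmul, hΛ.inner_map₂, CTensor.star_tmul, star_star,
      Multiplier.tmul_mul_eq, slice_tmul_one_left, G.slice_tmul_galoisL, hΛ.inner_eq]
    rfl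
  exact LinearMap.congr_fun this u

/-- Multiplication by `(ι ⊗ φ)ρ(u)` is bounded for every `u`, and for `u = ρ⁻¹(a ⊗ b)` this element
is `φ(b) a`. Fixing `b` with `φ(b) ≠ 0` and dividing yields an operator that depends linearly and
boundedly on `a`, because `ρ⁻¹` is bounded. -/
theorem IsGNS.exists_leftRegular (hΛ : G.IsGNS Λ) : ∃ M : A →ₗ[ℂ] (H →L[ℂ] H), IsBddMap M ∧
    ∀ a b, M a (Λ b) = Λ (a * b) := by
  by_cases h : ∃ b, G.integral b ≠ 0
  · obtain ⟨b, hb⟩ := h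
    have hl := CTensor.lift_isBdd hΛ.sliceBilin hΛ.sliceBilin_isBdd
    refine ⟨(G.integral b)⁻¹ • (CTensor.lift hΛ.sliceBilin hΛ.sliceBilin_isBdd ∘ₗ
      G.galoisR.symm.toLinearMap ∘ₗ (CTensor.tmulBilin A A).flip b), ?_, fun a c => ?_⟩
    · exact (hl.comp (G.galoisR_symm_isBdd.comp (CTensor.tmulBilin_isBdd.left b))).const_smul _
    · change (G.integral b)⁻¹ • CTensor.lift hΛ.sliceBilin hΛ.sliceBilin_isBdd
        (G.galoisR.symm (CTensor.tmul a b)) (Λ c) = _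
      rw [hΛ.lift_sliceBilin_apply, LinearEquiv.apply_symm_apply, slice_tmul, smul_mul_assoc,
        map_smul, inv_smul_smul₀ hb]
  -- If `φ` vanishes identically then faithfulness forces `A = 0`.
  · push Not at h
    have h0 : ∀ a : A, a = 0 := fun a => G.faithful a (h _)
    refine ⟨0, isBddMap_const 0, fun a b => ?_⟩
    rw [h0 (a * b), map_zero]
    rfl

/-- The left regular representation of `A` on `H` as a linear map. -/
noncomputable def IsGNS.leftRegularLin : A →ₗ[ℂ] (H →L[ℂ] H) := hΛ.exists_leftRegular.choose

/-- The left regular representation `m` of `A` on `H`, `m(a) Λ(b) = Λ(a b)`. -/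
noncomputable def IsGNS.leftRegular : A →⋆ₙₐ[ℂ] (H →L[ℂ] H) where
  toFun := hΛ.leftRegularLin
  map_smul' c a := map_smul hΛ.leftRegularLin c a
  map_zero' := map_zero hΛ.leftRegularLin
  map_add' a b := map_add hΛ.leftRegularLin a b
  map_mul' a b := clm_ext_of_denseRange hΛ.dense fun c => by
    rw [mul_apply_eq_comp]
    simp only [leftRegularLin, hΛ.exists_leftRegular.choose_spec.2, mul_assoc]
  map_star' a := clm_ext_of_denseRange hΛ.dense fun c => by
    -- Tested against `Λ(k)`, both sides are `φ(k^* a^* c)`.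
    refine ext_inner_of_dense_span (dense_span_range hΛ.dense) ?_
    rintro _ ⟨k, rfl⟩
    rw [ContinuousLinearMap.star_eq_adjoint, ContinuousLinearMap.adjoint_inner_right]
    simp only [leftRegularLin, hΛ.exists_leftRegular.choose_spec.2, hΛ.inner_eq, star_mul, mul_assoc]

theorem IsGNS.leftRegular_apply (a b : A) : hΛ.leftRegular a (Λ b) = Λ (a * b) :=
  hΛ.exists_leftRegular.choose_spec.2 a b

theorem IsGNS.leftRegular_isBdd : IsBddMap hΛ.leftRegular :=
  hΛ.exists_leftRegular.choose_spec.1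

theorem IsGNS.eq_leftRegular {a : A} {T : H →L[ℂ] H} (h : ∀ b, T (Λ b) = Λ (a * b)) :
    T = hΛ.leftRegular a :=
  clm_ext_of_denseRange hΛ.dense fun b => (h b).trans (hΛ.leftRegular_apply a b).symm

end GNS

end BornologicalQuantumGroup

/-! ### Operators on Hilbert spaces -/

section Operators

variable {K : Type*} [NormedAddCommGroup K] [InnerProductSpace ℂ K] [CompleteSpace K]

/-- The automorphism `T ↦ u^* T u`. -/
noncomputable def starConjHom (u : unitary (K →L[ℂ] K)) : (K →L[ℂ] K) →⋆ₐ[ℂ] (K →L[ℂ] K) where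
  toFun T := star (u : K →L[ℂ] K) * T * (u : K →L[ℂ] K)
  map_one' := by rw [mul_one, Unitary.coe_star_mul_self]
  map_mul' S T := by
    rw [mul_assoc, mul_assoc (star (u : K →L[ℂ] K) * S), mul_assoc (star (u : K →L[ℂ] K)) T,
      ← mul_assoc (u : K →L[ℂ] K) (star (u : K →L[ℂ] K)), Unitary.mul_star_self_of_mem u.2, one_mul]
    simp only [mul_assoc]
  map_zero' := by rw [mul_zero, zero_mul]
  map_add' S T := by rw [mul_add, add_mul]
  commutes' c := by
    rw [Algebra.algebraMap_eq_smul_one, mul_smul_comm, mul_one, smul_mul_assoc,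
      Unitary.coe_star_mul_self]
  map_star' T := by rw [star_mul, star_mul, star_star, mul_assoc]

theorem starConjHom_apply (u : unitary (K →L[ℂ] K)) (T : K →L[ℂ] K) :
    starConjHom u T = star (u : K →L[ℂ] K) * T * (u : K →L[ℂ] K) := rfl

theorem starConjHom_injective (u : unitary (K →L[ℂ] K)) : Function.Injective (starConjHom u) := by
  have key : ∀ T, (u : K →L[ℂ] K) * starConjHom u T * star (u : K →L[ℂ] K) = T := by
    intro T
    rw [starConjHom_apply, mul_assoc, mul_assoc, Unitary.mul_star_self_of_mem u.2, mul_one,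
      ← mul_assoc, Unitary.mul_star_self_of_mem u.2, one_mul]
  intro S T h
  rw [← key S, h, key T]

instance : CompleteConvexBornology (K →L[ℂ] K) := @instCompleteConvexBanach (K →L[ℂ] K) _ _ _

variable {V : Type*} {W : Type*} {U : Type*}
  [AddCommGroup V] [Module ℂ V] [Bornology V]
  [AddCommGroup W] [Module ℂ W] [Bornology W]
  [AddCommGroup U] [Module ℂ U] [Bornology U]

theorem CTensor.map_mem_clm {f : CTensor V W →ₗ[ℂ] (K →L[ℂ] K)} (hf : IsBddMap f)
    {N : Submodule ℂ (K →L[ℂ] K)} (hN : IsClosed (N : Set (K →L[ℂ] K)))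
    (h : ∀ v w, f (CTensor.tmul v w) ∈ N) (t : CTensor V W) : f t ∈ N :=
  CTensor.map_mem (X := K →L[ℂ] K) hf hN h t

theorem map_mem_clm_of_lift_surjective [CompleteConvexBornology U]
    {β : V →ₗ[ℂ] W →ₗ[ℂ] U}
    {hβ : IsBddMap₂ fun v w => β v w} (hs : Function.Surjective (CTensor.lift β hβ))
    {f : U →ₗ[ℂ] (K →L[ℂ] K)} (hf : IsBddMap f) {N : Submodule ℂ (K →L[ℂ] K)}
    (hN : IsClosed (N : Set (K →L[ℂ] K)))
    (h : ∀ v w, f (β v w) ∈ N) (x : U) : f x ∈ N :=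
  map_mem_of_lift_surjective (X := K →L[ℂ] K) hs hf hN h x

end Operators

namespace BornologicalQuantumGroup

/-! ### The reduced `C^*`-algebra and its coproduct -/

section Reduced

variable {A : Type u} [NonUnitalRing A] [Module ℂ A] [IsScalarTower ℂ A A] [SMulCommClass ℂ A A]
  [StarRing A] [StarModule ℂ A] [Bornology A] [BornologicalStarAlgebra A]
  {H : Type v} [NormedAddCommGroup H] [InnerProductSpace ℂ H] [CompleteSpace H]
  {G : BornologicalQuantumGroup A} {Λ : A →ₗ[ℂ] H} (hΛ : G.IsGNS Λ)

theorem IsGNS.leftRegularLin_isBdd : IsBddMap hΛ.leftRegularLin := hΛ.leftRegular_isBdd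

theorem IsGNS.leftRegular₂_aux : IsBddMap₂ fun a b =>
    ((opTensorBilin H H).compl₁₂ hΛ.leftRegularLin hΛ.leftRegularLin) a b := by
  intro S T hS hT
  obtain ⟨C, hC⟩ := (hΛ.leftRegularLin_isBdd S hS).subset_closedBall 0
  obtain ⟨D, hD⟩ := (hΛ.leftRegularLin_isBdd T hT).subset_closedBall 0
  refine (Metric.isBounded_closedBall (x := (0 : HTensor H H →L[ℂ] HTensor H H))
    (r := C * D)).subset ?_
  rintro _ ⟨a, ha, b, hb, rfl⟩
  have h1 : ‖hΛ.leftRegularLin a‖ ≤ C := by simpa using hC ⟨a, ha, rfl⟩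
  have h2 : ‖hΛ.leftRegularLin b‖ ≤ D := by simpa using hD ⟨b, hb, rfl⟩
  refine (mem_closedBall_zero_iff (E := HTensor H H →L[ℂ] HTensor H H)).2 ?_
  refine (norm_opTensor_le (hΛ.leftRegularLin a) (hΛ.leftRegularLin b)).trans ?_
  exact mul_le_mul h1 h2 (norm_nonneg _) ((norm_nonneg _).trans h1)

/-- The representation `m ⊗ m` of `A ⊗̂ A` on `H ⊗ H`. -/
noncomputable def IsGNS.leftRegular₂ : CTensor A A →ₗ[ℂ] (HTensor H H →L[ℂ] HTensor H H) :=
  CTensor.lift ((opTensorBilin H H).compl₁₂ hΛ.leftRegularLin hΛ.leftRegularLin)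
    hΛ.leftRegular₂_aux

theorem IsGNS.leftRegular₂_isBdd : IsBddMap hΛ.leftRegular₂ := CTensor.lift_isBdd _ _

theorem IsGNS.leftRegular₂_tmul (a b : A) : hΛ.leftRegular₂ (CTensor.tmul a b) =
    opTensor (hΛ.leftRegular a) (hΛ.leftRegular b) := CTensor.lift_tmul _ _ a b

/-- The GNS picture of `A ⊗̂ A`: the tensor product of the representations is left multiplication.
It holds for `t` and `s` elementary, and extends first in `s` and then in `t`. -/
theorem IsGNS.leftRegular₂_apply (t s : CTensor A A) :
    hΛ.leftRegular₂ t (hΛ.map₂ s) = hΛ.map₂ (t * s) := by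
  have h1 : ∀ a b, hΛ.leftRegular₂ (CTensor.tmul a b) (hΛ.map₂ s) =
      hΛ.map₂ (CTensor.tmul a b * s) := by
    intro a b
    have hm : IsBddMap (LinearMap.mulLeft ℂ (CTensor.tmul a b)) :=
      BornologicalAlgebra.bdd_mul.right _
    have : (hΛ.leftRegular₂ (CTensor.tmul a b)).toLinearMap ∘ₗ hΛ.map₂ =
        hΛ.map₂ ∘ₗ LinearMap.mulLeft ℂ (CTensor.tmul a b) := by
      refine CTensor.hom_ext (hΛ.map₂_isBdd.clm_comp (hΛ.leftRegular₂ (CTensor.tmul a b)))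
        (hΛ.map₂_isBdd.comp hm) fun c d => ?_
      change hΛ.leftRegular₂ (CTensor.tmul a b) (hΛ.map₂ (CTensor.tmul c d)) =
        hΛ.map₂ (CTensor.tmul a b * CTensor.tmul c d)
      rw [hΛ.leftRegular₂_tmul, CTensor.tmul_mul_tmul, hΛ.map₂_tmul, hΛ.map₂_tmul,
        opTensor_htmul, hΛ.leftRegular_apply, hΛ.leftRegular_apply]
    exact LinearMap.congr_fun this s
  have hm : IsBddMap (LinearMap.mulRight ℂ s) := BornologicalAlgebra.bdd_mul.left s
  have : (ContinuousLinearMap.apply ℂ (HTensor H H) (hΛ.map₂ s)).toLinearMap ∘ₗ hΛ.leftRegular₂ =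
      hΛ.map₂ ∘ₗ LinearMap.mulRight ℂ s :=
    CTensor.hom_ext (hΛ.leftRegular₂_isBdd.clm_comp
      (ContinuousLinearMap.apply ℂ (HTensor H H) (hΛ.map₂ s))) (hΛ.map₂_isBdd.comp hm) h1
  exact LinearMap.congr_fun this t

theorem IsGNS.leftRegular₂_star (t : CTensor A A) :
    hΛ.leftRegular₂ (star t) = star (hΛ.leftRegular₂ t) := by
  refine clm_ext_of_denseRange hΛ.denseRange_map₂ fun s => ?_
  refine ext_inner_of_dense_span (dense_span_range hΛ.denseRange_map₂) ?_
  rintro _ ⟨r, rfl⟩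
  rw [ContinuousLinearMap.star_eq_adjoint, ContinuousLinearMap.adjoint_inner_right,
    hΛ.leftRegular₂_apply, hΛ.leftRegular₂_apply, hΛ.inner_map₂, hΛ.inner_map₂, star_mul,
    mul_assoc]

/-- `A` need not be unital, so `a ⊗ 1` is only a multiplier and its operator is not covered by
`leftRegular₂`. -/
theorem IsGNS.opTensor_leftRegular_one_map₂ (a : A) (t : CTensor A A) :
    opTensor (hΛ.leftRegular a) 1 (hΛ.map₂ t) =
      hΛ.map₂ ((Multiplier.tmul (Multiplier.ofElem a) 1).left t) := by
  have : (opTensor (hΛ.leftRegular a) (1 : H →L[ℂ] H)).toLinearMap ∘ₗ hΛ.map₂ =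
      hΛ.map₂ ∘ₗ (Multiplier.tmul (Multiplier.ofElem a) 1).left := by
    refine CTensor.hom_ext (hΛ.map₂_isBdd.clm_comp (opTensor (hΛ.leftRegular a) (1 : H →L[ℂ] H)))
      (hΛ.map₂_isBdd.comp (Multiplier.left_bdd _)) fun c d => ?_
    change opTensor (hΛ.leftRegular a) 1 (hΛ.map₂ (CTensor.tmul c d)) =
      hΛ.map₂ ((Multiplier.tmul (Multiplier.ofElem a) 1).left (CTensor.tmul c d))
    rw [Multiplier.tmul_left_tmul, hΛ.map₂_tmul, hΛ.map₂_tmul, opTensor_htmul,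
      hΛ.leftRegular_apply]
    rfl
  exact LinearMap.congr_fun this t

theorem IsGNS.opTensor_one_leftRegular_map₂ (a : A) (t : CTensor A A) :
    opTensor 1 (hΛ.leftRegular a) (hΛ.map₂ t) =
      hΛ.map₂ ((Multiplier.tmul 1 (Multiplier.ofElem a)).left t) := by
  have : (opTensor (1 : H →L[ℂ] H) (hΛ.leftRegular a)).toLinearMap ∘ₗ hΛ.map₂ =
      hΛ.map₂ ∘ₗ (Multiplier.tmul 1 (Multiplier.ofElem a)).left := by
    refine CTensor.hom_ext (hΛ.map₂_isBdd.clm_comp (opTensor (1 : H →L[ℂ] H) (hΛ.leftRegular a)))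
      (hΛ.map₂_isBdd.comp (Multiplier.left_bdd _)) fun c d => ?_
    change opTensor 1 (hΛ.leftRegular a) (hΛ.map₂ (CTensor.tmul c d)) =
      hΛ.map₂ ((Multiplier.tmul 1 (Multiplier.ofElem a)).left (CTensor.tmul c d))
    rw [Multiplier.tmul_left_tmul, hΛ.map₂_tmul, hΛ.map₂_tmul, opTensor_htmul,
      hΛ.leftRegular_apply]
    rfl
  exact LinearMap.congr_fun this t

/-- The homomorphism `x ↦ W^* (1 ⊗ x) W` on `B(H)`. -/
noncomputable def IsGNS.comulHom : (H →L[ℂ] H) →⋆ₐ[ℂ] (HTensor H H →L[ℂ] HTensor H H) :=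
  (starConjHom hΛ.multUnitary).comp (oneTensorHom H H)

theorem IsGNS.comulHom_apply (x : H →L[ℂ] H) : hΛ.comulHom x =
    star (hΛ.multUnitary : HTensor H H →L[ℂ] HTensor H H) * opTensor 1 x *
      (hΛ.multUnitary : HTensor H H →L[ℂ] HTensor H H) := rfl

theorem IsGNS.continuous_comulHom : Continuous hΛ.comulHom := continuous_starAlgHom_clm _

theorem IsGNS.comulHom_injective : Function.Injective hΛ.comulHom := by
  intro x y h
  have h1 : opTensor (1 : H →L[ℂ] H) x = opTensor 1 y :=
    starConjHom_injective hΛ.multUnitary h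
  ext ξ
  -- Conjugation by `W` is injective, so `1 ⊗ x = 1 ⊗ y`. Applied to `ξ ⊗ ξ`, and since `‖ξ ⊗ η‖ =
  -- ‖ξ‖ ‖η‖`, this gives `x ξ = y ξ` or `ξ = 0`.
  have h2 : htmul ξ (x ξ - y ξ) = 0 := by
    rw [← htmulL_apply, map_sub, htmulL_apply, htmulL_apply, sub_eq_zero]
    simpa only [opTensor_htmul, one_apply_eq_self] using congrArg (fun T => T (htmul ξ ξ)) h1
  have h3 := norm_htmul ξ (x ξ - y ξ)
  rw [h2, norm_zero, eq_comm, mul_eq_zero, norm_eq_zero, norm_eq_zero, sub_eq_zero] at h3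
  rcases h3 with h3 | h3
  · rw [h3, map_zero, map_zero]
  · exact h3

/-- The link between the operator coproduct and the algebraic one. `W` takes the vector of `γ(g ⊗
f)` to `Λ(f) ⊗ Λ(g)`, then `1 ⊗ m(a)` gives `Λ(f) ⊗ Λ(a g)`, and `W^*` returns the vector of `γ(a g
⊗ f)`, which has the multiplier of `Δ(a)γ(g ⊗ f)`. Surjectivity of `γ` gives all `t`. -/
theorem IsGNS.comulHom_leftRegular_map₂ (a : A) (t : CTensor A A) :
    hΛ.comulHom (hΛ.leftRegular a) (hΛ.map₂ t) = hΛ.map₂ ((G.comul a).left t) := by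
  obtain ⟨s, rfl⟩ := G.galoisL.surjective t
  have hb : IsBddMap (hΛ.map₂ ∘ₗ G.galoisL.toLinearMap) := hΛ.map₂_isBdd.comp G.galoisL_isBdd
  have hb' : IsBddMap (hΛ.map₂ ∘ₗ (G.comul a).left ∘ₗ G.galoisL.toLinearMap) :=
    hΛ.map₂_isBdd.comp ((Multiplier.left_bdd _).comp G.galoisL_isBdd)
  have : (hΛ.comulHom (hΛ.leftRegular a)).toLinearMap ∘ₗ (hΛ.map₂ ∘ₗ G.galoisL.toLinearMap) =
      hΛ.map₂ ∘ₗ (G.comul a).left ∘ₗ G.galoisL.toLinearMap := by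
    refine CTensor.hom_ext (hb.clm_comp (hΛ.comulHom (hΛ.leftRegular a))) hb' fun g f => ?_
    change hΛ.comulHom (hΛ.leftRegular a) (hΛ.map₂ (G.galoisL (CTensor.tmul g f))) =
      hΛ.map₂ ((G.comul a).left (G.galoisL (CTensor.tmul g f)))
    rw [hΛ.comulHom_apply, mul_apply_eq_comp, mul_apply_eq_comp, hΛ.multUnitary_map₂,
      hΛ.map₂Flip_tmul, opTensor_htmul, hΛ.leftRegular_apply, one_apply_eq_self,
      ← hΛ.map₂Flip_tmul]
    refine (hΛ.star_multUnitary_map₂Flip _).trans (hΛ.map₂_congr ?_)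
    rw [Multiplier.ofElem_left, G.ofElem_galoisL, G.ofElem_galoisL, map_mul, mul_assoc]
  exact LinearMap.congr_fun this s

theorem IsGNS.comulHom_mul_leftRegular₂ (a : A) (t : CTensor A A) :
    hΛ.comulHom (hΛ.leftRegular a) * hΛ.leftRegular₂ t =
      hΛ.leftRegular₂ ((G.comul a).left t) := by
  refine clm_ext_of_denseRange hΛ.denseRange_map₂ fun s => ?_
  rw [mul_apply_eq_comp, hΛ.leftRegular₂_apply, hΛ.leftRegular₂_apply,
    hΛ.comulHom_leftRegular_map₂, Multiplier.left_mul]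

/-- Places `Δ(m(a))(m(b) ⊗ 1)` in the image of `A ⊗̂ A`, hence in `C ⊗ C`, and turns surjectivity of
`γ` into a density statement. -/
theorem IsGNS.leftRegular₂_galoisL (a b : A) :
    hΛ.leftRegular₂ (G.galoisL (CTensor.tmul a b)) =
      hΛ.comulHom (hΛ.leftRegular a) * opTensor (hΛ.leftRegular b) 1 := by
  refine clm_ext_of_denseRange hΛ.denseRange_map₂ fun s => ?_
  rw [mul_apply_eq_comp, hΛ.leftRegular₂_apply, hΛ.opTensor_leftRegular_one_map₂,
    hΛ.comulHom_leftRegular_map₂, ← Multiplier.mul_left_apply, ← G.ofElem_galoisL,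
    Multiplier.ofElem_left_apply]

theorem IsGNS.leftRegular₂_galoisR (a b : A) :
    hΛ.leftRegular₂ (G.galoisR (CTensor.tmul a b)) =
      opTensor 1 (hΛ.leftRegular a) * hΛ.comulHom (hΛ.leftRegular b) := by
  refine clm_ext_of_denseRange hΛ.denseRange_map₂ fun s => ?_
  rw [mul_apply_eq_comp, hΛ.leftRegular₂_apply, hΛ.comulHom_leftRegular_map₂,
    hΛ.opTensor_one_leftRegular_map₂, ← Multiplier.mul_left_apply, ← G.ofElem_galoisR,
    Multiplier.ofElem_left_apply]

/-- The reduced `C^*`-algebra `C_0^r(𝔾)`. -/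
noncomputable def IsGNS.reduced : NonUnitalStarSubalgebra ℂ (H →L[ℂ] H) :=
  (NonUnitalStarAlgHom.range hΛ.leftRegular).topologicalClosure

theorem IsGNS.isClosed_reduced : IsClosed (hΛ.reduced : Set (H →L[ℂ] H)) :=
  NonUnitalStarSubalgebra.isClosed_topologicalClosure _

theorem IsGNS.leftRegular_mem (a : A) : hΛ.leftRegular a ∈ hΛ.reduced :=
  NonUnitalStarSubalgebra.le_topologicalClosure _ ⟨a, rfl⟩

theorem IsGNS.coe_reduced : (hΛ.reduced : Set (H →L[ℂ] H)) = reducedFunctions Λ := by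
  change closure (NonUnitalStarAlgHom.range hΛ.leftRegular : Set (H →L[ℂ] H)) = closure _
  -- The sets agree before closure: an operator with `T Λ(b) = Λ(a b)` is `m(a)`, because `Λ` has
  -- dense range.
  congr 1
  ext T
  constructor
  · rintro ⟨a, rfl⟩
    exact ⟨a, hΛ.leftRegular_apply a⟩
  · rintro ⟨a, ha⟩
    exact ⟨a, (hΛ.eq_leftRegular ha).symm⟩

/-- Closed subspaces containing the operators `m(a)` contain the reduced `C^*`-algebra. -/
theorem IsGNS.reduced_subset {N : Submodule ℂ (H →L[ℂ] H)} (hN : IsClosed (N : Set (H →L[ℂ] H)))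
    (h : ∀ a, hΛ.leftRegular a ∈ N) : (hΛ.reduced : Set (H →L[ℂ] H)) ⊆ N := by
  refine closure_minimal ?_ hN
  rintro _ ⟨a, rfl⟩
  exact h a

theorem IsGNS.map_mem_of_leftRegular {X : Type*} [NormedAddCommGroup X] [NormedSpace ℂ X]
    (f : (H →L[ℂ] H) →ₗ[ℂ] X) (hf : Continuous f) {N : Submodule ℂ X} (hN : IsClosed (N : Set X))
    (h : ∀ a, f (hΛ.leftRegular a) ∈ N) {x : H →L[ℂ] H} (hx : x ∈ hΛ.reduced) : f x ∈ N :=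
  hΛ.reduced_subset (N := N.comap f) (hN.preimage hf) h hx

/-- `x ⊗ y` is norm continuous in each factor, so operators from `m(A)` suffice. Together with
`leftRegular₂_mem` this makes `C ⊗ C` the norm closure of `(m ⊗ m)(A ⊗̂ A)`. -/
theorem IsGNS.spatialTensor_subset {N : Submodule ℂ (HTensor H H →L[ℂ] HTensor H H)}
    (hN : IsClosed (N : Set (HTensor H H →L[ℂ] HTensor H H)))
    (h : ∀ t, hΛ.leftRegular₂ t ∈ N) :
    (spatialTensor hΛ.reduced hΛ.reduced : Set (HTensor H H →L[ℂ] HTensor H H)) ⊆ N := by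
  refine BornQG.spatialTensor_subset hN fun x hx y hy => ?_
  refine hΛ.map_mem_of_leftRegular (X := HTensor H H →L[ℂ] HTensor H H)
    ((opTensorBilin H H).flip y) (continuous_opTensor_left y) hN
    (fun a => ?_) hx
  refine hΛ.map_mem_of_leftRegular (X := HTensor H H →L[ℂ] HTensor H H)
    (opTensorBilin H H (hΛ.leftRegular a))
    (continuous_opTensor_right _) hN (fun b => ?_) hy
  rw [opTensorBilin_apply, ← hΛ.leftRegular₂_tmul]
  exact h _

theorem IsGNS.leftRegular₂_mem (t : CTensor A A) :
    hΛ.leftRegular₂ t ∈ spatialTensor hΛ.reduced hΛ.reduced := by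
  refine CTensor.map_mem_clm (K := HTensor H H)
      (N := (spatialTensor hΛ.reduced hΛ.reduced).toSubmodule)
    hΛ.leftRegular₂_isBdd isClosed_spatialTensor (fun a b => ?_) t
  rw [hΛ.leftRegular₂_tmul]
  exact opTensor_mem_spatialTensor (hΛ.leftRegular_mem a) (hΛ.leftRegular_mem b)

/-- `Λ(a b) = m(a)Λ(b)`, and by essentiality of `A` the closed span of such vectors contains `Λ(A)`.
-/
theorem IsGNS.isNondegenerate_reduced : IsNondegenerate hΛ.reduced := by
  rw [IsNondegenerate, Submodule.dense_iff_topologicalClosure_eq_top, eq_top_iff]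
  rintro ξ -
  set N := (Submodule.span ℂ {η : H | ∃ x ∈ hΛ.reduced, ∃ ξ : H, η = x ξ}).topologicalClosure
  have hN : IsClosed (N : Set H) := Submodule.isClosed_topologicalClosure _
  refine hΛ.dense.induction_on (p := fun ξ => ξ ∈ N) ξ hN fun a => ?_
  refine map_mem_of_lift_surjective G.essential.surjective hΛ.bdd hN (fun a b => ?_) a
  refine Submodule.le_topologicalClosure _ (Submodule.subset_span
    ⟨_, hΛ.leftRegular_mem a, Λ b, ?_⟩)
  exact (hΛ.leftRegular_apply a b).symm

/-- Closed subspaces containing `C C` contain `C`. -/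
theorem IsGNS.reduced_subset_of_mul {N : Submodule ℂ (H →L[ℂ] H)}
    (hN : IsClosed (N : Set (H →L[ℂ] H)))
    (h : ∀ x ∈ hΛ.reduced, ∀ y ∈ hΛ.reduced, x * y ∈ N) : (hΛ.reduced : Set (H →L[ℂ] H)) ⊆ N := by
  refine hΛ.reduced_subset hN fun a => ?_
  refine map_mem_clm_of_lift_surjective (f := hΛ.leftRegularLin) G.essential.surjective
    hΛ.leftRegularLin_isBdd hN (fun a b => ?_) a
  have : hΛ.leftRegularLin (LinearMap.mul ℂ A a b) = hΛ.leftRegular a * hΛ.leftRegular b :=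
    map_mul hΛ.leftRegular a b
  rw [this]
  exact h _ (hΛ.leftRegular_mem a) _ (hΛ.leftRegular_mem b)

/-- By continuity it suffices to take `x = m(a)` and `y = (m ⊗ m)(t)`, where the product is `(m ⊗
m)(Δ(a)t)`. -/
theorem IsGNS.comulHom_mul_mem {x : H →L[ℂ] H} (hx : x ∈ hΛ.reduced)
    {y : HTensor H H →L[ℂ] HTensor H H} (hy : y ∈ spatialTensor hΛ.reduced hΛ.reduced) :
    hΛ.comulHom x * y ∈ spatialTensor hΛ.reduced hΛ.reduced := by
  set N := (spatialTensor hΛ.reduced hΛ.reduced).toSubmodule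
  have hN : IsClosed (N : Set (HTensor H H →L[ℂ] HTensor H H)) := isClosed_spatialTensor
  refine hΛ.map_mem_of_leftRegular (X := HTensor H H →L[ℂ] HTensor H H)
    (LinearMap.mulRight ℂ y ∘ₗ hΛ.comulHom.toAlgHom.toLinearMap)
    ((continuous_mul_const y).comp hΛ.continuous_comulHom) hN (fun a => ?_) hx
  refine hΛ.spatialTensor_subset
    (isClosed_comap_mulLeft N hN (hΛ.comulHom (hΛ.leftRegular a))) (fun t => ?_) hy
  change hΛ.comulHom (hΛ.leftRegular a) * hΛ.leftRegular₂ t ∈ N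
  rw [hΛ.comulHom_mul_leftRegular₂]
  exact hΛ.leftRegular₂_mem _

theorem IsGNS.comulHom_mem {x : H →L[ℂ] H} (hx : x ∈ hΛ.reduced) :
    hΛ.comulHom x ∈ cstarMultiplier (spatialTensor hΛ.reduced hΛ.reduced) := by
  refine mem_cstarMultiplier_of_left (S := hΛ.comulHom '' hΛ.reduced) ?_ ?_ ⟨x, hx, rfl⟩
  · rintro _ ⟨x, hx, rfl⟩
    exact ⟨star x, star_mem hx, map_star hΛ.comulHom x⟩
  · rintro _ ⟨x, hx, rfl⟩ y hy
    exact hΛ.comulHom_mul_mem hx hy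

/-- The coproduct of the reduced `C^*`-algebra. -/
noncomputable def IsGNS.reducedComul :
    hΛ.reduced →⋆ₙₐ[ℂ] cstarMultiplier (spatialTensor hΛ.reduced hΛ.reduced) where
  toFun x := ⟨hΛ.comulHom x.1, hΛ.comulHom_mem x.2⟩
  map_smul' c x := Subtype.ext (map_smul hΛ.comulHom c x.1)
  map_zero' := Subtype.ext (map_zero hΛ.comulHom)
  map_add' x y := Subtype.ext (map_add hΛ.comulHom x.1 y.1)
  map_mul' x y := Subtype.ext (map_mul hΛ.comulHom x.1 y.1)
  map_star' x := Subtype.ext (map_star hΛ.comulHom x.1)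

theorem IsGNS.coe_reducedComul (x : hΛ.reduced) :
    (hΛ.reducedComul x : HTensor H H →L[ℂ] HTensor H H) = hΛ.comulHom x.1 := rfl

theorem IsGNS.reducedComul_injective : Function.Injective hΛ.reducedComul := by
  intro x y h
  exact Subtype.ext (hΛ.comulHom_injective (congrArg Subtype.val h))

/-- The common pattern of the three density statements: the generators must lie in `C ⊗ C` and must
approximate each `(m ⊗ m)(t)`. -/
theorem IsGNS.closure_span_eq {s : Set (HTensor H H →L[ℂ] HTensor H H)}
    (h1 : s ⊆ spatialTensor hΛ.reduced hΛ.reduced)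
    (h2 : ∀ t, hΛ.leftRegular₂ t ∈ (Submodule.span ℂ s).topologicalClosure) :
    closure (Submodule.span ℂ s : Set (HTensor H H →L[ℂ] HTensor H H)) =
      spatialTensor hΛ.reduced hΛ.reduced := by
  refine Set.Subset.antisymm ?_
    (hΛ.spatialTensor_subset (Submodule.isClosed_topologicalClosure _) h2)
  refine closure_minimal ?_ isClosed_spatialTensor
  exact Submodule.span_le (p := (spatialTensor hΛ.reduced hΛ.reduced).toSubmodule).2 h1

/-- Non-degeneracy is the image under `m ⊗ m` of the essentiality of `Δ`: the products `Δ(a)s`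
generate `A ⊗̂ A`. -/
theorem IsGNS.closure_span_comul_mul :
    closure (Submodule.span ℂ {T : HTensor H H →L[ℂ] HTensor H H |
      ∃ x : hΛ.reduced, ∃ y ∈ spatialTensor hΛ.reduced hΛ.reduced,
        T = (hΛ.reducedComul x).1 * y} : Set (HTensor H H →L[ℂ] HTensor H H)) =
      spatialTensor hΛ.reduced hΛ.reduced := by
  refine hΛ.closure_span_eq ?_ fun t => ?_
  · rintro _ ⟨x, y, hy, rfl⟩
    exact hΛ.comulHom_mul_mem x.2 hy
  · refine map_mem_clm_of_lift_surjective (K := HTensor H H)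
      (f := hΛ.leftRegular₂) G.isCoproduct.surjective
      hΛ.leftRegular₂_isBdd (Submodule.isClosed_topologicalClosure _) (fun a s => ?_) t
    refine Submodule.le_topologicalClosure _ (Submodule.subset_span
      ⟨⟨_, hΛ.leftRegular_mem a⟩, _, hΛ.leftRegular₂_mem s, ?_⟩)
    exact (hΛ.comulHom_mul_leftRegular₂ a s).symm

theorem IsGNS.closure_span_comul_mul_one :
    closure (Submodule.span ℂ {T : HTensor H H →L[ℂ] HTensor H H |
      ∃ x y : hΛ.reduced, T = (hΛ.reducedComul x).1 * opTensor y.1 (1 : H →L[ℂ] H)} :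
        Set (HTensor H H →L[ℂ] HTensor H H)) = spatialTensor hΛ.reduced hΛ.reduced := by
  refine hΛ.closure_span_eq ?_ fun t => ?_
  · rintro _ ⟨x, y, rfl⟩
    set N := (spatialTensor hΛ.reduced hΛ.reduced).toSubmodule
    have hN : IsClosed (N : Set (HTensor H H →L[ℂ] HTensor H H)) := isClosed_spatialTensor
    refine hΛ.map_mem_of_leftRegular (X := HTensor H H →L[ℂ] HTensor H H)
      (LinearMap.mulRight ℂ (opTensor y.1 (1 : H →L[ℂ] H)) ∘ₗ hΛ.comulHom.toAlgHom.toLinearMap)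
      ((continuous_mul_const _).comp hΛ.continuous_comulHom) hN (fun a => ?_) x.2
    refine hΛ.map_mem_of_leftRegular (X := HTensor H H →L[ℂ] HTensor H H)
      (LinearMap.mulLeft ℂ (hΛ.comulHom (hΛ.leftRegular a)) ∘ₗ
      (opTensorBilin H H).flip 1) ((continuous_const_mul _).comp (continuous_opTensor_left 1)) hN
      (fun b => ?_) y.2
    change hΛ.comulHom (hΛ.leftRegular a) * opTensor (hΛ.leftRegular b) 1 ∈ N
    rw [← hΛ.leftRegular₂_galoisL]
    exact hΛ.leftRegular₂_mem _
  -- As `t = γ(s)`, it is enough to treat `γ(a ⊗ b)`, whose image is one of the generators.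
  · obtain ⟨s, rfl⟩ := G.galoisL.surjective t
    refine CTensor.map_mem_clm (K := HTensor H H)
      (f := hΛ.leftRegular₂ ∘ₗ G.galoisL.toLinearMap)
      (hΛ.leftRegular₂_isBdd.comp G.galoisL_isBdd) (Submodule.isClosed_topologicalClosure _)
      (fun a b => ?_) s
    exact Submodule.le_topologicalClosure _ (Submodule.subset_span
      ⟨⟨_, hΛ.leftRegular_mem a⟩, ⟨_, hΛ.leftRegular_mem b⟩, hΛ.leftRegular₂_galoisL a b⟩)

/-- `ρ` produces the products `(1 ⊗ a)Δ(b)`, with the factors in the wrong order for the density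
statement. Conjugating `ρ` by the involution reverses them and stays complex linear. -/
theorem IsGNS.leftRegular₂_starConj_galoisR (a b : A) :
    hΛ.leftRegular₂ (starConj G.galoisR.toLinearMap (CTensor.tmul a b)) =
      hΛ.comulHom (hΛ.leftRegular b) * opTensor 1 (hΛ.leftRegular a) := by
  change hΛ.leftRegular₂ (star (G.galoisR (star (CTensor.tmul a b)))) = _
  rw [hΛ.leftRegular₂_star, CTensor.star_tmul, hΛ.leftRegular₂_galoisR]
  refine (star_mul (R := HTensor H H →L[ℂ] HTensor H H) _ _).trans ?_
  rw [star_opTensor, star_one, ← map_star, ← map_star, ← map_star, star_star, star_star]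

theorem IsGNS.closure_span_comul_one_mul :
    closure (Submodule.span ℂ {T : HTensor H H →L[ℂ] HTensor H H |
      ∃ x y : hΛ.reduced, T = (hΛ.reducedComul x).1 * opTensor (1 : H →L[ℂ] H) y.1} :
        Set (HTensor H H →L[ℂ] HTensor H H)) = spatialTensor hΛ.reduced hΛ.reduced := by
  refine hΛ.closure_span_eq ?_ fun t => ?_
  · rintro _ ⟨x, y, rfl⟩
    set N := (spatialTensor hΛ.reduced hΛ.reduced).toSubmodule
    have hN : IsClosed (N : Set (HTensor H H →L[ℂ] HTensor H H)) := isClosed_spatialTensor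
    refine hΛ.map_mem_of_leftRegular (X := HTensor H H →L[ℂ] HTensor H H)
      (LinearMap.mulRight ℂ (opTensor (1 : H →L[ℂ] H) y.1) ∘ₗ hΛ.comulHom.toAlgHom.toLinearMap)
      ((continuous_mul_const _).comp hΛ.continuous_comulHom) hN (fun a => ?_) x.2
    refine hΛ.map_mem_of_leftRegular (X := HTensor H H →L[ℂ] HTensor H H)
      (LinearMap.mulLeft ℂ (hΛ.comulHom (hΛ.leftRegular a)) ∘ₗ
      opTensorBilin H H 1) ((continuous_const_mul _).comp (continuous_opTensor_right 1)) hN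
      (fun b => ?_) y.2
    change hΛ.comulHom (hΛ.leftRegular a) * opTensor 1 (hΛ.leftRegular b) ∈ N
    rw [← hΛ.leftRegular₂_starConj_galoisR]
    exact hΛ.leftRegular₂_mem _
  -- Surjectivity of `ρ` passes to its conjugate by the involution: solve `ρ(s) = t^*` and use
  -- `s^*`.
  · obtain ⟨s, hs⟩ := G.galoisR.surjective (star t)
    have ht : starConj G.galoisR.toLinearMap (star s) = t := by
      change star (G.galoisR (star (star s))) = t
      rw [star_star, hs, star_star]
    rw [← ht]
    refine CTensor.map_mem_clm (K := HTensor H H)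
      (f := hΛ.leftRegular₂ ∘ₗ starConj G.galoisR.toLinearMap)
      (hΛ.leftRegular₂_isBdd.comp (starConj_bdd G.galoisR_isBdd))
      (Submodule.isClosed_topologicalClosure _) (fun a b => ?_) (star s)
    exact Submodule.le_topologicalClosure _ (Submodule.subset_span
      ⟨⟨_, hΛ.leftRegular_mem b⟩, ⟨_, hΛ.leftRegular_mem a⟩,
        hΛ.leftRegular₂_starConj_galoisR a b⟩)

end Reduced

end BornologicalQuantumGroup

/-! ### Operators on threefold tensor products and extension to multipliers -/

section Operators

variable {X : Type*} [NormedAddCommGroup X] [InnerProductSpace ℂ X] [CompleteSpace X]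
  {Y : Type*} [NormedAddCommGroup Y] [InnerProductSpace ℂ Y] [CompleteSpace Y]
  {Z : Type*} [NormedAddCommGroup Z] [InnerProductSpace ℂ Z] [CompleteSpace Z]

/-- The isomorphism `B(X) → B(Y)` induced by a unitary `X → Y`. -/
noncomputable def conjHom (e : X ≃ₗᵢ[ℂ] Y) : (X →L[ℂ] X) →⋆ₐ[ℂ] (Y →L[ℂ] Y) where
  toFun := e.conjStarAlgEquiv
  map_one' := map_one e.conjStarAlgEquiv
  map_mul' := map_mul e.conjStarAlgEquiv
  map_zero' := map_zero e.conjStarAlgEquiv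
  map_add' := map_add e.conjStarAlgEquiv
  commutes' c := by
    rw [Algebra.algebraMap_eq_smul_one, Algebra.algebraMap_eq_smul_one, map_smul, map_one]
  map_star' := map_star e.conjStarAlgEquiv

theorem conjHom_apply (e : X ≃ₗᵢ[ℂ] Y) (T : X →L[ℂ] X) (y : Y) :
    conjHom e T y = e (T (e.symm y)) := rfl

theorem conjHom_hassoc_symm_opTensor (x : X →L[ℂ] X) (y : Y →L[ℂ] Y) (z : Z →L[ℂ] Z) :
    conjHom (hassoc X Y Z).symm (opTensor x (opTensor y z)) = opTensor (opTensor x y) z := by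
  ext ζ
  rw [conjHom_apply, LinearIsometryEquiv.symm_symm, LinearIsometryEquiv.symm_apply_eq,
    hassoc_opTensor]

theorem conjHom_hleftComm_opTensor (x : X →L[ℂ] X) (y : Y →L[ℂ] Y) (z : Z →L[ℂ] Z) :
    conjHom (hleftComm X Y Z) (opTensor x (opTensor y z)) = opTensor y (opTensor x z) := by
  ext ζ
  rw [conjHom_apply, hleftComm_opTensor, LinearIsometryEquiv.apply_symm_apply]

theorem opTensor_mem_unitary {u : X →L[ℂ] X} {v : Y →L[ℂ] Y} (hu : u ∈ unitary (X →L[ℂ] X))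
    (hv : v ∈ unitary (Y →L[ℂ] Y)) : opTensor u v ∈ unitary (HTensor X Y →L[ℂ] HTensor X Y) := by
  rw [Unitary.mem_iff, star_opTensor]
  constructor
  · rw [opTensor_mul, Unitary.star_mul_self_of_mem hu, Unitary.star_mul_self_of_mem hv,
      opTensor_one]
  · rw [opTensor_mul, Unitary.mul_star_self_of_mem hu, Unitary.mul_star_self_of_mem hv,
      opTensor_one]

/-- The unitary `u ⊗ v`. -/
noncomputable def opTensorUnitary (u : unitary (X →L[ℂ] X)) (v : unitary (Y →L[ℂ] Y)) :
    unitary (HTensor X Y →L[ℂ] HTensor X Y) :=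
  ⟨opTensor u v, opTensor_mem_unitary u.2 v.2⟩

theorem starConjHom_opTensorUnitary (u : unitary (X →L[ℂ] X)) (v : unitary (Y →L[ℂ] Y))
    (x : X →L[ℂ] X) (y : Y →L[ℂ] Y) : starConjHom (opTensorUnitary u v) (opTensor x y) =
      opTensor (starConjHom u x) (starConjHom v y) := by
  rw [starConjHom_apply, starConjHom_apply, starConjHom_apply, ← opTensor_mul, ← opTensor_mul,
    ← star_opTensor]
  rfl

theorem starConjHom_one (x : X →L[ℂ] X) : starConjHom (1 : unitary (X →L[ℂ] X)) x = x := by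
  rw [starConjHom_apply, OneMemClass.coe_one, star_one, one_mul, mul_one]

/-- A non-degenerate `*`-homomorphism restricts to the multiplier algebras. -/
theorem exists_multiplier_extension {D : NonUnitalStarSubalgebra ℂ (X →L[ℂ] X)}
    (Φ : (X →L[ℂ] X) →⋆ₐ[ℂ] (Y →L[ℂ] Y))
    {E : NonUnitalStarSubalgebra ℂ (Y →L[ℂ] Y)} (hE : IsClosed (E : Set (Y →L[ℂ] Y)))
    (h1 : ∀ x ∈ D, ∀ y ∈ E, Φ x * y ∈ E)
    (h2 : ∀ N : Submodule ℂ (Y →L[ℂ] Y), IsClosed (N : Set (Y →L[ℂ] Y)) →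
      (∀ x ∈ D, ∀ y ∈ E, Φ x * y ∈ N) → (E : Set (Y →L[ℂ] Y)) ⊆ N) :
    ∃ F : cstarMultiplier D →⋆ₐ[ℂ] cstarMultiplier E, ∀ T, (F T).1 = Φ T.1 :=
  ⟨(Φ.comp (cstarMultiplier D).subtype).codRestrict (cstarMultiplier E)
    fun T => map_mem_cstarMultiplier Φ hE h1 h2 T.2, fun _ => rfl⟩

/-- Closed subspaces of the operators are pulled back to closed subspaces by `*`-homomorphisms
followed by right multiplication. -/
theorem isClosed_comap_hom_mulRight (Φ : (X →L[ℂ] X) →⋆ₐ[ℂ] (Y →L[ℂ] Y))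
    {N : Submodule ℂ (Y →L[ℂ] Y)} (hN : IsClosed (N : Set (Y →L[ℂ] Y))) (y : Y →L[ℂ] Y) :
    IsClosed ((N.comap (LinearMap.mulRight ℂ y ∘ₗ Φ.toAlgHom.toLinearMap) :
      Submodule ℂ (X →L[ℂ] X)) : Set (X →L[ℂ] X)) :=
  hN.preimage ((continuous_mul_const y).comp (continuous_starAlgHom_clm Φ))

theorem isClosed_comap_opTensor_left {N : Submodule ℂ (HTensor X Y →L[ℂ] HTensor X Y)}
    (hN : IsClosed (N : Set (HTensor X Y →L[ℂ] HTensor X Y))) (y : Y →L[ℂ] Y) :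
    IsClosed ((N.comap ((opTensorBilin X Y).flip y) : Submodule ℂ (X →L[ℂ] X)) :
      Set (X →L[ℂ] X)) :=
  hN.preimage (continuous_opTensor_left y)

theorem isClosed_comap_opTensor_right {N : Submodule ℂ (HTensor X Y →L[ℂ] HTensor X Y)}
    (hN : IsClosed (N : Set (HTensor X Y →L[ℂ] HTensor X Y))) (x : X →L[ℂ] X) :
    IsClosed ((N.comap (opTensorBilin X Y x) : Submodule ℂ (Y →L[ℂ] Y)) :
      Set (Y →L[ℂ] Y)) :=
  hN.preimage (continuous_opTensor_right x)

theorem isClosed_comap_apply {N : Submodule ℂ X} (hN : IsClosed (N : Set X)) (ξ : X) :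
    IsClosed ((N.comap (ContinuousLinearMap.apply ℂ X ξ).toLinearMap :
      Submodule ℂ (X →L[ℂ] X)) : Set (X →L[ℂ] X)) :=
  hN.preimage (ContinuousLinearMap.apply ℂ X ξ).continuous

end Operators

namespace BornologicalQuantumGroup

/-! ### Extensions to multiplier algebras -/

section Extension

variable {A : Type u} [NonUnitalRing A] [Module ℂ A] [IsScalarTower ℂ A A] [SMulCommClass ℂ A A]
  [StarRing A] [StarModule ℂ A] [Bornology A] [BornologicalStarAlgebra A]
  {H : Type v} [NormedAddCommGroup H] [InnerProductSpace ℂ H] [CompleteSpace H]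
  {G : BornologicalQuantumGroup A} {Λ : A →ₗ[ℂ] H} (hΛ : G.IsGNS Λ)

/-- The homomorphism `Δ ⊗ ι` on `B(H ⊗ H)`. -/
noncomputable def IsGNS.comulTensorHom : (HTensor H H →L[ℂ] HTensor H H) →⋆ₐ[ℂ]
    (HTensor (HTensor H H) H →L[ℂ] HTensor (HTensor H H) H) :=
  -- In leg notation `T ↦ W₁₂^* T₂₃ W₁₂`. The formula makes sense on all bounded operators, so no
  -- separate extension to multipliers has to be constructed.
  (starConjHom (opTensorUnitary hΛ.multUnitary 1)).comp
    ((conjHom (hassoc H H H).symm).comp (oneTensorHom H (HTensor H H)))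

/-- The homomorphism `ι ⊗ Δ` on `B(H ⊗ H)`. -/
noncomputable def IsGNS.tensorComulHom : (HTensor H H →L[ℂ] HTensor H H) →⋆ₐ[ℂ]
    (HTensor H (HTensor H H) →L[ℂ] HTensor H (HTensor H H)) :=
  -- In leg notation `T ↦ W₂₃^* T₁₃ W₂₃`; the leg permutation turns `1 ⊗ (x ⊗ y)` into `x ⊗ (1 ⊗
  -- y)`.
  (starConjHom (opTensorUnitary 1 hΛ.multUnitary)).comp
    ((conjHom (hleftComm H H H)).comp (oneTensorHom H (HTensor H H)))

theorem IsGNS.comulTensorHom_opTensor (x y : H →L[ℂ] H) :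
    hΛ.comulTensorHom (opTensor x y) = opTensor (hΛ.comulHom x) y := by
  change starConjHom (opTensorUnitary hΛ.multUnitary 1)
    (conjHom (hassoc H H H).symm (opTensor 1 (opTensor x y))) = _
  rw [conjHom_hassoc_symm_opTensor, starConjHom_opTensorUnitary, starConjHom_one]
  rfl

theorem IsGNS.tensorComulHom_opTensor (x y : H →L[ℂ] H) :
    hΛ.tensorComulHom (opTensor x y) = opTensor x (hΛ.comulHom y) := by
  change starConjHom (opTensorUnitary 1 hΛ.multUnitary)
    (conjHom (hleftComm H H H) (opTensor 1 (opTensor x y))) = _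
  rw [conjHom_hleftComm_opTensor, starConjHom_opTensorUnitary, starConjHom_one]
  rfl

/-- Non-degeneracy of `Δ` as a test for closed subspaces, ready to be applied one tensor factor at a
time. -/
theorem IsGNS.spatialTensor_subset_of_comul_mul
    {N : Submodule ℂ (HTensor H H →L[ℂ] HTensor H H)}
    (hN : IsClosed (N : Set (HTensor H H →L[ℂ] HTensor H H)))
    (h : ∀ x ∈ hΛ.reduced, ∀ y ∈ spatialTensor hΛ.reduced hΛ.reduced, hΛ.comulHom x * y ∈ N) :
    (spatialTensor hΛ.reduced hΛ.reduced : Set (HTensor H H →L[ℂ] HTensor H H)) ⊆ N := by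
  rw [← hΛ.closure_span_comul_mul]
  refine closure_minimal (Submodule.span_le.2 ?_) hN
  rintro _ ⟨x, y, hy, rfl⟩
  exact h x.1 x.2 y hy

theorem IsGNS.comulTensorHom_mul_mem {x : HTensor H H →L[ℂ] HTensor H H}
    (hx : x ∈ spatialTensor hΛ.reduced hΛ.reduced)
    {y : HTensor (HTensor H H) H →L[ℂ] HTensor (HTensor H H) H}
    (hy : y ∈ spatialTensor (spatialTensor hΛ.reduced hΛ.reduced) hΛ.reduced) :
    hΛ.comulTensorHom x * y ∈ spatialTensor (spatialTensor hΛ.reduced hΛ.reduced) hΛ.reduced := by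
  set N := (spatialTensor (spatialTensor hΛ.reduced hΛ.reduced) hΛ.reduced).toSubmodule
  have hN : IsClosed (N : Set (HTensor (HTensor H H) H →L[ℂ] HTensor (HTensor H H) H)) :=
    isClosed_spatialTensor
  refine BornQG.spatialTensor_subset (isClosed_comap_hom_mulRight hΛ.comulTensorHom hN y)
    (fun a ha b hb => ?_) hx
  refine BornQG.spatialTensor_subset
    (isClosed_comap_mulLeft N hN (hΛ.comulTensorHom (opTensor a b))) (fun s hs c hc => ?_) hy
  change hΛ.comulTensorHom (opTensor a b) * opTensor s c ∈
    spatialTensor (spatialTensor hΛ.reduced hΛ.reduced) hΛ.reduced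
  rw [hΛ.comulTensorHom_opTensor, opTensor_mul]
  exact opTensor_mem_spatialTensor (hΛ.comulHom_mul_mem ha hs) (mul_mem hb hc)

theorem IsGNS.tensorComulHom_mul_mem {x : HTensor H H →L[ℂ] HTensor H H}
    (hx : x ∈ spatialTensor hΛ.reduced hΛ.reduced)
    {y : HTensor H (HTensor H H) →L[ℂ] HTensor H (HTensor H H)}
    (hy : y ∈ spatialTensor hΛ.reduced (spatialTensor hΛ.reduced hΛ.reduced)) :
    hΛ.tensorComulHom x * y ∈ spatialTensor hΛ.reduced (spatialTensor hΛ.reduced hΛ.reduced) := by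
  set N := (spatialTensor hΛ.reduced (spatialTensor hΛ.reduced hΛ.reduced)).toSubmodule
  have hN : IsClosed (N : Set (HTensor H (HTensor H H) →L[ℂ] HTensor H (HTensor H H))) :=
    isClosed_spatialTensor
  refine BornQG.spatialTensor_subset (isClosed_comap_hom_mulRight hΛ.tensorComulHom hN y)
    (fun a ha b hb => ?_) hx
  refine BornQG.spatialTensor_subset
    (isClosed_comap_mulLeft N hN (hΛ.tensorComulHom (opTensor a b))) (fun c hc s hs => ?_) hy
  change hΛ.tensorComulHom (opTensor a b) * opTensor c s ∈
    spatialTensor hΛ.reduced (spatialTensor hΛ.reduced hΛ.reduced)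
  rw [hΛ.tensorComulHom_opTensor, opTensor_mul]
  exact opTensor_mem_spatialTensor (mul_mem ha hc) (hΛ.comulHom_mul_mem hb hs)

/-- Non-degeneracy of `Δ ⊗ ι`: use non-degeneracy of `Δ` in the first factor and the density of `C
C` in `C` in the second, through `Δ(a)y ⊗ b b' = (Δ(a) ⊗ b)(y ⊗ b')`. -/
theorem IsGNS.subset_of_comulTensorHom_mul_mem
    {N : Submodule ℂ (HTensor (HTensor H H) H →L[ℂ] HTensor (HTensor H H) H)}
    (hN : IsClosed (N : Set (HTensor (HTensor H H) H →L[ℂ] HTensor (HTensor H H) H)))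
    (h : ∀ x ∈ spatialTensor hΛ.reduced hΛ.reduced,
      ∀ y ∈ spatialTensor (spatialTensor hΛ.reduced hΛ.reduced) hΛ.reduced,
        hΛ.comulTensorHom x * y ∈ N) :
    (spatialTensor (spatialTensor hΛ.reduced hΛ.reduced) hΛ.reduced :
      Set (HTensor (HTensor H H) H →L[ℂ] HTensor (HTensor H H) H)) ⊆ N := by
  refine BornQG.spatialTensor_subset hN fun s hs c hc => ?_
  refine hΛ.spatialTensor_subset_of_comul_mul (isClosed_comap_opTensor_left hN c)
    (fun a ha y hy => ?_) hs
  refine hΛ.reduced_subset_of_mul (isClosed_comap_opTensor_right hN (hΛ.comulHom a * y))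
    (fun b hb b' hb' => ?_) hc
  change opTensor (hΛ.comulHom a * y) (b * b') ∈ N
  rw [← opTensor_mul, ← hΛ.comulTensorHom_opTensor]
  exact h _ (opTensor_mem_spatialTensor ha hb) _ (opTensor_mem_spatialTensor hy hb')

theorem IsGNS.subset_of_tensorComulHom_mul_mem
    {N : Submodule ℂ (HTensor H (HTensor H H) →L[ℂ] HTensor H (HTensor H H))}
    (hN : IsClosed (N : Set (HTensor H (HTensor H H) →L[ℂ] HTensor H (HTensor H H))))
    (h : ∀ x ∈ spatialTensor hΛ.reduced hΛ.reduced,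
      ∀ y ∈ spatialTensor hΛ.reduced (spatialTensor hΛ.reduced hΛ.reduced),
        hΛ.tensorComulHom x * y ∈ N) :
    (spatialTensor hΛ.reduced (spatialTensor hΛ.reduced hΛ.reduced) :
      Set (HTensor H (HTensor H H) →L[ℂ] HTensor H (HTensor H H))) ⊆ N := by
  refine BornQG.spatialTensor_subset hN fun c hc s hs => ?_
  refine hΛ.spatialTensor_subset_of_comul_mul (isClosed_comap_opTensor_right hN c)
    (fun a ha y hy => ?_) hs
  refine hΛ.reduced_subset_of_mul (isClosed_comap_opTensor_left hN (hΛ.comulHom a * y))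
    (fun b hb b' hb' => ?_) hc
  change opTensor (b * b') (hΛ.comulHom a * y) ∈ N
  rw [← opTensor_mul, ← hΛ.tensorComulHom_opTensor]
  exact h _ (opTensor_mem_spatialTensor hb ha) _ (opTensor_mem_spatialTensor hb' hy)

theorem IsGNS.exists_comulTensor :
    ∃ F : cstarMultiplier (spatialTensor hΛ.reduced hΛ.reduced) →⋆ₐ[ℂ]
      cstarMultiplier (spatialTensor (spatialTensor hΛ.reduced hΛ.reduced) hΛ.reduced),
      ∀ T, (F T).1 = hΛ.comulTensorHom T.1 :=
  exists_multiplier_extension hΛ.comulTensorHom isClosed_spatialTensor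
    (fun _ hx _ hy => hΛ.comulTensorHom_mul_mem hx hy)
    fun _ hN h => hΛ.subset_of_comulTensorHom_mul_mem hN h

theorem IsGNS.exists_tensorComul :
    ∃ F : cstarMultiplier (spatialTensor hΛ.reduced hΛ.reduced) →⋆ₐ[ℂ]
      cstarMultiplier (spatialTensor hΛ.reduced (spatialTensor hΛ.reduced hΛ.reduced)),
      ∀ T, (F T).1 = hΛ.tensorComulHom T.1 :=
  exists_multiplier_extension hΛ.tensorComulHom isClosed_spatialTensor
    (fun _ hx _ hy => hΛ.tensorComulHom_mul_mem hx hy)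
    fun _ hN h => hΛ.subset_of_tensorComulHom_mul_mem hN h

/-- The closed span contains `(C ⊗ C)(H ⊗ H)`, as `Δ(C)(C ⊗ C)` spans a dense subspace of `C ⊗ C`;
and `C ⊗ C` acts non-degenerately because `C` does. -/
theorem IsGNS.dense_span_comulHom :
    Dense (Submodule.span ℂ {η : HTensor H H | ∃ x ∈ hΛ.reduced, ∃ ξ, η = hΛ.comulHom x ξ} :
      Set (HTensor H H)) := by
  rw [Submodule.dense_iff_topologicalClosure_eq_top]
  set N := (Submodule.span ℂ {η : HTensor H H | ∃ x ∈ hΛ.reduced, ∃ ξ,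
    η = hΛ.comulHom x ξ}).topologicalClosure
  have hN : IsClosed (N : Set (HTensor H H)) := Submodule.isClosed_topologicalClosure _
  have key : ∀ ζ, ∀ T ∈ spatialTensor hΛ.reduced hΛ.reduced, T ζ ∈ N := by
    intro ζ T hT
    refine hΛ.spatialTensor_subset_of_comul_mul (isClosed_comap_apply hN ζ)
      (fun x hx y _ => ?_) hT
    exact Submodule.le_topologicalClosure _ (Submodule.subset_span ⟨x, hx, y ζ, rfl⟩)
  refine htmul_mem_of_dense hΛ.isNondegenerate_reduced hΛ.isNondegenerate_reduced hN ?_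
  rintro _ ⟨x, hx, ξ, rfl⟩ _ ⟨y, hy, η, rfl⟩
  rw [← opTensor_htmul]
  exact key _ _ (opTensor_mem_spatialTensor hx hy)

end Extension

end BornologicalQuantumGroup

namespace BornologicalQuantumGroup

/-! ### Coassociativity of the coproduct of the reduced `C^*`-algebra -/

section Coassociativity

variable {A : Type u} [NonUnitalRing A] [Module ℂ A] [IsScalarTower ℂ A A] [SMulCommClass ℂ A A]
  [StarRing A] [StarModule ℂ A] [Bornology A] [BornologicalStarAlgebra A]
  {H : Type v} [NormedAddCommGroup H] [InnerProductSpace ℂ H] [CompleteSpace H]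
  {G : BornologicalQuantumGroup A} {Λ : A →ₗ[ℂ] H} (hΛ : G.IsGNS Λ)

theorem IsGNS.subset_closure_span_opTensor :
    (spatialTensor hΛ.reduced hΛ.reduced : Set (HTensor H H →L[ℂ] HTensor H H)) ⊆
      closure (Submodule.span ℂ {T : HTensor H H →L[ℂ] HTensor H H |
        ∃ a b : hΛ.reduced, T = opTensor a.1 b.1} : Set (HTensor H H →L[ℂ] HTensor H H)) := by
  change _ ⊆ ((Submodule.span ℂ {T : HTensor H H →L[ℂ] HTensor H H |
    ∃ a b : hΛ.reduced, T = opTensor a.1 b.1}).topologicalClosure :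
      Set (HTensor H H →L[ℂ] HTensor H H))
  refine BornQG.spatialTensor_subset (Submodule.isClosed_topologicalClosure _)
    fun x hx y hy => ?_
  exact Submodule.le_topologicalClosure _ (Submodule.subset_span ⟨⟨x, hx⟩, ⟨y, hy⟩, rfl⟩)

/-- Uniqueness of the extension. Values are prescribed on elementary tensors of `C ⊗ C`, which span
a dense subspace, and `Δ ⊗ ι` is non-degenerate there, so its values on multipliers are forced. -/
theorem IsGNS.eq_comulTensorHom
    {F : cstarMultiplier (spatialTensor hΛ.reduced hΛ.reduced) →⋆ₐ[ℂ]
      cstarMultiplier (spatialTensor (spatialTensor hΛ.reduced hΛ.reduced) hΛ.reduced)}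
    (hF : ∀ (a b : hΛ.reduced) (T : cstarMultiplier (spatialTensor hΛ.reduced hΛ.reduced)),
      T.1 = opTensor a.1 b.1 → (F T).1 = opTensor (hΛ.reducedComul a).1 b.1)
    (T : cstarMultiplier (spatialTensor hΛ.reduced hΛ.reduced)) :
    (F T).1 = hΛ.comulTensorHom T.1 := by
  obtain ⟨F', hF'⟩ := hΛ.exists_comulTensor
  rw [← hF']
  have : F' = F := by
    refine starAlgHom_multiplier_ext (K := HTensor H H)
      (D := spatialTensor hΛ.reduced hΛ.reduced) isClosed_spatialTensor isClosed_spatialTensor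
      (s := {T : HTensor H H →L[ℂ] HTensor H H | ∃ a b : hΛ.reduced, T = opTensor a.1 b.1})
      ?_ hΛ.subset_closure_span_opTensor ?_ ?_
    · rintro _ ⟨a, b, rfl⟩
      exact opTensor_mem_spatialTensor a.2 b.2
    · rintro T ⟨a, b, hT⟩
      have h1 : hΛ.comulTensorHom T.1 = hΛ.comulTensorHom (opTensor a.1 b.1) := congrArg _ hT
      exact Subtype.ext (((hF' T).trans h1).trans
        ((hΛ.comulTensorHom_opTensor a.1 b.1).trans (hF a b T hT).symm))
    · rw [Submodule.dense_iff_topologicalClosure_eq_top]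
      -- The vectors `Δ(x)ξ ⊗ y η` are values of `Δ ⊗ ι` on `x ⊗ y`, and they span a dense subspace
      -- leg by leg.
      refine htmul_mem_of_dense hΛ.dense_span_comulHom hΛ.isNondegenerate_reduced
        (Submodule.isClosed_topologicalClosure _) ?_
      rintro _ ⟨x, hx, ξ, rfl⟩ _ ⟨y, hy, η, rfl⟩
      refine Submodule.le_topologicalClosure _ (Submodule.subset_span
        ⟨⟨opTensor x y, mem_cstarMultiplier_of_mem (opTensor_mem_spatialTensor hx hy)⟩,
          ⟨⟨x, hx⟩, ⟨y, hy⟩, rfl⟩, htmul ξ η, ?_⟩)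
      rw [hF', hΛ.comulTensorHom_opTensor, opTensor_htmul]
  rw [this]

theorem IsGNS.eq_tensorComulHom
    {F : cstarMultiplier (spatialTensor hΛ.reduced hΛ.reduced) →⋆ₐ[ℂ]
      cstarMultiplier (spatialTensor hΛ.reduced (spatialTensor hΛ.reduced hΛ.reduced))}
    (hF : ∀ (a b : hΛ.reduced) (T : cstarMultiplier (spatialTensor hΛ.reduced hΛ.reduced)),
      T.1 = opTensor a.1 b.1 → (F T).1 = opTensor a.1 (hΛ.reducedComul b).1)
    (T : cstarMultiplier (spatialTensor hΛ.reduced hΛ.reduced)) :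
    (F T).1 = hΛ.tensorComulHom T.1 := by
  obtain ⟨F', hF'⟩ := hΛ.exists_tensorComul
  rw [← hF']
  have : F' = F := by
    refine starAlgHom_multiplier_ext (K := HTensor H H)
      (D := spatialTensor hΛ.reduced hΛ.reduced) isClosed_spatialTensor isClosed_spatialTensor
      (s := {T : HTensor H H →L[ℂ] HTensor H H | ∃ a b : hΛ.reduced, T = opTensor a.1 b.1})
      ?_ hΛ.subset_closure_span_opTensor ?_ ?_
    · rintro _ ⟨a, b, rfl⟩
      exact opTensor_mem_spatialTensor a.2 b.2
    · rintro T ⟨a, b, hT⟩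
      have h1 : hΛ.tensorComulHom T.1 = hΛ.tensorComulHom (opTensor a.1 b.1) := congrArg _ hT
      exact Subtype.ext (((hF' T).trans h1).trans
        ((hΛ.tensorComulHom_opTensor a.1 b.1).trans (hF a b T hT).symm))
    · rw [Submodule.dense_iff_topologicalClosure_eq_top]
      refine htmul_mem_of_dense hΛ.isNondegenerate_reduced hΛ.dense_span_comulHom
        (Submodule.isClosed_topologicalClosure _) ?_
      rintro _ ⟨x, hx, ξ, rfl⟩ _ ⟨y, hy, η, rfl⟩
      refine Submodule.le_topologicalClosure _ (Submodule.subset_span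
        ⟨⟨opTensor x y, mem_cstarMultiplier_of_mem (opTensor_mem_spatialTensor hx hy)⟩,
          ⟨⟨x, hx⟩, ⟨y, hy⟩, rfl⟩, htmul ξ η, ?_⟩)
      rw [hF', hΛ.tensorComulHom_opTensor, opTensor_htmul]
  rw [this]

/-- The bounded map `(Λ ⊗ Λ) ⊗ Λ`. -/
noncomputable def IsGNS.map₃ : CTensor (CTensor A A) A →ₗ[ℂ] HTensor (HTensor H H) H :=
  hmap hΛ.map₂ Λ hΛ.map₂_isBdd hΛ.bdd

/-- The bounded map `Λ ⊗ (Λ ⊗ Λ)`. -/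
noncomputable def IsGNS.map₃' : CTensor A (CTensor A A) →ₗ[ℂ] HTensor H (HTensor H H) :=
  hmap Λ hΛ.map₂ hΛ.bdd hΛ.map₂_isBdd

theorem IsGNS.map₃_isBdd : IsBddMap hΛ.map₃ := hmap_isBdd _ _

theorem IsGNS.map₃'_isBdd : IsBddMap hΛ.map₃' := hmap_isBdd _ _

theorem IsGNS.map₃_tmul (t : CTensor A A) (c : A) :
    hΛ.map₃ (CTensor.tmul t c) = htmul (hΛ.map₂ t) (Λ c) := hmap_tmul _ _ t c

theorem IsGNS.map₃'_tmul (c : A) (t : CTensor A A) :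
    hΛ.map₃' (CTensor.tmul c t) = htmul (Λ c) (hΛ.map₂ t) := hmap_tmul _ _ c t

theorem IsGNS.denseRange_map₃ : DenseRange hΛ.map₃ :=
  denseRange_hmap _ _ hΛ.denseRange_map₂ hΛ.dense

theorem IsGNS.hassoc_map₃ (y : CTensor (CTensor A A) A) :
    hassoc H H H (hΛ.map₃ y) = hΛ.map₃' (CTensor.assoc A A A y) :=
  hassoc_hmap hΛ.bdd hΛ.bdd hΛ.bdd y

variable (G) in
/-- The action of `A ⊗̂ A` on `(A ⊗̂ A) ⊗̂ A` defined by `Δ ⊗ ι`. -/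
noncomputable def comulTensorAct : CTensor A A →ₗ[ℂ] CTensor (CTensor A A) A →ₗ[ℂ]
    CTensor (CTensor A A) A :=
  CTensor.map₂ (actL G.comul) (LinearMap.mul ℂ A) G.isCoproduct.bdd_left bdd_mulL

variable (G) in
/-- The action of `A ⊗̂ A` on `A ⊗̂ (A ⊗̂ A)` defined by `ι ⊗ Δ`. -/
noncomputable def tensorComulAct : CTensor A A →ₗ[ℂ] CTensor A (CTensor A A) →ₗ[ℂ]
    CTensor A (CTensor A A) :=
  CTensor.map₂ (LinearMap.mul ℂ A) (actL G.comul) bdd_mulL G.isCoproduct.bdd_left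

theorem comulTensorAct_isBdd : IsBddMap₂ fun x t => G.comulTensorAct x t :=
  CTensor.map₂_isBdd _ _ _ _

theorem tensorComulAct_isBdd : IsBddMap₂ fun x t => G.tensorComulAct x t :=
  CTensor.map₂_isBdd _ _ _ _

theorem comulTensorAct_tmul (a b : A) (s : CTensor A A) (c : A) :
    G.comulTensorAct (CTensor.tmul a b) (CTensor.tmul s c) =
      CTensor.tmul ((G.comul a).left s) (b * c) := by
  rw [comulTensorAct, CTensor.map₂_tmul, CTensor.map_tmul]
  rfl

theorem tensorComulAct_tmul (a b c : A) (s : CTensor A A) :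
    G.tensorComulAct (CTensor.tmul a b) (CTensor.tmul c s) =
      CTensor.tmul (a * c) ((G.comul b).left s) := by
  rw [tensorComulAct, CTensor.map₂_tmul, CTensor.map_tmul]
  rfl

/-- On GNS vectors the operator `(Δ ⊗ ι)((m ⊗ m)(x))` is the algebraic action of `(Δ ⊗ ι)(x)`.
Elementary tensors reduce this to the same fact for `Δ`, and both variables extend by boundedness.
-/
theorem IsGNS.comulTensorHom_leftRegular₂_map₃ (x : CTensor A A) (y : CTensor (CTensor A A) A) :
    hΛ.comulTensorHom (hΛ.leftRegular₂ x) (hΛ.map₃ y) = hΛ.map₃ (G.comulTensorAct x y) := by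
  have h1 : ∀ a b, hΛ.comulTensorHom (hΛ.leftRegular₂ (CTensor.tmul a b)) (hΛ.map₃ y) =
      hΛ.map₃ (G.comulTensorAct (CTensor.tmul a b) y) := by
    intro a b
    have : (hΛ.comulTensorHom (hΛ.leftRegular₂ (CTensor.tmul a b))).toLinearMap ∘ₗ hΛ.map₃ =
        hΛ.map₃ ∘ₗ G.comulTensorAct (CTensor.tmul a b) := by
      refine CTensor.hom_ext
        (hΛ.map₃_isBdd.clm_comp (hΛ.comulTensorHom (hΛ.leftRegular₂ (CTensor.tmul a b))))
        (hΛ.map₃_isBdd.comp (comulTensorAct_isBdd.right _)) fun s c => ?_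
      change hΛ.comulTensorHom (hΛ.leftRegular₂ (CTensor.tmul a b))
        (hΛ.map₃ (CTensor.tmul s c)) = hΛ.map₃ (G.comulTensorAct (CTensor.tmul a b)
          (CTensor.tmul s c))
      rw [hΛ.leftRegular₂_tmul, hΛ.comulTensorHom_opTensor, comulTensorAct_tmul, hΛ.map₃_tmul,
        hΛ.map₃_tmul, opTensor_htmul, hΛ.comulHom_leftRegular_map₂, hΛ.leftRegular_apply]
    exact LinearMap.congr_fun this y
  let f : CTensor A A →ₗ[ℂ] HTensor (HTensor H H) H :=
    ((ContinuousLinearMap.apply ℂ _ (hΛ.map₃ y)).toLinearMap ∘ₗ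
      hΛ.comulTensorHom.toAlgHom.toLinearMap) ∘ₗ hΛ.leftRegular₂
  have hf : IsBddMap f := hΛ.leftRegular₂_isBdd.clm_comp
    ((ContinuousLinearMap.apply ℂ _ (hΛ.map₃ y)).comp
      (⟨hΛ.comulTensorHom.toAlgHom.toLinearMap, continuous_starAlgHom_clm _⟩ : _ →L[ℂ] _))
  have : f = hΛ.map₃ ∘ₗ G.comulTensorAct.flip y :=
    CTensor.hom_ext hf (hΛ.map₃_isBdd.comp (comulTensorAct_isBdd.left y)) h1
  exact LinearMap.congr_fun this x

theorem IsGNS.tensorComulHom_leftRegular₂_map₃' (x : CTensor A A)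
    (y : CTensor A (CTensor A A)) :
    hΛ.tensorComulHom (hΛ.leftRegular₂ x) (hΛ.map₃' y) = hΛ.map₃' (G.tensorComulAct x y) := by
  have h1 : ∀ a b, hΛ.tensorComulHom (hΛ.leftRegular₂ (CTensor.tmul a b)) (hΛ.map₃' y) =
      hΛ.map₃' (G.tensorComulAct (CTensor.tmul a b) y) := by
    intro a b
    have : (hΛ.tensorComulHom (hΛ.leftRegular₂ (CTensor.tmul a b))).toLinearMap ∘ₗ hΛ.map₃' =
        hΛ.map₃' ∘ₗ G.tensorComulAct (CTensor.tmul a b) := by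
      refine CTensor.hom_ext
        (hΛ.map₃'_isBdd.clm_comp (hΛ.tensorComulHom (hΛ.leftRegular₂ (CTensor.tmul a b))))
        (hΛ.map₃'_isBdd.comp (tensorComulAct_isBdd.right _)) fun c s => ?_
      change hΛ.tensorComulHom (hΛ.leftRegular₂ (CTensor.tmul a b))
        (hΛ.map₃' (CTensor.tmul c s)) = hΛ.map₃' (G.tensorComulAct (CTensor.tmul a b)
          (CTensor.tmul c s))
      rw [hΛ.leftRegular₂_tmul, hΛ.tensorComulHom_opTensor, tensorComulAct_tmul, hΛ.map₃'_tmul,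
        hΛ.map₃'_tmul, opTensor_htmul, hΛ.comulHom_leftRegular_map₂, hΛ.leftRegular_apply]
    exact LinearMap.congr_fun this y
  let f : CTensor A A →ₗ[ℂ] HTensor H (HTensor H H) :=
    ((ContinuousLinearMap.apply ℂ _ (hΛ.map₃' y)).toLinearMap ∘ₗ
      hΛ.tensorComulHom.toAlgHom.toLinearMap) ∘ₗ hΛ.leftRegular₂
  have hf : IsBddMap f := hΛ.leftRegular₂_isBdd.clm_comp
    ((ContinuousLinearMap.apply ℂ _ (hΛ.map₃' y)).comp
      (⟨hΛ.tensorComulHom.toAlgHom.toLinearMap, continuous_starAlgHom_clm _⟩ : _ →L[ℂ] _))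
  have : f = hΛ.map₃' ∘ₗ G.tensorComulAct.flip y :=
    CTensor.hom_ext hf (hΛ.map₃'_isBdd.comp (tensorComulAct_isBdd.left y)) h1
  exact LinearMap.congr_fun this x

/-- Maps on `(A ⊗̂ A) ⊗̂ A` are determined by their values on `(Δ ⊗ ι)(A ⊗̂ A) ((A ⊗̂ A) ⊗̂ A)`. -/
theorem ext_of_comulTensorAct {X : Type*} [NormedAddCommGroup X] [NormedSpace ℂ X]
    [CompleteSpace X] {f g : CTensor (CTensor A A) A →ₗ[ℂ] X} (hf : IsBddMap f) (hg : IsBddMap g)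
    (h : ∀ x y, f (G.comulTensorAct x y) = g (G.comulTensorAct x y)) : f = g := by
  refine CTensor.hom_ext hf hg fun s c => ?_
  have h2 : ∀ a t, f (CTensor.tmul ((G.comul a).left t) c) =
      g (CTensor.tmul ((G.comul a).left t) c) := by
    intro a t
    have hb : IsBddMap (CTensor.tmulBilin (CTensor A A) A ((G.comul a).left t)) :=
      CTensor.tmulBilin_isBdd.right _
    have : f ∘ₗ CTensor.tmulBilin (CTensor A A) A ((G.comul a).left t) =
        g ∘ₗ CTensor.tmulBilin (CTensor A A) A ((G.comul a).left t) := by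
      -- Essentiality of `A` replaces `c` by products `v w`, and `Δ(a)t ⊗ v w` is the action of `a ⊗
      -- v` on `t ⊗ w`. Essentiality of `Δ` afterwards replaces `s` by the elements `Δ(a)t`.
      refine ext_of_lift_surjective G.essential.surjective (hf.comp hb) (hg.comp hb) fun v w => ?_
      have := h (CTensor.tmul a v) (CTensor.tmul t w)
      rwa [comulTensorAct_tmul] at this
    exact LinearMap.congr_fun this c
  have hb : IsBddMap ((CTensor.tmulBilin (CTensor A A) A).flip c) :=
    CTensor.tmulBilin_isBdd.left c
  have : f ∘ₗ (CTensor.tmulBilin (CTensor A A) A).flip c =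
      g ∘ₗ (CTensor.tmulBilin (CTensor A A) A).flip c :=
    ext_of_lift_surjective G.isCoproduct.surjective (hf.comp hb) (hg.comp hb) h2
  exact LinearMap.congr_fun this s

/-- Maps on `A ⊗̂ (A ⊗̂ A)` are determined by their values on `(ι ⊗ Δ)(A ⊗̂ A) (A ⊗̂ (A ⊗̂ A))`. -/
theorem ext_of_tensorComulAct {X : Type*} [NormedAddCommGroup X] [NormedSpace ℂ X]
    [CompleteSpace X] {f g : CTensor A (CTensor A A) →ₗ[ℂ] X} (hf : IsBddMap f) (hg : IsBddMap g)
    (h : ∀ x y, f (G.tensorComulAct x y) = g (G.tensorComulAct x y)) : f = g := by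
  refine CTensor.hom_ext hf hg fun c s => ?_
  have h2 : ∀ a t, f (CTensor.tmul c ((G.comul a).left t)) =
      g (CTensor.tmul c ((G.comul a).left t)) := by
    intro a t
    have hb : IsBddMap ((CTensor.tmulBilin A (CTensor A A)).flip ((G.comul a).left t)) :=
      CTensor.tmulBilin_isBdd.left _
    have : f ∘ₗ (CTensor.tmulBilin A (CTensor A A)).flip ((G.comul a).left t) =
        g ∘ₗ (CTensor.tmulBilin A (CTensor A A)).flip ((G.comul a).left t) := by
      refine ext_of_lift_surjective G.essential.surjective (hf.comp hb) (hg.comp hb) fun v w => ?_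
      have := h (CTensor.tmul v a) (CTensor.tmul w t)
      rwa [tensorComulAct_tmul] at this
    exact LinearMap.congr_fun this c
  have hb : IsBddMap (CTensor.tmulBilin A (CTensor A A) c) :=
    CTensor.tmulBilin_isBdd.right c
  have : f ∘ₗ CTensor.tmulBilin A (CTensor A A) c =
      g ∘ₗ CTensor.tmulBilin A (CTensor A A) c :=
    ext_of_lift_surjective G.isCoproduct.surjective (hf.comp hb) (hg.comp hb) h2
  exact LinearMap.congr_fun this s

/-- The operator satisfies the relation that characterizes `d = (Δ ⊗ ι)(Δ(a))`: by multiplicativity,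
applying it after `(Δ ⊗ ι)((m ⊗ m)(x))` gives `(Δ ⊗ ι)((m ⊗ m)(Δ(a)x))`. Vectors of the form used
here suffice by essentiality. -/
theorem IsGNS.comulTensorHom_comulHom_map₃ {a : A} {d : Multiplier (CTensor (CTensor A A) A)}
    (hd : ∀ x y, d.left (G.comulTensorAct x y) = G.comulTensorAct ((G.comul a).left x) y)
    (z : CTensor (CTensor A A) A) :
    hΛ.comulTensorHom (hΛ.comulHom (hΛ.leftRegular a)) (hΛ.map₃ z) = hΛ.map₃ (d.left z) := by
  have : (hΛ.comulTensorHom (hΛ.comulHom (hΛ.leftRegular a))).toLinearMap ∘ₗ hΛ.map₃ =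
      hΛ.map₃ ∘ₗ d.left := by
    refine ext_of_comulTensorAct (G := G)
      (hΛ.map₃_isBdd.clm_comp (hΛ.comulTensorHom (hΛ.comulHom (hΛ.leftRegular a))))
      (hΛ.map₃_isBdd.comp d.left_bdd) fun x y => ?_
    change hΛ.comulTensorHom (hΛ.comulHom (hΛ.leftRegular a)) (hΛ.map₃ (G.comulTensorAct x y)) =
      hΛ.map₃ (d.left (G.comulTensorAct x y))
    rw [hd, ← hΛ.comulTensorHom_leftRegular₂_map₃, ← hΛ.comulTensorHom_leftRegular₂_map₃,
      ← hΛ.comulHom_mul_leftRegular₂, map_mul, mul_apply_eq_comp]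
  exact LinearMap.congr_fun this z

theorem IsGNS.tensorComulHom_comulHom_map₃' {a : A} {d : Multiplier (CTensor A (CTensor A A))}
    (hd : ∀ x y, d.left (G.tensorComulAct x y) = G.tensorComulAct ((G.comul a).left x) y)
    (z : CTensor A (CTensor A A)) :
    hΛ.tensorComulHom (hΛ.comulHom (hΛ.leftRegular a)) (hΛ.map₃' z) = hΛ.map₃' (d.left z) := by
  have : (hΛ.tensorComulHom (hΛ.comulHom (hΛ.leftRegular a))).toLinearMap ∘ₗ hΛ.map₃' =
      hΛ.map₃' ∘ₗ d.left := by
    refine ext_of_tensorComulAct (G := G)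
      (hΛ.map₃'_isBdd.clm_comp (hΛ.tensorComulHom (hΛ.comulHom (hΛ.leftRegular a))))
      (hΛ.map₃'_isBdd.comp d.left_bdd) fun x y => ?_
    change hΛ.tensorComulHom (hΛ.comulHom (hΛ.leftRegular a)) (hΛ.map₃' (G.tensorComulAct x y)) =
      hΛ.map₃' (d.left (G.tensorComulAct x y))
    rw [hd, ← hΛ.tensorComulHom_leftRegular₂_map₃', ← hΛ.tensorComulHom_leftRegular₂_map₃',
      ← hΛ.comulHom_mul_leftRegular₂, map_mul, mul_apply_eq_comp]
  exact LinearMap.congr_fun this z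

/-- Both operators are compared on the dense set of reassociated vectors `(Λ ⊗ Λ) ⊗ Λ`, where they
act by the two multipliers that coassociativity of `A` identifies through the associator. -/
theorem IsGNS.hassoc_comulTensorHom_comulHom_leftRegular (a : A) :
    conjHom (hassoc H H H) (hΛ.comulTensorHom (hΛ.comulHom (hΛ.leftRegular a))) =
      hΛ.tensorComulHom (hΛ.comulHom (hΛ.leftRegular a)) := by
  obtain ⟨d, d', hd, hd', hdd, -⟩ := G.isCoproduct.coassoc a
  have hdense : DenseRange fun y => hassoc H H H (hΛ.map₃ y) :=
    (hassoc H H H).surjective.denseRange.comp hΛ.denseRange_map₃ (hassoc H H H).continuous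
  refine clm_ext_of_denseRange hdense fun z => ?_
  rw [conjHom_apply, LinearIsometryEquiv.symm_apply_apply, hΛ.comulTensorHom_comulHom_map₃ hd.1,
    hΛ.hassoc_map₃, hΛ.hassoc_map₃, hΛ.tensorComulHom_comulHom_map₃' hd'.1, hdd]

theorem IsGNS.hassoc_comulTensorHom_comulHom {x : H →L[ℂ] H} (hx : x ∈ hΛ.reduced) :
    conjHom (hassoc H H H) (hΛ.comulTensorHom (hΛ.comulHom x)) =
      hΛ.tensorComulHom (hΛ.comulHom x) := by
  have h1 : Continuous fun x => conjHom (hassoc H H H) (hΛ.comulTensorHom (hΛ.comulHom x)) :=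
    (continuous_starAlgHom_clm _).comp
      ((continuous_starAlgHom_clm hΛ.comulTensorHom).comp hΛ.continuous_comulHom)
  have h2 : Continuous fun x => hΛ.tensorComulHom (hΛ.comulHom x) :=
    (continuous_starAlgHom_clm hΛ.tensorComulHom).comp hΛ.continuous_comulHom
  -- All homomorphisms involved are norm continuous, so the identity extends from `m(A)` to its
  -- closure.
  refine closure_minimal (t := {x | conjHom (hassoc H H H) (hΛ.comulTensorHom (hΛ.comulHom x)) =
    hΛ.tensorComulHom (hΛ.comulHom x)}) ?_ (isClosed_eq h1 h2) hx
  rintro _ ⟨a, rfl⟩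
  exact hΛ.hassoc_comulTensorHom_comulHom_leftRegular a

theorem IsGNS.isCStarCoassociative : IsCStarCoassociative hΛ.reduced hΛ.reducedComul := by
  refine ⟨?_, ?_, fun F F' hF hF' x ζ => ?_⟩
  · obtain ⟨F, hF⟩ := hΛ.exists_comulTensor
    refine ⟨F, fun a b T hT => ?_⟩
    rw [hF, hT, hΛ.comulTensorHom_opTensor]
    rfl
  · obtain ⟨F, hF⟩ := hΛ.exists_tensorComul
    refine ⟨F, fun a b T hT => ?_⟩
    rw [hF, hT, hΛ.tensorComulHom_opTensor]
    rfl
  · rw [hΛ.eq_comulTensorHom hF, hΛ.eq_tensorComulHom hF', hΛ.coe_reducedComul,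
      ← hΛ.hassoc_comulTensorHom_comulHom x.2, conjHom_apply,
      LinearIsometryEquiv.symm_apply_apply]

end Coassociativity

end BornologicalQuantumGroup

end BornQG

/-! ### The main theorem -/

theorem mainTheorem8 {A : Type u} [NonUnitalRing A] [Module ℂ A] [IsScalarTower ℂ A A]
    [SMulCommClass ℂ A A] [StarRing A] [StarModule ℂ A] [Bornology A] [BornologicalStarAlgebra A]
    (hA : ApproximationProperty A) (G : BornologicalQuantumGroup A)
    {H : Type v} [NormedAddCommGroup H] [InnerProductSpace ℂ H] [CompleteSpace H]
    (Λ : A →ₗ[ℂ] H) (hΛ : G.IsGNS Λ) :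
    (∀ f : A, ∃ T : H →L[ℂ] H, ∀ g : A, T (Λ g) = Λ (f * g)) ∧
    ∃ W : HTensor H H →L[ℂ] HTensor H H,
      G.IsMultiplicativeUnitary hΛ W ∧ (∀ W', G.IsMultiplicativeUnitary hΛ W' → W' = W) ∧
      ∃ C : NonUnitalStarSubalgebra ℂ (H →L[ℂ] H),
        (C : Set (H →L[ℂ] H)) = BornologicalQuantumGroup.reducedFunctions Λ ∧
        IsClosed (C : Set (H →L[ℂ] H)) ∧
        IsNondegenerate C ∧
        ∃ Δ : C →⋆ₙₐ[ℂ] cstarMultiplier (spatialTensor C C),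
          (∀ x : C, (Δ x : HTensor H H →L[ℂ] HTensor H H) = star W * opTensor (1 : H →L[ℂ] H) x.1 * W) ∧
          Function.Injective Δ ∧
          closure (Submodule.span ℂ {T : HTensor H H →L[ℂ] HTensor H H |
            ∃ x : C, ∃ y ∈ spatialTensor C C, T = (Δ x).1 * y} : Set (HTensor H H →L[ℂ] HTensor H H)) = spatialTensor C C ∧
          IsCStarCoassociative C Δ ∧
          closure (Submodule.span ℂ {T : HTensor H H →L[ℂ] HTensor H H |
            ∃ x y : C, T = (Δ x).1 * opTensor y.1 (1 : H →L[ℂ] H)} : Set (HTensor H H →L[ℂ] HTensor H H)) = spatialTensor C C ∧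
          closure (Submodule.span ℂ {T : HTensor H H →L[ℂ] HTensor H H |
            ∃ x y : C, T = (Δ x).1 * opTensor (1 : H →L[ℂ] H) y.1} : Set (HTensor H H →L[ℂ] HTensor H H)) = spatialTensor C C := by
  refine ⟨fun f => ⟨hΛ.leftRegular f, hΛ.leftRegular_apply f⟩, hΛ.multUnitary,
    hΛ.isMultiplicativeUnitary, fun W' hW' => hΛ.eq_multUnitary hW', hΛ.reduced, hΛ.coe_reduced,
    hΛ.isClosed_reduced, hΛ.isNondegenerate_reduced, hΛ.reducedComul, fun x => ?_,
    hΛ.reducedComul_injective, hΛ.closure_span_comul_mul, hΛ.isCStarCoassociative,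
    hΛ.closure_span_comul_mul_one, hΛ.closure_span_comul_one_mul⟩
  exact hΛ.comulHom_apply x.1
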